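/- Let $d\ge 1$ and $k\ge 3$ be integers and let $\mathbb F\in\{\mathbb R,\mathbb C\}$. Let $K_n^k$ be the complete $k$-partite $k$-uniform hypergraph with vertex classes $V_1,\dots,V_k$ of size $n$; its hyperedges are the sets containing exactly one vertex of each class. A point configuration is a tuple $\mathbf p=(p_v)_{v\in V_1\cup\dots\cup V_k}$ with $p_v\in\mathbb F^d$; it is generic if its $dkn$ coordinates $p_{v,j}$ are algebraically independent over $\mathbb Q$. Put $\sigma(\mathbf p)=\bigl(\sum_{j=1}^d\prod_{v\in e}p_{v,j}\bigr)_{e\in E(K_n^k)}$, and for a spanning subgraph $G\subseteq K_n^k$ let $f_G(\mathbf p)$ be the restriction of $\sigma(\mathbf p)$ to the coordinates $e\in E(G)$. Configurations $\mathbf p,\mathbf q$ are congruent if there are a $d\times d$ permutation matrix $\Sigma$ and diagonal matrices $D_1,\dots,D_k$ with $D_1\cdots D_k=I$ such that $q_v=D_i\Sigma p_v$ for all $i$ and all $v\in V_i$. The subgraph $G$ is locally rigid in $\mathbb F^d$ if every generic $\mathbf p$ has a neighbourhood in which every $\mathbf q$ with $f_G(\mathbf q)=f_G(\mathbf p)$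 is congruent to $\mathbf p$. The generic tensor rigidity matroid $\mathcal T_{n,d}$ is the row matroid, on $E(K_n^k)$, of the Jacobian matrix of $\sigma$ at a (equivalently, any) generic $\mathbf p$. Add the hyperedges of $K_n^k$ one at a time in uniformly random order, let $G(n,m)$ be the subgraph formed by the first $m$ of them, and let $M_d$ be the least $m$ such that every vertex of $G(n,m)$ has degree at least $d$. Let $G(n,p)$ be the random subgraph of $K_n^k$ in which each hyperedge is kept independently with probability $p$. All limits are as $n\to\infty$ with $k,d,\mathbb F$ fixed, and "asymptotically almost surely" means with probability tending to $1$. 1. Asymptotically almost surely, $G(n,M_d)$ is locally rigid in $\mathbb F^d$. 2. Asymptotically almost surely, the edge set of $G(n,M_d)$ has rank $dkn-d(k-1)$ in $\mathcal T_{n,d}$. These two properties are equivalent: for every $n\ge1$, a subgraph $G\subseteq K_n^k$ is locally rigid in $\mathbb F^d$ if and only if $E(G)$ has rank $dkn-d(k-1)$ in $\mathcal T_{n,d}$ (computed at any generic configuration). 3. $p=\dfrac{\log n+(d-1)\log\log n+o(\log\log n)}{n^{k-1}}$ is the sharp threshold for local rigidity of $G(n,p)$ in $\mathbb F^d$, in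 the following sense. Let $p(n)\in[0,1]$. If $p(n)\ge \dfrac{\log n+(d-1)\log\log n+\log\log\log n}{n^{k-1}}$ for all large $n$, then asymptotically almost surely $G(n,p(n))$ is locally rigid in $\mathbb F^d$. If $p(n)\le \dfrac{\log n+(d-1)\log\log n-\log\log\log n}{n^{k-1}}$ for all large $n$, then asymptotically almost surely $G(n,p(n))$ is not locally rigid in $\mathbb F^d$. -/

import Mathlib

open Filter Topology Finset Matrix

noncomputable section

namespace TensorRigidity

/-! ### The complete `k`-partite `k`-graph and its spanning subgraphs

The vertex `v` of the `i`-th class of `K_n^k` is the pair `(i, v) : Fin k × Fin n`; a hyperedge is a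
transversal, that is, a choice `e i` of one vertex in each class `i`. A spanning subgraph of `K_n^k`
is given by its finite set of hyperedges. -/

/-- Hyperedges of `K_n^k`. -/
abbrev Edge (k n : ℕ) : Type := Fin k → Fin n

/-- Spanning subgraphs of `K_n^k`. -/
abbrev Subgraph (k n : ℕ) : Type := Finset (Edge k n)

/-- The number of hyperedges of `G` that contain the vertex `v` of the `i`-th class. -/
def degree {k n : ℕ} (G : Subgraph k n) (i : Fin k) (v : Fin n) : ℕ :=
  #{e ∈ G | e i = v}

/-- Every vertex of `G` has degree at least `d`. -/
def MinDegreeGE {k n : ℕ} (d : ℕ) (G : Subgraph k n) : Prop :=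
  ∀ (i : Fin k) (v : Fin n), d ≤ degree G i v

/-! ### Point configurations and local rigidity -/

/-- `d`-dimensional point configurations: `p i v` is the point of `𝔽^d` at the vertex `(i, v)`. -/
abbrev Config (𝔽 : Type*) (k n d : ℕ) : Type _ := Fin k → Fin n → Fin d → 𝔽

/-- The `d`-sum of the Segre map: `p ↦ (∑ j, ∏ i, p_{i, e i, j})_e`. -/
def segre {𝔽 : Type*} [CommSemiring 𝔽] {k n d : ℕ} (p : Config 𝔽 k n d) : Edge k n → 𝔽 :=
  fun e => ∑ j, ∏ i, p i (e i) j

/-- The rigidity map of `G`: the coordinates of `segre p` at the hyperedges of `G`. -/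
def rigidityMap {𝔽 : Type*} [CommSemiring 𝔽] {k n d : ℕ} (G : Subgraph k n)
    (p : Config 𝔽 k n d) : G → 𝔽 :=
  fun e => segre p e

/-- `(A_1, …, A_k) ∈ GL(d, 𝔽)^k` is a stabilizer: `A_i = D_i Σ` with one permutation matrix `Σ` and
diagonal matrices `D_i` whose product is the identity. -/
def IsStabilizer {𝔽 : Type*} [CommRing 𝔽] {k d : ℕ} (A : Fin k → GL (Fin d) 𝔽) : Prop :=
  ∃ (s : Equiv.Perm (Fin d)) (D : Fin k → Fin d → 𝔽), (∀ j, ∏ i, D i j = 1) ∧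
    ∀ i, (A i : Matrix (Fin d) (Fin d) 𝔽) = Matrix.diagonal (D i) * s.permMatrix 𝔽

/-- `p` and `q` are congruent: some stabilizer maps `p` to `q`. -/
def ConfigCongruent {𝔽 : Type*} [CommRing 𝔽] {k n d : ℕ} (p q : Config 𝔽 k n d) : Prop :=
  ∃ A : Fin k → GL (Fin d) 𝔽, IsStabilizer A ∧
    ∀ i v, q i v = (A i : Matrix (Fin d) (Fin d) 𝔽) *ᵥ p i v

/-- The framework `(G, p)` is locally rigid. -/
def FrameworkLocallyRigid {𝔽 : Type*} [RCLike 𝔽] {k n d : ℕ} (G : Subgraph k n)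
    (p : Config 𝔽 k n d) : Prop :=
  ∃ U : Set (Config 𝔽 k n d), IsOpen U ∧ p ∈ U ∧
    ∀ q ∈ U, rigidityMap G p = rigidityMap G q → ConfigCongruent p q

/-- `p` is generic: its `dkn` coordinates are algebraically independent over `ℚ`. -/
def Generic {𝔽 : Type*} [RCLike 𝔽] {k n d : ℕ} (p : Config 𝔽 k n d) : Prop :=
  AlgebraicIndependent ℚ (fun x : Fin k × Fin n × Fin d => p x.1 x.2.1 x.2.2)

/-- `G` is locally rigid in `𝔽^d`: `(G, p)` is locally rigid for all generic `p`. -/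
def LocallyRigid (𝔽 : Type*) [RCLike 𝔽] {k n : ℕ} (d : ℕ) (G : Subgraph k n) : Prop :=
  ∀ p : Config 𝔽 k n d, Generic p → FrameworkLocallyRigid G p

/-! ### The generic tensor rigidity matroid -/

/-- The Jacobian matrix at `p` of the `d`-sum of the Segre map. -/
def jacobian {𝔽 : Type*} [RCLike 𝔽] {k n d : ℕ} (p : Config 𝔽 k n d) :
    Matrix (Edge k n) (Fin k × Fin n × Fin d) 𝔽 :=
  fun e x => fderiv 𝔽 (fun q : Config 𝔽 k n d => segre q e) p
    (Pi.single x.1 (Pi.single x.2.1 (Pi.single x.2.2 1)))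

/-- The row matroid of a matrix with finitely many rows: a set of row indices is independent if the
corresponding rows are linearly independent. -/
def rowMatroid {R C K : Type*} [Finite R] [Field K] (A : Matrix R C K) : Matroid R :=
  (IndepMatroid.ofFinite (E := Set.univ) Set.finite_univ (fun I => LinearIndepOn K A.row I)
    (linearIndepOn_empty K A.row)
    (fun _ _ hJ hIJ => hJ.mono hIJ)
    (by
      intro I J hI hJ hlt
      by_contra! hcon
      have hsub : A.row '' J ⊆ Submodule.span K (A.row '' I) := by
        rintro _ ⟨e, he, rfl⟩
        by_cases heI : e ∈ I
        · exact Submodule.subset_span ⟨e, heI, rfl⟩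
        · by_contra hnot
          exact hcon e he heI ((linearIndepOn_insert heI).2 ⟨hI, hnot⟩)
      have hspan : Submodule.span K (A.row '' J) ≤ Submodule.span K (A.row '' I) :=
        Submodule.span_le.2 hsub
      have hcard : ∀ S : Set R, LinearIndepOn K A.row S →
          Module.finrank K (Submodule.span K (A.row '' S)) = S.ncard := by
        intro S hS
        have : Fintype S := Fintype.ofFinite S
        have h := finrank_span_eq_card (R := K) (b := fun x : S => A.row x) hS
        have hr : Set.range (fun x : S => A.row x) = A.row '' S := by
          ext y; simp [Set.mem_image]
        rw [hr] at h
        rw [h, ← Nat.card_coe_set_eq, Nat.card_eq_fintype_card]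
      have hfin : FiniteDimensional K (Submodule.span K (A.row '' I)) :=
        FiniteDimensional.span_of_finite K ((Set.toFinite I).image A)
      have hle := Submodule.finrank_mono hspan
      rw [hcard I hI, hcard J hJ] at hle
      omega)
    (fun I _ => Set.subset_univ I)).matroid

/-- The tensor rigidity matroid at `p`, on the hyperedges of `K_n^k`: the row matroid of the
Jacobian at `p`. At a generic `p` it is the generic tensor rigidity matroid. -/
def tensorRigidityMatroid {𝔽 : Type*} [RCLike 𝔽] {k n d : ℕ} (p : Config 𝔽 k n d) :
    Matroid (Edge k n) :=
  rowMatroid (jacobian p)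

/-- The hyperedges of `G` have rank `dkn - d(k-1)` in the generic tensor rigidity matroid. -/
def FullRigidityRank (𝔽 : Type*) [RCLike 𝔽] {k n : ℕ} (d : ℕ) (G : Subgraph k n) : Prop :=
  ∀ p : Config 𝔽 k n d, Generic p →
    (tensorRigidityMatroid p).eRk (G : Set (Edge k n)) = ((d * k * n - d * (k - 1) : ℕ) : ℕ∞)

/-! ### Random subgraphs -/

/-- Probability of an event under the uniform distribution on a finite type. -/
def uniformProb (Ω : Type*) (A : Ω → Prop) : ℝ :=
  (Nat.card {ω // A ω} : ℝ) / (Nat.card Ω : ℝ)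

/-- Orderings of the hyperedges of `K_n^k`: the outcomes of the random graph process, which adds
the hyperedges one at a time in a uniformly random order. -/
abbrev Ordering (k n : ℕ) : Type := Fin (Fintype.card (Edge k n)) ≃ Edge k n

/-- `G(n, m)`: the first `m` hyperedges of the ordering. -/
def graphAt {k n : ℕ} (w : Ordering k n) (m : ℕ) : Subgraph k n :=
  Finset.univ.filter fun e => (w.symm e : ℕ) < m

/-- `M_d`: the least `m` for which `G(n, m)` has minimum degree at least `d`. -/
def hittingTime {k n : ℕ} (d : ℕ) (w : Ordering k n) : ℕ :=
  sInf {m | MinDegreeGE d (graphAt w m)}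

open Classical in
/-- Probability that `G(n, p)` has the property `P`, where `G(n, p)` keeps each hyperedge of `K_n^k`
independently with probability `p`. -/
def binomialProb (k n : ℕ) (p : ℝ) (P : Subgraph k n → Prop) : ℝ :=
  ∑ G : Subgraph k n with P G, p ^ #G * (1 - p) ^ (Fintype.card (Edge k n) - #G)

/-- `(log n + (d-1) log log n + log log log n) / n^(k-1)` -/
def pPlus (k d n : ℕ) : ℝ :=
  (Real.log n + ((d : ℝ) - 1) * Real.log (Real.log n) + Real.log (Real.log (Real.log n)))
    / (n : ℝ) ^ (k - 1)

/-- `(log n + (d-1) log log n - log log log n) / n^(k-1)` -/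
def pMinus (k d n : ℕ) : ℝ :=
  (Real.log n + ((d : ℝ) - 1) * Real.log (Real.log n) - Real.log (Real.log (Real.log n)))
    / (n : ℝ) ^ (k - 1)

end TensorRigidity

end

/-!
Two ingredients make the theorem true: at a generic configuration local rigidity is a statement of
linear algebra, and in the random process that statement first holds when the last vertex acquires
degree `d`.

*Linear algebra.* The diagonal stabilizers form a torus acting on configurations, and the tangent
space of the orbit of `p` (`IsTorusTangent`) has dimension `d (k - 1)` and lies in the kernel of
the differential of `segre`. A graph is called infinitesimally rigid if the kernel of the
differential of its rigidity map is no larger. By rank-nullity this says that its edges have rank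
`dkn - d (k - 1)` (`eRk_eq_iff_infinitesimallyRigid`). To compare it with local rigidity, fix the
torus action by adjoining the coordinates of one vertex in all classes but one (`gaugedMap`). If
the kernel is the tangent space, the gauged map is injective near `p` by the inverse function
theorem. If it is larger, then, since a generic `p` is a point of maximal rank
(`rank_map_aeval_le`), the fibre through `p` is infinite near `p` (`infinite_fiber_of_rank_le`),
whereas only the finitely many permutations of coordinates could produce congruent points in the
gauge.

*A criterion for rigidity.* Choose `d` disjoint transversals. A vertex is attached to them in a
set of edges `F` if it completes each of the transversals, with its own class left out, to an edge
in `F`. If the vertices of the transversals are attached, then any motion respecting the edges in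
`F` is, up to the torus, zero on all attached vertices (`exists_torus_eq_on_attached`): the
relevant determinant is a polynomial, and it is nonzero at the configuration that places the
`j`-th transversal at the `j`-th basis vector, which is where `k ≥ 3` enters. Moreover a vertex
with `d` edges to vertices that do not move does not move, by a Vandermonde determinant
(`eq_zero_of_card_le`). Hence `infinitesimallyRigid_of_attached`: minimum degree `d` is enough as
soon as all but some exceptional vertices have `d` edges to attached vertices, and no edge has two
exceptional vertices.

*The random process.* Take three independent random subgraphs `A`, `B`, `C` such that,
asymptotically almost surely, `A ∪ B` has a vertex of degree less than `d` and `C` has none.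
Averaging over all permutations of the edges, the ordering may be assumed to pass through `A ∪ B`
and `A ∪ B ∪ C`, so that `G(n, M_d)` lies between them (`uniformProb_le_expect`). The closure of
`A` in the matroid misses few edges, although `A` has only `O(n log n)` edges: an edge outside of
the closure would become a coloop on insertion, and a graph has no more coloops than its rank
(`expect_card_compl_spannedEdges_le`). Thus randomly chosen transversals attach all but `ε n`
vertices of each class in the closure of `A` (`exists_transversals_attached`). Since `B` is
independent of `A`, no vertex has many edges of `B` to unattached vertices
(`prob_exists_card_bad_gt_le`), so the vertices of degree of order `log n` in `B` are not
exceptional; and two vertices of smaller degree are unlikely to share an edge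
(`prob_exists_low_pair_le`). So the criterion applies to `G(n, M_d)`.

*The threshold.* Rigidity implies minimum degree `d` (`InfinitesimallyRigid.minDegreeGE`), and by
the hitting time statement it is asymptotically implied by it (`prob_not_locallyRigid_le`). The
threshold for minimum degree `d` follows from the independence of the degrees in one class on the
one side (`tendsto_prob_minDegreeGE`) and a Chernoff bound on the other
(`tendsto_prob_not_minDegreeGE`).
-/

namespace TensorRigidity

/-! ### Polynomial matrices at generic points, and the row matroid -/

section LinearAlgebra

lemma exists_linearIndependent_rows {R C K : Type*} [Fintype R] [Fintype C] [Field K]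
    (A : Matrix R C K) (m : ℕ) (hm : A.rank = m) :
    ∃ r : Fin m → R, LinearIndependent K (A.submatrix r id).row := by
  obtain ⟨κ, a, ha, hspan, hli⟩ := exists_linearIndependent' K A.row
  have : Finite κ := Finite.of_injective a ha
  have : Fintype κ := Fintype.ofFinite κ
  have h1 : Fintype.card κ = m := by
    rw [← hm, A.rank_eq_finrank_span_row, ← hspan, finrank_span_eq_card hli]
  let ε : Fin m ≃ κ := (Fintype.equivFinOfCardEq h1).symm
  exact ⟨a ∘ ε, hli.comp ε ε.injective⟩

/-- Over a field, some square submatrix of size `A.rank` is nonsingular. -/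
lemma exists_submatrix_det_ne_zero {R C K : Type*} [Fintype R] [Fintype C] [Field K]
    (A : Matrix R C K) :
    ∃ (r : Fin A.rank → R) (c : Fin A.rank → C), (A.submatrix r c).det ≠ 0 := by
  obtain ⟨r, hr⟩ := exists_linearIndependent_rows A _ rfl
  have h2 : ((A.submatrix r id)ᵀ).rank = A.rank := by
    rw [rank_transpose, hr.rank_matrix, Fintype.card_fin]
  obtain ⟨c, hc⟩ := exists_linearIndependent_rows (A.submatrix r id)ᵀ _ h2
  refine ⟨r, c, ?_⟩
  have h3 : IsUnit ((A.submatrix r c)ᵀ) := by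
    rw [← Matrix.linearIndependent_rows_iff_isUnit]
    exact hc
  have := (Matrix.isUnit_iff_isUnit_det _).1 h3
  rw [det_transpose] at this
  exact this.ne_zero

/-- A matrix with a nonsingular square submatrix of size `m` has rank at least `m`. -/
lemma le_rank_of_submatrix_det_ne_zero {R C K : Type*} [Fintype R] [Fintype C] [Field K]
    (A : Matrix R C K) {m : ℕ} (r : Fin m → R) (c : Fin m → C)
    (h : (A.submatrix r c).det ≠ 0) : m ≤ A.rank := by
  calc m = (A.submatrix r c).rank := by
        rw [rank_of_isUnit _ ((Matrix.isUnit_iff_isUnit_det _).2 h.isUnit), Fintype.card_fin]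
    _ ≤ A.rank := rank_submatrix_le A r c

/-- A rational polynomial that does not vanish somewhere does not vanish at a point with
algebraically independent coordinates. -/
lemma aeval_ne_zero_of_algebraicIndependent {σ L : Type*} [Field L] [Algebra ℚ L] {x : σ → L}
    (hx : AlgebraicIndependent ℚ x) (P : MvPolynomial σ ℚ) (y : σ → L)
    (h : MvPolynomial.aeval y P ≠ 0) : MvPolynomial.aeval x P ≠ 0 := by
  intro h0
  apply h
  rw [(algebraicIndependent_iff.1 hx) P h0, map_zero]

lemma map_aeval_det {σ L ι : Type*} [Field L] [Algebra ℚ L] [Fintype ι] [DecidableEq ι]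
    (A : Matrix ι ι (MvPolynomial σ ℚ)) (y : σ → L) :
    (A.map (MvPolynomial.aeval y)).det = MvPolynomial.aeval y A.det :=
  (AlgHom.map_det (MvPolynomial.aeval y) A).symm

/-- Lower semicontinuity of the rank: a matrix of rational polynomials has its maximal rank at
every point with algebraically independent coordinates. -/
lemma rank_map_aeval_le {σ L R C : Type*} [Field L] [Algebra ℚ L] [Fintype R] [Fintype C]
    {x : σ → L} (hx : AlgebraicIndependent ℚ x) (A : Matrix R C (MvPolynomial σ ℚ)) (y : σ → L) :
    (A.map (MvPolynomial.aeval y)).rank ≤ (A.map (MvPolynomial.aeval x)).rank := by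
  obtain ⟨r, c, h⟩ := exists_submatrix_det_ne_zero (A.map (MvPolynomial.aeval y))
  refine le_rank_of_submatrix_det_ne_zero _ r c ?_
  rw [Matrix.submatrix_map, map_aeval_det] at h ⊢
  exact aeval_ne_zero_of_algebraicIndependent hx _ y h

/-- A square system of rational polynomials that is nonsingular somewhere has only the zero solution
at a point with algebraically independent coordinates. -/
lemma eq_zero_of_mulVec_map_aeval {σ L ι : Type*} [Field L] [Algebra ℚ L] [Fintype ι]
    {x : σ → L} (hx : AlgebraicIndependent ℚ x)
    (A : Matrix ι ι (MvPolynomial σ ℚ)) (y : σ → L)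
    (hy : ∀ z, A.map (MvPolynomial.aeval y) *ᵥ z = 0 → z = 0) {z : ι → L}
    (hz : A.map (MvPolynomial.aeval x) *ᵥ z = 0) : z = 0 := by
  classical
  by_contra hne
  have h1 := Matrix.exists_mulVec_eq_zero_iff.1 ⟨z, hne, hz⟩
  rw [map_aeval_det] at h1
  have h2 : (A.map (MvPolynomial.aeval y)).det ≠ 0 := by
    intro h0
    obtain ⟨w, hw, hw'⟩ := Matrix.exists_mulVec_eq_zero_iff.2 h0
    exact hw (hy w hw')
  rw [map_aeval_det] at h2
  exact aeval_ne_zero_of_algebraicIndependent hx _ y h2 h1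

lemma rowMatroid_indep_iff {R C K : Type*} [Finite R] [Field K] (A : Matrix R C K) (I : Set R) :
    (rowMatroid A).Indep I ↔ LinearIndepOn K A.row I := by
  simp [rowMatroid]

/-- The rank of a set of rows in the row matroid is the dimension of their span. -/
lemma rowMatroid_eRk {R C K : Type*} [Finite R] [Fintype C] [Field K] (A : Matrix R C K)
    (X : Set R) :
    (rowMatroid A).eRk X = (A.submatrix (fun x : X => (x : R)) id).rank := by
  obtain ⟨I, hI⟩ := (rowMatroid A).exists_isBasis X (by
    change X ⊆ Set.univ; exact Set.subset_univ X)
  have hli : LinearIndepOn K A.row I := (rowMatroid_indep_iff A I).1 hI.indep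
  have hspan : Submodule.span K (A.row '' I) = Submodule.span K (A.row '' X) := by
    refine le_antisymm (Submodule.span_mono (Set.image_mono hI.subset)) (Submodule.span_le.2 ?_)
    rintro _ ⟨e, he, rfl⟩
    by_cases heI : e ∈ I
    · exact Submodule.subset_span ⟨e, heI, rfl⟩
    · by_contra hnot
      have h1 := (rowMatroid_indep_iff A _).2 ((linearIndepOn_insert heI).2 ⟨hli, hnot⟩)
      exact heI (hI.mem_of_insert_indep he h1)
  have hfin : Finite X := inferInstance
  have : Fintype I := Fintype.ofFinite I
  rw [hI.eRk_eq_encard, (A.submatrix _ _).rank_eq_finrank_span_row]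
  have hr : Set.range (A.submatrix (fun x : X => (x : R)) id).row = A.row '' X := by
    ext y; simp only [Set.mem_range, Set.mem_image, Subtype.exists]
    constructor
    · rintro ⟨a, b, rfl⟩; exact ⟨a, b, rfl⟩
    · rintro ⟨a, b, rfl⟩; exact ⟨a, b, rfl⟩
  have h := finrank_span_eq_card (R := K) (b := fun x : I => A.row x) hli
  have hr2 : Set.range (fun x : I => A.row x) = A.row '' I := by
    ext y; simp [Set.mem_image]
  rw [hr2, hspan] at h
  rw [hr, h, ← Nat.card_eq_fintype_card, Nat.card_coe_set_eq,
    Set.Finite.cast_ncard_eq (Set.toFinite I)]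

end LinearAlgebra

/-! ### Fibres of a map at a point of maximal rank -/

section ConstantRank

variable {𝔽 E W : Type*} [RCLike 𝔽] [NormedAddCommGroup E] [NormedSpace 𝔽 E]
  [NormedAddCommGroup W] [NormedSpace 𝔽 W] [FiniteDimensional 𝔽 E] [FiniteDimensional 𝔽 W]

/-- A map with injective strict derivative at `p` is injective near `p`. -/
lemma eventually_injective_of_hasStrictFDerivAt {F : E → W} {F' : E →L[𝔽] W} {p : E}
    (hF : HasStrictFDerivAt F F' p) (hinj : Function.Injective F') :
    ∃ U ∈ 𝓝 p, Set.InjOn F U := by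
  have : CompleteSpace E := FiniteDimensional.complete 𝔽 E
  obtain ⟨g, hg⟩ := LinearMap.exists_leftInverse_of_injective (F' : E →ₗ[𝔽] W)
    (LinearMap.ker_eq_bot.2 hinj)
  let G : W →L[𝔽] E := LinearMap.toContinuousLinearMap g
  have h1 : HasStrictFDerivAt (fun x => G (F x))
      ((ContinuousLinearEquiv.refl 𝔽 E : E ≃L[𝔽] E) : E →L[𝔽] E) p := by
    refine (G.hasStrictFDerivAt.comp p hF).congr_fderiv ?_
    ext x
    exact LinearMap.congr_fun hg x
  refine ⟨{x | h1.localInverse _ _ _ (G (F x)) = x}, h1.eventually_left_inverse, ?_⟩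
  intro x hx y hy hxy
  rw [Set.mem_ofPred_eq] at hx hy
  rw [← hx, ← hy, hxy]

/-- The case of the constant rank theorem that is needed: if the derivative of `F` attains its
maximal rank at `p` and is not injective there, then the fibre of `F` through `p` is infinite near
`p`. -/
lemma infinite_fiber_of_rank_le {F : E → W} {p : E} (hF : ContDiff 𝔽 1 F)
    (hrank : ∀ x, Module.finrank 𝔽 (LinearMap.range (fderiv 𝔽 F x).toLinearMap) ≤
      Module.finrank 𝔽 (LinearMap.range (fderiv 𝔽 F p).toLinearMap))
    {z : E} (hz : z ≠ 0) (hz' : fderiv 𝔽 F p z = 0) {U : Set E} (hU : U ∈ 𝓝 p) :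
    {q | q ∈ U ∧ F q = F p}.Infinite := by
  have : CompleteSpace E := FiniteDimensional.complete 𝔽 E
  set f' : E →ₗ[𝔽] W := (fderiv 𝔽 F p).toLinearMap with hf'
  set R := LinearMap.range f' with hR
  set K := LinearMap.ker f' with hK
  obtain ⟨π, hπ⟩ := LinearMap.exists_leftInverse_of_injective R.subtype R.ker_subtype
  obtain ⟨ρ, hρ⟩ := LinearMap.exists_leftInverse_of_injective K.subtype K.ker_subtype
  let πc : W →L[𝔽] R := LinearMap.toContinuousLinearMap π
  let ρc : E →L[𝔽] K := LinearMap.toContinuousLinearMap ρ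
  -- `Φ` straightens the fibres of `F`
  let Φ : E → R × K := fun x => (πc (F x), ρc x)
  have hΦ : ContDiff 𝔽 1 Φ := (πc.contDiff.comp hF).prodMk ρc.contDiff
  have hFd : ∀ x, HasFDerivAt F (fderiv 𝔽 F x) x := fun x =>
    (hF.differentiable one_ne_zero x).hasFDerivAt
  have hΦd : ∀ x, HasFDerivAt Φ ((πc.comp (fderiv 𝔽 F x)).prod ρc) x := fun x =>
    ((πc.hasFDerivAt.comp x (hFd x))).prodMk ρc.hasFDerivAt
  have hinj : Function.Injective ((πc.comp (fderiv 𝔽 F p)).prod ρc).toLinearMap := by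
    rw [← LinearMap.ker_eq_bot, LinearMap.ker_eq_bot']
    intro x hx
    have h1 : π (f' x) = 0 := congrArg Prod.fst hx
    have h2 : ρ x = 0 := congrArg Prod.snd hx
    have h3 := LinearMap.congr_fun hπ ⟨f' x, x, rfl⟩
    simp only [LinearMap.comp_apply, Submodule.subtype_apply, LinearMap.id_apply, h1] at h3
    have h4 : f' x = 0 := (congrArg Subtype.val h3).symm
    have h5 := LinearMap.congr_fun hρ ⟨x, h4⟩
    simp only [LinearMap.comp_apply, Submodule.subtype_apply, LinearMap.id_apply, h2] at h5
    exact (congrArg Subtype.val h5).symm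
  have hdim : Module.finrank 𝔽 E = Module.finrank 𝔽 (R × K) := by
    rw [Module.finrank_prod, LinearMap.finrank_range_add_finrank_ker]
  let e : E ≃L[𝔽] (R × K) :=
    (LinearEquiv.ofInjectiveOfFinrankEq _ hinj hdim).toContinuousLinearEquiv
  have he : HasFDerivAt Φ (e : E →L[𝔽] R × K) p := by
    exact hΦd p
  let ψ := hΦ.contDiffAt.localInverse he one_ne_zero
  have hψ : ContDiffAt 𝔽 1 ψ (Φ p) := hΦ.contDiffAt.to_localInverse he one_ne_zero
  have hψp : ψ (Φ p) = p := hΦ.contDiffAt.localInverse_apply_image he one_ne_zero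
  have hst : HasStrictFDerivAt Φ (e : E →L[𝔽] R × K) p :=
    hΦ.contDiffAt.hasStrictFDerivAt' he one_ne_zero
  have hright : ∀ᶠ y in 𝓝 (Φ p), Φ (ψ y) = y := hst.eventually_right_inverse
  have hdiff : ∀ᶠ y in 𝓝 (Φ p), DifferentiableAt 𝔽 ψ y :=
    (hψ.eventually (by simp)).mono fun y hy => hy.differentiableAt one_ne_zero
  have hψU : ∀ᶠ y in 𝓝 (Φ p), ψ y ∈ U := by
    have := hψ.continuousAt
    exact this (by rw [hψp]; exact hU)
  let τ : K := ⟨z, hz'⟩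
  let ℓ : 𝔽 → R × K := fun t => Φ p + t • ((0 : R), τ)
  have hℓ : Continuous ℓ := by fun_prop
  have hℓ0 : ℓ 0 = Φ p := by simp [ℓ]
  have hall := (hright.eventually_nhds.and (hdiff.and hψU))
  have hall' : ∀ᶠ t in 𝓝 (0 : 𝔽), (∀ᶠ y in 𝓝 (ℓ t), Φ (ψ y) = y) ∧
      DifferentiableAt 𝔽 ψ (ℓ t) ∧ ψ (ℓ t) ∈ U :=
    (hℓ.tendsto' 0 _ hℓ0).eventually hall
  obtain ⟨ε, hε, hball⟩ := Metric.eventually_nhds_iff_ball.1 hall'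
  -- `F ∘ ψ` has zero derivative along the line `ℓ`
  have hder : ∀ t ∈ Metric.ball (0 : 𝔽) ε, HasDerivAt (fun t => F (ψ (ℓ t))) 0 t := by
    intro t ht
    obtain ⟨h1, h2, -⟩ := hball t ht
    have hℓd : HasDerivAt ℓ ((0 : R), τ) t := by
      have := ((hasDerivAt_id t).smul_const ((0 : R), τ)).const_add (Φ p)
      rw [one_smul] at this
      exact this
    have hc : HasFDerivAt (fun y => Φ (ψ y))
        (((πc.comp (fderiv 𝔽 F (ψ (ℓ t)))).prod ρc).comp (fderiv 𝔽 ψ (ℓ t))) (ℓ t) :=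
      (hΦd _).comp (ℓ t) h2.hasFDerivAt
    have hid : HasFDerivAt (fun y => Φ (ψ y)) (ContinuousLinearMap.id 𝔽 (R × K)) (ℓ t) :=
      (hasFDerivAt_id (ℓ t)).congr_of_eventuallyEq h1
    have hEq := hc.unique hid
    set G := fderiv 𝔽 F (ψ (ℓ t)) with hG
    have hsurj : ∀ y : R × K, πc (G (fderiv 𝔽 ψ (ℓ t) y)) = y.1 := fun y =>
      congrArg Prod.fst (DFunLike.congr_fun hEq y)
    -- `π` is injective on the range of `G`, by comparison of dimensions
    let π' : LinearMap.range G.toLinearMap →ₗ[𝔽] R := π.comp (Submodule.subtype _)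
    have hs' : Function.Surjective π' := fun y =>
      ⟨⟨G (fderiv 𝔽 ψ (ℓ t) (y, 0)), _, rfl⟩, hsurj (y, 0)⟩
    have hfr : Module.finrank 𝔽 (LinearMap.range G.toLinearMap) = Module.finrank 𝔽 R :=
      le_antisymm (hrank _) (LinearMap.finrank_le_finrank_of_surjective hs')
    have hi' : Function.Injective π' :=
      (LinearMap.injective_iff_surjective_of_finrank_eq_finrank hfr).2 hs'
    have h0 : G (fderiv 𝔽 ψ (ℓ t) ((0 : R), τ)) = 0 := by
      have h5 : π' ⟨G (fderiv 𝔽 ψ (ℓ t) ((0 : R), τ)), _, rfl⟩ = 0 := hsurj (0, τ)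
      have h6 := hi' (h5.trans (map_zero π').symm)
      exact congrArg Subtype.val h6
    have := ((hFd (ψ (ℓ t))).comp (ℓ t) h2.hasFDerivAt).comp_hasDerivAt t hℓd
    rw [ContinuousLinearMap.comp_apply, ← hG, h0] at this
    exact this
  have hconst : ∀ t ∈ Metric.ball (0 : 𝔽) ε, F (ψ (ℓ t)) = F p := by
    intro t ht
    have hpre : IsPreconnected (Metric.ball (0 : 𝔽) ε) := by
      let _ : NormedSpace ℝ 𝔽 := NormedSpace.restrictScalars ℝ 𝔽 𝔽
      exact (convex_ball (0 : 𝔽) ε).isPreconnected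
    have := Metric.isOpen_ball.is_const_of_deriv_eq_zero hpre
      (fun t ht => (hder t ht).differentiableAt.differentiableWithinAt)
      (fun t ht => (hder t ht).deriv) ht (Metric.mem_ball_self hε)
    rw [this, hℓ0, hψp]
  have hinfb : (Metric.ball (0 : 𝔽) ε).Infinite :=
    infinite_of_mem_nhds 0 (Metric.ball_mem_nhds 0 hε)
  refine (hinfb.image (f := fun t => ψ (ℓ t)) ?_).mono ?_
  · intro s hs t ht hst
    have h1 := (hball s hs).1.self_of_nhds
    have h2 := (hball t ht).1.self_of_nhds
    have h3 : ℓ s = ℓ t := by rw [← h1, ← h2]; exact congrArg Φ hst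
    have h4 : s • ((0 : R), τ) = t • ((0 : R), τ) := add_left_cancel h3
    have h5 : s • z = t • z := congrArg (fun y => (y.2 : E)) h4
    exact smul_left_injective 𝔽 hz h5
  · rintro _ ⟨t, ht, rfl⟩
    exact ⟨(hball t ht).2.2, hconst t ht⟩

end ConstantRank

/-! ### Existence of generic configurations -/

/-- Over `ℝ` and `ℂ` there are finite families of any size that are algebraically independent over
`ℚ`. -/
lemma exists_algebraicIndependent (𝔽 : Type*) [RCLike 𝔽] (ι : Type*) [Finite ι] :
    ∃ x : ι → 𝔽, AlgebraicIndependent ℚ x := by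
  obtain ⟨s, hs⟩ := exists_isTranscendenceBasis ℚ 𝔽
  have hinf : s.Infinite := by
    intro hfin
    have : Countable s := hfin.countable.to_subtype
    have halg := hs.isAlgebraic
    have h1 := Algebra.IsAlgebraic.cardinalMk_le_max
      (Algebra.adjoin ℚ (Set.range ((↑) : s → 𝔽))) 𝔽
    have h2 : Countable (Algebra.adjoin ℚ (Set.range ((↑) : s → 𝔽))) :=
      have : Countable (MvPolynomial s ℚ) := Cardinal.mk_le_aleph0_iff.1
        (MvPolynomial.cardinalMk_le_max_lift.trans (by simp))
      hs.1.aevalEquiv.symm.toEquiv.injective.countable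
    have h3 : Cardinal.mk 𝔽 ≤ Cardinal.aleph0 := by
      refine h1.trans (max_le ?_ le_rfl)
      exact Cardinal.mk_le_aleph0_iff.2 h2
    have h4 : Countable 𝔽 := Cardinal.mk_le_aleph0_iff.1 h3
    have h5 : Countable ℝ := (RCLike.ofReal_injective (K := 𝔽)).countable
    exact Cardinal.not_countable_real (Set.countable_univ_iff.2 h5)
  have : Infinite s := hinf.to_subtype
  obtain ⟨f⟩ : Nonempty (ι ↪ s) := by
    have := Fintype.ofFinite ι
    obtain ⟨t, ht⟩ := Infinite.exists_subset_card_eq s (Fintype.card ι)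
    exact ⟨(Fintype.equivOfCardEq (by simp [ht])).toEmbedding.trans
      (Function.Embedding.subtype (· ∈ t))⟩
  exact ⟨fun i => f i, hs.1.comp f f.injective⟩

lemma exists_generic (𝔽 : Type*) [RCLike 𝔽] (k n d : ℕ) : ∃ p : Config 𝔽 k n d, Generic p := by
  obtain ⟨x, hx⟩ := exists_algebraicIndependent 𝔽 (Fin k × Fin n × Fin d)
  exact ⟨fun i v j => x (i, v, j), hx⟩

/-! ### The Jacobian of the sum of Segre maps -/

section Jacobian

variable {𝔽 : Type*} [RCLike 𝔽] {k n d : ℕ}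

/-- The coordinate `p ↦ p_{i, v, j}` as a continuous linear form. -/
noncomputable def coord (𝔽 : Type*) [RCLike 𝔽] {k n d : ℕ} (i : Fin k) (v : Fin n) (j : Fin d) :
    Config 𝔽 k n d →L[𝔽] 𝔽 :=
  (ContinuousLinearMap.proj (R := 𝔽) (φ := fun _ : Fin d => 𝔽) j).comp
    ((ContinuousLinearMap.proj (R := 𝔽) (φ := fun _ : Fin n => Fin d → 𝔽) v).comp
      (ContinuousLinearMap.proj (R := 𝔽) (φ := fun _ : Fin k => Fin n → Fin d → 𝔽) i))

@[simp] lemma coord_apply (i : Fin k) (v : Fin n) (j : Fin d) (x : Config 𝔽 k n d) :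
    coord 𝔽 i v j x = x i v j := rfl

/-- The differential at `p` of the coordinate `e` of `segre`: the row `e` of the Jacobian, as a
linear form. -/
noncomputable def segreDiff (p : Config 𝔽 k n d) (e : Edge k n) : Config 𝔽 k n d →L[𝔽] 𝔽 :=
  ∑ j, ∑ i, (∏ i' ∈ univ.erase i, p i' (e i') j) • coord 𝔽 i (e i) j

lemma segreDiff_apply (p : Config 𝔽 k n d) (e : Edge k n) (x : Config 𝔽 k n d) :
    segreDiff p e x = ∑ j, ∑ i, (∏ i' ∈ univ.erase i, p i' (e i') j) * x i (e i) j := by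
  simp [segreDiff]

lemma hasStrictFDerivAt_segre (p : Config 𝔽 k n d) (e : Edge k n) :
    HasStrictFDerivAt (fun q : Config 𝔽 k n d => segre q e) (segreDiff p e) p := by
  unfold segre segreDiff
  refine HasStrictFDerivAt.fun_sum fun j _ => ?_
  exact HasStrictFDerivAt.finsetProd fun i _ => (coord 𝔽 i (e i) j).hasStrictFDerivAt

lemma jacobian_apply (p : Config 𝔽 k n d) (e : Edge k n) (x : Fin k × Fin n × Fin d) :
    jacobian p e x =
      if e x.1 = x.2.1 then ∏ i' ∈ univ.erase x.1, p i' (e i') x.2.2 else 0 := by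
  obtain ⟨i, v, j⟩ := x
  rw [jacobian, (hasStrictFDerivAt_segre p e).hasFDerivAt.fderiv, segreDiff_apply,
    Finset.sum_eq_single j, Finset.sum_eq_single i]
  · simp [Pi.single_apply]
    split_ifs <;> simp_all
  · intro i' _ hi'
    simp [Pi.single_eq_of_ne hi']
  · simp
  · intro j' _ hj'
    refine Finset.sum_eq_zero fun i' _ => ?_
    by_cases h : i' = i
    · subst h
      by_cases h2 : e i' = v
      · subst h2; simp [Pi.single_eq_of_ne hj']
      · simp [Pi.single_eq_of_ne h2]
    · simp [Pi.single_eq_of_ne h]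
  · simp

/-- A family of scalars indexed by the coordinates, read as a configuration. -/
def unflat : (Fin k × Fin n × Fin d → 𝔽) ≃ₗ[𝔽] Config 𝔽 k n d where
  toFun y := fun i v j => y (i, v, j)
  invFun x := fun c => x c.1 c.2.1 c.2.2
  map_add' _ _ := rfl
  map_smul' _ _ := rfl
  left_inv _ := rfl
  right_inv _ := rfl

lemma jacobian_mulVec (p : Config 𝔽 k n d) (e : Edge k n) (y : Fin k × Fin n × Fin d → 𝔽) :
    (jacobian p *ᵥ y) e = segreDiff p e (unflat y) := by
  rw [segreDiff_apply, Finset.sum_comm, Matrix.mulVec, dotProduct]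
  simp only [jacobian_apply, Fintype.sum_prod_type, ite_mul, zero_mul]
  refine Finset.sum_congr rfl fun i _ => ?_
  rw [Finset.sum_comm]
  refine Finset.sum_congr rfl fun j _ => ?_
  rw [Finset.sum_ite_eq, if_pos (mem_univ _)]
  rfl

/-- The Jacobian of `segre` as a matrix of polynomials in the coordinates. -/
noncomputable def jacobianPoly (k n d : ℕ) :
    Matrix (Edge k n) (Fin k × Fin n × Fin d) (MvPolynomial (Fin k × Fin n × Fin d) ℚ) :=
  fun e x => if e x.1 = x.2.1 then ∏ i' ∈ univ.erase x.1, MvPolynomial.X (i', e i', x.2.2) else 0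

lemma jacobianPoly_aeval (p : Config 𝔽 k n d) (e : Edge k n) (x : Fin k × Fin n × Fin d) :
    MvPolynomial.aeval (unflat.symm p) (jacobianPoly k n d e x) = jacobian p e x := by
  rw [jacobian_apply, jacobianPoly]
  split_ifs
  · simp [map_prod, unflat]
  · simp

lemma Generic.ne_zero {p : Config 𝔽 k n d} (hp : Generic p) (i : Fin k) (v : Fin n) (j : Fin d) :
    p i v j ≠ 0 :=
  AlgebraicIndependent.ne_zero hp (i, v, j)

end Jacobian

/-! ### Diagonal stabilizers, infinitesimal rigidity and the matroid rank -/

section Torus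

variable {𝔽 : Type*} [RCLike 𝔽] {k n d : ℕ}

/-- The tangent vectors at `p` of its orbit under the diagonal stabilizers. -/
def IsTorusTangent (p x : Config 𝔽 k n d) : Prop :=
  ∃ lam : Fin k → Fin d → 𝔽, (∀ j, ∑ i, lam i j = 0) ∧ ∀ i v j, x i v j = lam i j * p i v j

/-- Infinitesimal rigidity of `(G, p)`: the kernel of the differential of the rigidity map consists
of the directions tangent to the orbit of `p` only. -/
def InfinitesimallyRigid (G : Subgraph k n) (p : Config 𝔽 k n d) : Prop :=
  ∀ x : Config 𝔽 k n d, (∀ e ∈ G, segreDiff p e x = 0) → IsTorusTangent p x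

lemma InfinitesimallyRigid.mono {G H : Subgraph k n} (hGH : G ⊆ H) {p : Config 𝔽 k n d}
    (h : InfinitesimallyRigid G p) : InfinitesimallyRigid H p :=
  fun x hx => h x fun e he => hx e (hGH he)

lemma segreDiff_torus {p x : Config 𝔽 k n d} (hx : IsTorusTangent p x) (e : Edge k n) :
    segreDiff p e x = 0 := by
  obtain ⟨lam, h0, h⟩ := hx
  rw [segreDiff_apply]
  refine Finset.sum_eq_zero fun j _ => ?_
  have : ∀ i, (∏ i' ∈ univ.erase i, p i' (e i') j) * x i (e i) j =
      lam i j * ∏ i', p i' (e i') j := by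
    intro i
    rw [h, ← Finset.mul_prod_erase univ (fun i' => p i' (e i') j) (mem_univ i)]
    ring
  rw [Finset.sum_congr rfl fun i _ => this i, ← Finset.sum_mul, h0, zero_mul]

/-- Modulo a direction tangent to the orbit of `p`, the coordinates of a vector at one chosen vertex
of each class and each coordinate direction vanish, except in one class. -/
lemma exists_torus_gauge {p : Config 𝔽 k n d} (hp : ∀ i v j, p i v j ≠ 0) (i₀ : Fin k)
    (c : Fin k → Fin d → Fin n) (x : Config 𝔽 k n d) :
    ∃ y, IsTorusTangent p y ∧ ∀ i j, i ≠ i₀ → (x - y) i (c i j) j = 0 := by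
  let mu : Fin k → Fin d → 𝔽 := fun i j => x i (c i j) j / p i (c i j) j
  let lam : Fin k → Fin d → 𝔽 := fun i j =>
    if i = i₀ then - ∑ i' ∈ univ.erase i₀, mu i' j else mu i j
  refine ⟨fun i v j => lam i j * p i v j, ⟨lam, ?_, fun _ _ _ => rfl⟩, ?_⟩
  · intro j
    rw [← Finset.add_sum_erase univ _ (mem_univ i₀)]
    have : ∑ i ∈ univ.erase i₀, lam i j = ∑ i ∈ univ.erase i₀, mu i j :=
      Finset.sum_congr rfl fun i hi => by simp [lam, Finset.ne_of_mem_erase hi]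
    rw [this]
    simp [lam]
  · intro i j hi
    simp only [Pi.sub_apply, lam, if_neg hi, mu]
    rw [div_mul_cancel₀ _ (hp _ _ _), sub_self]

/-- The scalars `(λ_{i,j})` with `∑_i λ_{i,j} = 0` parametrize the tangent vectors of the orbit. -/
noncomputable def torusMap (p : Config 𝔽 k n d) :
    (Fin k → Fin d → 𝔽) →ₗ[𝔽] (Fin k × Fin n × Fin d → 𝔽) where
  toFun lam := fun x => lam x.1 x.2.2 * p x.1 x.2.1 x.2.2
  map_add' a b := by ext; simp [add_mul]
  map_smul' a b := by ext; simp [mul_assoc]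

/-- The column sums of a family `(λ_{i,j})`. -/
noncomputable def columnSum (𝔽 : Type*) [RCLike 𝔽] (k d : ℕ) :
    (Fin k → Fin d → 𝔽) →ₗ[𝔽] (Fin d → 𝔽) :=
  ∑ i, LinearMap.proj i

lemma columnSum_apply (lam : Fin k → Fin d → 𝔽) (j : Fin d) :
    columnSum 𝔽 k d lam j = ∑ i, lam i j := by
  simp [columnSum, LinearMap.sum_apply]

lemma finrank_torus (hk : 1 ≤ k) (hn : 1 ≤ n) {p : Config 𝔽 k n d} (hp : ∀ i v j, p i v j ≠ 0) :
    Module.finrank 𝔽 ((LinearMap.ker (columnSum 𝔽 k d)).map (torusMap p)) = d * (k - 1) := by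
  have hinj : Function.Injective (torusMap p) := by
    rw [← LinearMap.ker_eq_bot, LinearMap.ker_eq_bot']
    intro lam h
    ext i j
    have := congrFun h (i, ⟨0, hn⟩, j)
    simpa [torusMap, hp] using this
  rw [← (Submodule.equivMapOfInjective _ hinj _).finrank_eq]
  have hsurj : Function.Surjective (columnSum 𝔽 k d) := by
    intro y
    refine ⟨Pi.single ⟨0, hk⟩ y, ?_⟩
    ext j
    rw [columnSum_apply, Finset.sum_eq_single ⟨0, hk⟩]
    · simp
    · intro i _ hi; simp [Pi.single_eq_of_ne hi]
    · simp
  have h := LinearMap.finrank_range_add_finrank_ker (columnSum 𝔽 k d)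
  rw [LinearMap.range_eq_top.2 hsurj, finrank_top] at h
  simp only [Module.finrank_self, mul_one, Module.finrank_pi_fintype, Finset.sum_const, card_univ,
    Fintype.card_fin, smul_eq_mul] at h
  obtain ⟨m, rfl⟩ : ∃ m, k = m + 1 := ⟨k - 1, by omega⟩
  simp only [Nat.add_sub_cancel]
  nlinarith

/-- The rank `dkn - d(k-1)` expresses infinitesimal rigidity: it is the codimension of the tangent
space of the orbit. -/
lemma eRk_eq_iff_infinitesimallyRigid (hk : 1 ≤ k) (hn : 1 ≤ n) {p : Config 𝔽 k n d}
    (hp : Generic p) (G : Subgraph k n) :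
    (tensorRigidityMatroid p).eRk (G : Set (Edge k n)) = ((d * k * n - d * (k - 1) : ℕ) : ℕ∞) ↔
      InfinitesimallyRigid G p := by
  set A := (jacobian p).submatrix (fun e : (G : Set (Edge k n)) => (e : Edge k n)) id with hA
  have h1 : (tensorRigidityMatroid p).eRk (G : Set (Edge k n)) = A.rank := rowMatroid_eRk _ _
  rw [h1, Nat.cast_inj]
  set T := (LinearMap.ker (columnSum 𝔽 k d)).map (torusMap p) with hT
  have hTd : Module.finrank 𝔽 T = d * (k - 1) := finrank_torus hk hn hp.ne_zero
  have hker : ∀ y, y ∈ LinearMap.ker A.mulVecLin ↔ ∀ e ∈ G, segreDiff p e (unflat y) = 0 := by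
    intro y
    rw [LinearMap.mem_ker, Matrix.mulVecLin_apply, funext_iff]
    constructor
    · intro h e he
      rw [← jacobian_mulVec]
      exact h ⟨e, he⟩
    · intro h e
      have := h e.1 e.2
      rw [← jacobian_mulVec] at this
      exact this
  have hmemT : ∀ y, y ∈ T ↔ IsTorusTangent p (unflat y) := by
    intro y
    rw [hT, Submodule.mem_map]
    constructor
    · rintro ⟨lam, hl, rfl⟩
      refine ⟨lam, fun j => ?_, fun _ _ _ => rfl⟩
      rw [← columnSum_apply, LinearMap.mem_ker.1 hl, Pi.zero_apply]
    · rintro ⟨lam, hl, h⟩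
      refine ⟨lam, ?_, ?_⟩
      · rw [LinearMap.mem_ker]
        ext j
        rw [columnSum_apply, hl, Pi.zero_apply]
      · ext ⟨i, v, j⟩
        exact (h i v j).symm
  have hle : T ≤ LinearMap.ker A.mulVecLin := fun y hy =>
    (hker y).2 fun e _ => segreDiff_torus ((hmemT y).1 hy) e
  have hsum := LinearMap.finrank_range_add_finrank_ker A.mulVecLin
  rw [Module.finrank_fintype_fun_eq_card] at hsum
  simp only [Fintype.card_prod, Fintype.card_fin] at hsum
  have hrk : A.rank + Module.finrank 𝔽 (LinearMap.ker A.mulVecLin) = d * k * n := by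
    rw [Matrix.rank, hsum]; ring
  have hge := Submodule.finrank_mono hle
  rw [hTd] at hge
  have : A.rank = d * k * n - d * (k - 1) ↔ LinearMap.ker A.mulVecLin ≤ T := by
    constructor
    · intro h
      exact (Submodule.eq_of_le_of_finrank_le hle (by omega)).ge
    · intro h
      have := Submodule.finrank_mono h
      omega
  rw [this]
  constructor
  · intro h x hx
    exact (hmemT (unflat.symm x)).1 (h ((hker (unflat.symm x)).2 hx))
  · intro h y hy
    exact (hmemT y).2 (h _ ((hker y).1 hy))

end Torus

/-! ### Local rigidity is infinitesimal rigidity -/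

section LocalRigidity

variable {𝔽 : Type*} [RCLike 𝔽] {k n d : ℕ}

/-- The rigidity map of `G` together with the coordinates of the vertex `v₀` of every class other
than `i₀`; the latter fix the action of the diagonal stabilizers. -/
def gaugedMap (G : Subgraph k n) (i₀ : Fin k) (v₀ : Fin n) (q : Config 𝔽 k n d) :
    G ⊕ Fin k × Fin d → 𝔽 :=
  Sum.elim (rigidityMap G q) fun x => if x.1 = i₀ then 0 else q x.1 v₀ x.2

/-- The differential of `gaugedMap`. -/
noncomputable def gaugedDiff (G : Subgraph k n) (i₀ : Fin k) (v₀ : Fin n) (q : Config 𝔽 k n d) :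
    Config 𝔽 k n d →L[𝔽] (G ⊕ Fin k × Fin d → 𝔽) :=
  ContinuousLinearMap.pi (Sum.elim (fun e => segreDiff q e)
    fun x => if x.1 = i₀ then 0 else coord 𝔽 x.1 v₀ x.2)

lemma hasStrictFDerivAt_gaugedMap (G : Subgraph k n) (i₀ : Fin k) (v₀ : Fin n)
    (q : Config 𝔽 k n d) :
    HasStrictFDerivAt (gaugedMap G i₀ v₀) (gaugedDiff G i₀ v₀ q) q := by
  refine hasStrictFDerivAt_pi.2 ?_
  rintro (e | x)
  · exact hasStrictFDerivAt_segre q e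
  · simp only [gaugedMap, Sum.elim_inr]
    split_ifs
    · exact hasStrictFDerivAt_const _ _
    · exact (coord 𝔽 x.1 v₀ x.2).hasStrictFDerivAt

lemma contDiff_gaugedMap (G : Subgraph k n) (i₀ : Fin k) (v₀ : Fin n) :
    ContDiff 𝔽 1 (gaugedMap (𝔽 := 𝔽) (d := d) G i₀ v₀) := by
  refine contDiff_pi.2 ?_
  rintro (e | x)
  · simp only [gaugedMap, Sum.elim_inl, rigidityMap, segre]
    exact ContDiff.sum fun j _ => contDiff_prod fun i _ => (coord 𝔽 i (e.1 i) j).contDiff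
  · simp only [gaugedMap, Sum.elim_inr]
    split_ifs
    · exact contDiff_const
    · exact (coord 𝔽 x.1 v₀ x.2).contDiff

lemma gaugedDiff_eq_zero_iff (G : Subgraph k n) (i₀ : Fin k) (v₀ : Fin n)
    (q x : Config 𝔽 k n d) :
    gaugedDiff G i₀ v₀ q x = 0 ↔
      (∀ e ∈ G, segreDiff q e x = 0) ∧ ∀ i j, i ≠ i₀ → x i v₀ j = 0 := by
  rw [funext_iff, Sum.forall]
  refine and_congr ?_ ?_
  · simp [gaugedDiff]
  · simp only [gaugedDiff, ContinuousLinearMap.pi_apply, Sum.elim_inr, Prod.forall, Pi.zero_apply]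
    refine forall₂_congr fun i j => ?_
    split_ifs with h <;> simp [h]

/-- The rank of the differential of `gaugedMap` is maximal at generic configurations. -/
lemma finrank_range_gaugedDiff_le (G : Subgraph k n) (i₀ : Fin k) (v₀ : Fin n)
    {p : Config 𝔽 k n d} (hp : Generic p) (q : Config 𝔽 k n d) :
    Module.finrank 𝔽 (LinearMap.range (gaugedDiff G i₀ v₀ q).toLinearMap) ≤
      Module.finrank 𝔽 (LinearMap.range (gaugedDiff G i₀ v₀ p).toLinearMap) := by
  let A : Matrix (G ⊕ Fin k × Fin d) (Fin k × Fin n × Fin d)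
      (MvPolynomial (Fin k × Fin n × Fin d) ℚ) :=
    Matrix.of (Sum.elim (fun e => jacobianPoly k n d e)
      fun x y => if x.1 = i₀ then 0 else if y = (x.1, v₀, x.2) then 1 else 0)
  have key : ∀ q : Config 𝔽 k n d,
      Module.finrank 𝔽 (LinearMap.range (gaugedDiff G i₀ v₀ q).toLinearMap) =
        (A.map (MvPolynomial.aeval (unflat.symm q))).rank := by
    intro q
    rw [Matrix.rank]
    have : (A.map (MvPolynomial.aeval (unflat.symm q))).mulVecLin =
        (gaugedDiff G i₀ v₀ q).toLinearMap ∘ₗ (unflat (𝔽 := 𝔽)).toLinearMap := by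
      refine LinearMap.ext fun y => ?_
      funext r
      rcases r with e | x
      · change _ = segreDiff q e.1 (unflat y)
        rw [← jacobian_mulVec]
        refine Finset.sum_congr rfl fun c _ => ?_
        exact congrArg (· * y c) (jacobianPoly_aeval q e.1 c)
      · change ∑ c, MvPolynomial.aeval (unflat.symm q)
          (if x.1 = i₀ then 0 else if c = (x.1, v₀, x.2) then 1 else 0) * y c =
          (if x.1 = i₀ then 0 else coord 𝔽 x.1 v₀ x.2 : Config 𝔽 k n d →L[𝔽] 𝔽) (unflat y)
        split_ifs with hi
        · simp
        · simp only [apply_ite (MvPolynomial.aeval (unflat.symm q)), map_one, map_zero, ite_mul,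
            one_mul, zero_mul, Finset.sum_ite_eq', mem_univ, if_true]
          rfl
    rw [this, LinearMap.range_comp_of_range_eq_top _ (LinearEquiv.range _)]
  rw [key, key]
  exact rank_map_aeval_le hp A _

lemma configCongruent_of_scaling {p q : Config 𝔽 k n d} (t : Fin k → Fin d → 𝔽)
    (ht : ∀ j, ∏ i, t i j = 1) (h : ∀ i v j, q i v j = t i j * p i v j) : ConfigCongruent p q := by
  have hne : ∀ i j, t i j ≠ 0 := fun i j h0 => by
    have := ht j
    rw [Finset.prod_eq_zero (mem_univ i) h0] at this
    exact zero_ne_one this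
  have hu : ∀ i, IsUnit (Matrix.diagonal (t i)) := fun i => by
    rw [Matrix.isUnit_iff_isUnit_det, det_diagonal]
    exact (Finset.prod_ne_zero_iff.2 fun j _ => hne i j).isUnit
  refine ⟨fun i => (hu i).unit, ⟨1, t, ht, fun i => by simp⟩, fun i v => ?_⟩
  ext j
  simp [h, mulVec_diagonal]

/-- A configuration congruent to `p` with the same gauge coordinates is determined by the
permutation, so there are finitely many of them. -/
lemma finite_congruent_gauged {p : Config 𝔽 k n d} (hp : ∀ i v j, p i v j ≠ 0) (i₀ : Fin k)
    (v₀ : Fin n) :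
    {q : Config 𝔽 k n d | ConfigCongruent p q ∧ ∀ i j, i ≠ i₀ → q i v₀ j = p i v₀ j}.Finite := by
  let D : Equiv.Perm (Fin d) → Fin k → Fin d → 𝔽 := fun s i j =>
    if i = i₀ then (∏ i' ∈ univ.erase i₀, p i' v₀ j / p i' v₀ (s j))⁻¹ else p i v₀ j / p i v₀ (s j)
  refine (Set.finite_range fun (s : Equiv.Perm (Fin d)) (i : Fin k) (v : Fin n) (j : Fin d) =>
    D s i j * p i v (s j)).subset ?_
  rintro q ⟨⟨A, ⟨s, E, hE, hA⟩, hq⟩, hg⟩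
  refine ⟨s, ?_⟩
  have hq' : ∀ i v j, q i v j = E i j * p i v (s j) := by
    intro i v j
    rw [hq, hA, ← Matrix.mulVec_mulVec, mulVec_diagonal, Matrix.permMatrix_mulVec]
    rfl
  have hED : ∀ i j, i ≠ i₀ → E i j = p i v₀ j / p i v₀ (s j) := by
    intro i j hi
    rw [eq_div_iff (hp _ _ _), ← hq', hg i j hi]
  ext i v j
  rw [hq']
  refine congrArg (· * p i v (s j)) (?_ : D s i j = E i j)
  by_cases hi : i = i₀
  · subst hi
    simp only [D, if_true]
    refine (eq_inv_of_mul_eq_one_left ?_).symm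
    rw [← hE j, ← Finset.mul_prod_erase univ _ (mem_univ i)]
    congr 1
    exact Finset.prod_congr rfl fun i' hi' => (hED i' j (Finset.ne_of_mem_erase hi')).symm
  · simp only [D, if_neg hi]
    exact (hED i j hi).symm

/-- After fixing the gauge, infinitesimal rigidity makes the differential injective, so the inverse
function theorem applies; every nearby configuration can be moved into the gauge by the torus. -/
lemma InfinitesimallyRigid.frameworkLocallyRigid (hk : 1 ≤ k) (hn : 1 ≤ n) {G : Subgraph k n}
    {p : Config 𝔽 k n d} (hp : Generic p) (h : InfinitesimallyRigid G p) :
    FrameworkLocallyRigid G p := by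
  let i₀ : Fin k := ⟨0, hk⟩
  let v₀ : Fin n := ⟨0, hn⟩
  have hp0 := hp.ne_zero
  have hinj : Function.Injective (gaugedDiff G i₀ v₀ p) := by
    rw [← ContinuousLinearMap.coe_coe, ← LinearMap.ker_eq_bot, LinearMap.ker_eq_bot']
    intro x hx
    obtain ⟨h1, h2⟩ := (gaugedDiff_eq_zero_iff G i₀ v₀ p x).1 hx
    obtain ⟨lam, hl, hx⟩ := h x h1
    have h3 : ∀ i j, i ≠ i₀ → lam i j = 0 := fun i j hi => by
      have := h2 i j hi
      rw [hx] at this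
      exact (mul_eq_zero.1 this).resolve_right (hp0 _ _ _)
    have h4 : ∀ j, lam i₀ j = 0 := fun j => by
      rw [← hl j, Finset.sum_eq_single i₀ (fun i _ hi => h3 i j hi) (by simp)]
    ext i v j
    rw [hx]
    by_cases hi : i = i₀
    · rw [hi, h4]; simp
    · rw [h3 i j hi]; simp
  obtain ⟨U, hU, hinjU⟩ :=
    eventually_injective_of_hasStrictFDerivAt (hasStrictFDerivAt_gaugedMap G i₀ v₀ p) hinj
  -- `t q` is the element of the torus that matches the gauge coordinates of `q` with those of `p`
  let t : Config 𝔽 k n d → Fin k → Fin d → 𝔽 := fun q i j =>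
    if i = i₀ then ∏ i' ∈ univ.erase i₀, (q i' v₀ j / p i' v₀ j) else p i v₀ j / q i v₀ j
  let g : Config 𝔽 k n d → Config 𝔽 k n d := fun q i v j => t q i j * q i v j
  have hgp : g p = p := by
    ext i v j
    have : t p i j = 1 := by
      simp only [t]
      split_ifs
      · exact Finset.prod_eq_one fun i' _ => div_self (hp0 _ _ _)
      · exact div_self (hp0 _ _ _)
    simp [g, this]
  have hgc : ContinuousAt g p := by
    have hc : ∀ i v j, ContinuousAt (fun q : Config 𝔽 k n d => q i v j) p := fun i v j =>
      (coord 𝔽 i v j).continuous.continuousAt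
    refine continuousAt_pi.2 fun i => continuousAt_pi.2 fun v => continuousAt_pi.2 fun j => ?_
    refine ContinuousAt.mul ?_ (hc i v j)
    by_cases hi : i = i₀
    · simp only [t, if_pos hi]
      exact tendsto_finsetProd _ fun i' _ => (hc i' v₀ j).div_const _
    · simp only [t, if_neg hi]
      exact ContinuousAt.div continuousAt_const (hc i v₀ j) (hp0 _ _ _)
  have hne : ∀ᶠ q : Config 𝔽 k n d in 𝓝 p, ∀ i j, q i v₀ j ≠ 0 := by
    refine eventually_all.2 fun i => eventually_all.2 fun j => ?_
    exact (coord 𝔽 i v₀ j).continuous.continuousAt.eventually_ne (hp0 i v₀ j)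
  have hgU : ∀ᶠ q in 𝓝 p, g q ∈ U := hgc (by rw [hgp]; exact hU)
  obtain ⟨V, hV, hVo, hpV⟩ := mem_nhds_iff.1 (hne.and hgU)
  refine ⟨V, hVo, hpV, fun q hq hfq => ?_⟩
  obtain ⟨hq0, hqU⟩ := hV hq
  have ht0 : ∀ i j, t q i j ≠ 0 := by
    intro i j
    simp only [t]
    split_ifs
    · exact Finset.prod_ne_zero_iff.2 fun i' _ => div_ne_zero (hq0 _ _) (hp0 _ _ _)
    · exact div_ne_zero (hp0 _ _ _) (hq0 _ _)
  have ht1 : ∀ j, ∏ i, t q i j = 1 := by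
    intro j
    rw [← Finset.mul_prod_erase univ _ (mem_univ i₀)]
    have : ∏ i ∈ univ.erase i₀, t q i j = ∏ i ∈ univ.erase i₀, (p i v₀ j / q i v₀ j) :=
      Finset.prod_congr rfl fun i hi => by simp [t, Finset.ne_of_mem_erase hi]
    rw [this]
    simp only [t, if_true]
    rw [← Finset.prod_mul_distrib]
    exact Finset.prod_eq_one fun i _ => by
      rw [div_mul_div_comm, mul_comm, div_self (mul_ne_zero (hp0 _ _ _) (hq0 _ _))]
  have hseg : ∀ e, segre (g q) e = segre q e := by
    intro e
    refine Finset.sum_congr rfl fun j _ => ?_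
    simp only [g]
    rw [Finset.prod_mul_distrib, ht1, one_mul]
  have hgq : g q = p := by
    refine hinjU hqU (mem_of_mem_nhds hU) ?_
    ext x
    rcases x with e | ⟨i, j⟩
    · simp only [gaugedMap, Sum.elim_inl, rigidityMap, hseg]
      exact (congrFun hfq e).symm
    · simp only [gaugedMap, Sum.elim_inr]
      split_ifs with hi
      · rfl
      · simp only [g, t, if_neg hi]
        exact div_mul_cancel₀ _ (hq0 _ _)
  refine configCongruent_of_scaling (fun i j => (t q i j)⁻¹) (fun j => ?_) fun i v j => ?_
  · rw [Finset.prod_inv_distrib, ht1, inv_one]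
  · rw [eq_inv_mul_iff_mul_eq₀ (ht0 i j)]
    exact congrFun (congrFun (congrFun hgq i) v) j

/-- A kernel vector that is not tangent to the orbit gives infinitely many nearby points in the
fibre of the gauged map, because the rank is maximal at `p`; only finitely many of them are
congruent to `p`. -/
lemma FrameworkLocallyRigid.infinitesimallyRigid (hk : 1 ≤ k) (hn : 1 ≤ n) {G : Subgraph k n}
    {p : Config 𝔽 k n d} (hp : Generic p) (h : FrameworkLocallyRigid G p) :
    InfinitesimallyRigid G p := by
  let i₀ : Fin k := ⟨0, hk⟩
  let v₀ : Fin n := ⟨0, hn⟩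
  intro x hx
  obtain ⟨y, hy, hxy⟩ := exists_torus_gauge hp.ne_zero i₀ (fun _ _ => v₀) x
  by_cases hz : x - y = 0
  · rwa [sub_eq_zero.1 hz]
  exfalso
  obtain ⟨U, hUo, hpU, hU⟩ := h
  have hd : ∀ q, fderiv 𝔽 (gaugedMap G i₀ v₀) q = gaugedDiff G i₀ v₀ q := fun q =>
    (hasStrictFDerivAt_gaugedMap (𝔽 := 𝔽) (d := d) G i₀ v₀ q).hasFDerivAt.fderiv
  have hzero : gaugedDiff G i₀ v₀ p (x - y) = 0 := by
    refine (gaugedDiff_eq_zero_iff G i₀ v₀ p _).2 ⟨fun e he => ?_, hxy⟩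
    rw [map_sub, hx e he, segreDiff_torus hy, sub_zero]
  have hinf := infinite_fiber_of_rank_le (contDiff_gaugedMap (𝔽 := 𝔽) (d := d) G i₀ v₀) (p := p)
    (fun q => by rw [hd, hd]; exact finrank_range_gaugedDiff_le G i₀ v₀ hp q) hz
    (by rw [hd]; exact hzero) (hUo.mem_nhds hpU)
  refine hinf ((finite_congruent_gauged hp.ne_zero i₀ v₀).subset ?_)
  rintro q ⟨hqU, hq⟩
  refine ⟨hU q hqU ?_, fun i j hi => ?_⟩
  · ext e
    exact (congrFun hq (Sum.inl e)).symm
  · have := congrFun hq (Sum.inr (i, j))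
    simpa [gaugedMap, hi] using this

/-- At a generic configuration, infinitesimal rigidity does not depend on the configuration. -/
lemma InfinitesimallyRigid.of_generic (hk : 1 ≤ k) (hn : 1 ≤ n) {G : Subgraph k n}
    {p q : Config 𝔽 k n d} (hp : Generic p) (hq : Generic q) (h : InfinitesimallyRigid G p) :
    InfinitesimallyRigid G q := by
  rw [← eRk_eq_iff_infinitesimallyRigid hk hn hp] at h
  rw [← eRk_eq_iff_infinitesimallyRigid hk hn hq, ← h]
  have key : ∀ q : Config 𝔽 k n d, (tensorRigidityMatroid q).eRk (G : Set (Edge k n)) =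
      (((jacobianPoly k n d).submatrix (fun e : (G : Set (Edge k n)) => (e : Edge k n)) id).map
        (MvPolynomial.aeval (unflat.symm q))).rank := by
    intro q
    have h1 : (jacobian q).submatrix (fun e : (G : Set (Edge k n)) => (e : Edge k n)) id =
        ((jacobianPoly k n d).submatrix (fun e : (G : Set (Edge k n)) => (e : Edge k n)) id).map
        (MvPolynomial.aeval (unflat.symm q)) := by
      ext e x
      simp [jacobianPoly_aeval]
    rw [← h1]
    exact rowMatroid_eRk _ _
  rw [key, key, Nat.cast_inj]
  exact le_antisymm (rank_map_aeval_le hp _ _) (rank_map_aeval_le hq _ _)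

lemma locallyRigid_iff_infinitesimallyRigid (hk : 1 ≤ k) (hn : 1 ≤ n) (G : Subgraph k n)
    {p : Config 𝔽 k n d} (hp : Generic p) :
    LocallyRigid 𝔽 d G ↔ InfinitesimallyRigid G p :=
  ⟨fun h => (h p hp).infinitesimallyRigid hk hn hp,
    fun h _ hq => (h.of_generic hk hn hp hq).frameworkLocallyRigid hk hn hq⟩

end LocalRigidity

/-! ### Attached vertices and the deterministic rigidity criterion -/

section Attachment

variable {𝔽 : Type*} [RCLike 𝔽] {k n d : ℕ}

lemma segreDiff_congr (p : Config 𝔽 k n d) (e : Edge k n) {x y : Config 𝔽 k n d}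
    (h : ∀ i, x i (e i) = y i (e i)) : segreDiff p e x = segreDiff p e y := by
  simp only [segreDiff_apply, h]

/-- A vertex with `d` edges whose other vertices do not move does not move either. The `d` equations
at the vertex are independent at a generic configuration because they are at a Vandermonde
configuration. -/
lemma eq_zero_of_card_le {p : Config 𝔽 k n d} (hp : Generic p) {x : Config 𝔽 k n d} (i : Fin k)
    (v : Fin n) (S : Finset (Edge k n)) (hS : d ≤ #S) (hv : ∀ e ∈ S, e i = v)
    (hx : ∀ e ∈ S, segreDiff p e x = 0) (h0 : ∀ e ∈ S, ∀ i', i' ≠ i → x i' (e i') = 0) :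
    x i v = 0 := by
  obtain ⟨S', hS', hcard⟩ := Finset.exists_subset_card_eq hS
  let f : Fin d ≃ S' := (S'.equivFinOfCardEq hcard).symm
  let A : Matrix (Fin d) (Fin d) (MvPolynomial (Fin k × Fin n × Fin d) ℚ) :=
    Matrix.of fun l j => ∏ i' ∈ univ.erase i, MvPolynomial.X (i', (f l).1 i', j)
  -- base-`n` digits make the Vandermonde nodes distinct
  let y : Fin k × Fin n × Fin d → 𝔽 := fun c =>
    ((2 : 𝔽) ^ ((c.2.1 : ℕ) * n ^ (c.1 : ℕ))) ^ (c.2.2 : ℕ)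
  let w : Fin d → 𝔽 := fun l => (2 : 𝔽) ^ ∑ i' ∈ univ.erase i, ((f l).1 i' : ℕ) * n ^ (i' : ℕ)
  refine eq_zero_of_mulVec_map_aeval hp A y ?_ ?_
  · have hAy : A.map (MvPolynomial.aeval y) = Matrix.vandermonde w := by
      ext l j
      simp only [A, y, w, Matrix.map_apply, Matrix.of_apply, map_prod, MvPolynomial.aeval_X,
        Matrix.vandermonde_apply, Finset.prod_pow, Finset.prod_pow_eq_pow_sum]
    rw [hAy]
    intro z hz
    refine Matrix.eq_zero_of_mulVec_eq_zero (Matrix.det_vandermonde_ne_zero_iff.2 ?_) hz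
    intro l m hlm
    have h1 : ∑ i' ∈ univ.erase i, ((f l).1 i' : ℕ) * n ^ (i' : ℕ) =
        ∑ i' ∈ univ.erase i, ((f m).1 i' : ℕ) * n ^ (i' : ℕ) := by
      have : ((2 ^ (∑ i' ∈ univ.erase i, ((f l).1 i' : ℕ) * n ^ (i' : ℕ)) : ℕ) : 𝔽) =
          ((2 ^ (∑ i' ∈ univ.erase i, ((f m).1 i' : ℕ) * n ^ (i' : ℕ)) : ℕ) : 𝔽) := by
        push_cast
        exact hlm
      exact Nat.pow_right_injective le_rfl (Nat.cast_injective this)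
    have h2 : ∑ i', ((f l).1 i' : ℕ) * n ^ (i' : ℕ) = ∑ i', ((f m).1 i' : ℕ) * n ^ (i' : ℕ) := by
      rw [← Finset.add_sum_erase _ _ (mem_univ i), h1,
        ← Finset.add_sum_erase _ (fun i' => ((f m).1 i' : ℕ) * n ^ (i' : ℕ)) (mem_univ i),
        hv _ (hS' (f l).2), hv _ (hS' (f m).2)]
    have h3 : finFunctionFinEquiv (f l).1 = finFunctionFinEquiv (f m).1 := by
      ext
      rw [finFunctionFinEquiv_apply, finFunctionFinEquiv_apply, h2]
    exact f.injective (Subtype.ext (finFunctionFinEquiv.injective h3))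
  · ext l
    have h1 := hx _ (hS' (f l).2)
    rw [segreDiff_apply] at h1
    rw [Pi.zero_apply, ← h1, Matrix.mulVec, dotProduct]
    refine Finset.sum_congr rfl fun j _ => ?_
    rw [Finset.sum_eq_single i]
    · rw [hv _ (hS' (f l).2)]
      simp [A, map_prod]
    · intro i' _ hi'
      rw [h0 _ (hS' (f l).2) i' hi']
      simp
    · simp

/-- The configuration that places a chosen vertex `c i j` of each class at the `j`-th basis vector,
and all other vertices at the origin. -/
def basisConfig (𝔽 : Type*) [RCLike 𝔽] (c : Fin k → Fin d → Fin n) : Config 𝔽 k n d :=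
  fun i v j => if v = c i j then 1 else 0

/-- Row of the Jacobian at `basisConfig` of an edge that meets the `j`-th transversal
`(c i j)_i` in all vertices but one. -/
lemma segreDiff_basisConfig_update (hk : 3 ≤ k) {c : Fin k → Fin d → Fin n}
    (hc : ∀ i, Function.Injective (c i)) (i : Fin k) (v : Fin n) (j : Fin d) (hv : v ≠ c i j)
    (x : Config 𝔽 k n d) :
    segreDiff (basisConfig 𝔽 c) (Function.update (fun i' => c i' j) i v) x = x i v j := by
  have hcard : ∀ a b : Fin k, ∃ i'', i'' ≠ a ∧ i'' ≠ b := by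
    intro a b
    obtain ⟨i'', h⟩ := Finset.exists_mem_notMem_of_card_lt_card (s := {a, b}) (t := univ)
      (by rw [card_univ, Fintype.card_fin]; exact lt_of_le_of_lt (Finset.card_le_two) hk)
    exact ⟨i'', by simp_all⟩
  rw [segreDiff_apply, Finset.sum_eq_single j, Finset.sum_eq_single i]
  · rw [Function.update_self, Finset.prod_eq_one, one_mul]
    intro i' hi'
    rw [Function.update_of_ne (Finset.ne_of_mem_erase hi'), basisConfig, if_pos rfl]
  · intro i' _ hi'
    rw [Finset.prod_eq_zero (i := i) (by simp [hi'.symm]), zero_mul]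
    rw [Function.update_self, basisConfig, if_neg hv]
  · simp
  · intro j' _ hj'
    refine Finset.sum_eq_zero fun i' _ => ?_
    obtain ⟨i'', h1, h2⟩ := hcard i i'
    rw [Finset.prod_eq_zero (i := i'') (by simp [h2]), zero_mul]
    rw [Function.update_of_ne h1, basisConfig, if_neg]
    exact fun h => hj' (hc i'' h).symm
  · simp

/-- Row of the Jacobian at `basisConfig` of the `j`-th transversal. -/
lemma segreDiff_basisConfig (hk : 2 ≤ k) {c : Fin k → Fin d → Fin n}
    (hc : ∀ i, Function.Injective (c i)) (j : Fin d) (x : Config 𝔽 k n d) :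
    segreDiff (basisConfig 𝔽 c) (fun i' => c i' j) x = ∑ i, x i (c i j) j := by
  have : Nontrivial (Fin k) := Fin.nontrivial_iff_two_le.2 hk
  rw [segreDiff_apply, Finset.sum_eq_single j]
  · refine Finset.sum_congr rfl fun i _ => ?_
    rw [Finset.prod_eq_one, one_mul]
    intro i' hi'
    rw [basisConfig, if_pos rfl]
  · intro j' _ hj'
    refine Finset.sum_eq_zero fun i' _ => ?_
    obtain ⟨i'', h2⟩ := exists_ne i'
    rw [Finset.prod_eq_zero (i := i'') (by simp [h2]), zero_mul]
    rw [basisConfig, if_neg]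
    exact fun h => hj' (hc i'' h).symm
  · simp

/-- The vertex `(i, v)` completes all the transversals `(c i' j)_{i'}`, with their `i`-th vertex
removed, to edges in `F`. -/
def Attached (F : Subgraph k n) (c : Fin k → Fin d → Fin n) (i : Fin k) (v : Fin n) : Prop :=
  ∀ j, Function.update (fun i' => c i' j) i v ∈ F

/-- If the vertices of `d` disjoint transversals are attached, then all attached vertices move
together, along the torus. It suffices to check this at `basisConfig`, where after fixing the gauge
and the vertices that are not attached the equations form a nonsingular square system. -/
lemma exists_torus_eq_on_attached (hk : 3 ≤ k) {p : Config 𝔽 k n d} (hp : Generic p)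
    {F : Subgraph k n} {c : Fin k → Fin d → Fin n} (hc : ∀ i, Function.Injective (c i))
    (hatt : ∀ i j, Attached F c i (c i j)) {x : Config 𝔽 k n d}
    (hx : ∀ e ∈ F, segreDiff p e x = 0) :
    ∃ y, IsTorusTangent p y ∧ ∀ i v, Attached F c i v → (x - y) i v = 0 := by
  classical
  let i₀ : Fin k := ⟨0, by omega⟩
  obtain ⟨y, hy, hxy⟩ := exists_torus_gauge hp.ne_zero i₀ c x
  refine ⟨y, hy, ?_⟩
  let z : Config 𝔽 k n d := fun i v => if Attached F c i v then (x - y) i v else 0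
  let A : Matrix (Fin k × Fin n × Fin d) (Fin k × Fin n × Fin d)
      (MvPolynomial (Fin k × Fin n × Fin d) ℚ) := Matrix.of fun r =>
    if Attached F c r.1 r.2.1 ∧ (r.2.1 = c r.1 r.2.2 → r.1 = i₀) then
      jacobianPoly k n d (Function.update (fun i' => c i' r.2.2) r.1 r.2.1)
    else Pi.single r 1
  have hA : ∀ (q u : Config 𝔽 k n d) (i : Fin k) (v : Fin n) (j : Fin d),
      (A.map (MvPolynomial.aeval (unflat.symm q)) *ᵥ unflat.symm u) (i, v, j) =
        if Attached F c i v ∧ (v = c i j → i = i₀) then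
          segreDiff q (Function.update (fun i' => c i' j) i v) u else u i v j := by
    intro q u i v j
    rw [Matrix.mulVec, dotProduct]
    split_ifs with h
    · have h2 := jacobian_mulVec q (Function.update (fun i' => c i' j) i v) (unflat.symm u)
      rw [LinearEquiv.apply_symm_apply] at h2
      rw [← h2]
      refine Finset.sum_congr rfl fun x _ => ?_
      refine congrArg (· * _) (Eq.trans ?_ (jacobianPoly_aeval q _ x))
      simp only [A, Matrix.map_apply, Matrix.of_apply, if_pos h]
    · rw [Finset.sum_eq_single (i, v, j)]
      · simp only [A, Matrix.map_apply, Matrix.of_apply, if_neg h, Pi.single_eq_same, map_one,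
          one_mul]
        rfl
      · intro b _ hb
        simp only [A, Matrix.map_apply, Matrix.of_apply, if_neg h, Pi.single_eq_of_ne hb, map_zero,
          zero_mul]
      · simp
  have hz : unflat.symm z = 0 := by
    refine eq_zero_of_mulVec_map_aeval hp A (unflat.symm (basisConfig 𝔽 c)) ?_ ?_
    · intro u' hu'
      obtain ⟨u, rfl⟩ := unflat.symm.surjective u'
      have hu : ∀ i v j, (if Attached F c i v ∧ (v = c i j → i = i₀) then
          segreDiff (basisConfig 𝔽 c) (Function.update (fun i' => c i' j) i v) u
          else u i v j) = 0 := fun i v j => by rw [← hA, hu']; rfl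
      have h1 : ∀ i v j, (v = c i j → i ≠ i₀) → u i v j = 0 := by
        intro i v j h
        have := hu i v j
        split_ifs at this with h'
        · rwa [segreDiff_basisConfig_update hk hc i v j fun h'' => h h'' (h'.2 h'')] at this
        · exact this
      have h2 : ∀ j, u i₀ (c i₀ j) j = 0 := by
        intro j
        have := hu i₀ (c i₀ j) j
        rw [if_pos ⟨hatt _ _, fun _ => rfl⟩, Function.update_eq_self i₀ (fun i' => c i' j),
          segreDiff_basisConfig (by omega) hc, Finset.sum_eq_single i₀] at this
        · exact this
        · intro i _ hi
          exact h1 i _ j fun _ => hi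
        · simp
      ext ⟨i, v, j⟩
      change u i v j = 0
      by_cases h : v = c i j → i ≠ i₀
      · exact h1 i v j h
      · push Not at h
        obtain ⟨rfl, rfl⟩ := h
        exact h2 j
    · ext ⟨i, v, j⟩
      refine (hA p z i v j).trans ?_
      split_ifs with h
      · have h1 : segreDiff p (Function.update (fun i' => c i' j) i v) z =
            segreDiff p (Function.update (fun i' => c i' j) i v) (x - y) := by
          refine segreDiff_congr _ _ fun i' => ?_
          by_cases hi : i' = i
          · subst hi
            rw [Function.update_self]
            exact if_pos h.1
          · rw [Function.update_of_ne hi]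
            exact if_pos (hatt i' j)
        rw [h1, map_sub, segreDiff_torus hy, sub_zero]
        exact hx _ (h.1 j)
      · by_cases ha : Attached F c i v
        · have h2 : v = c i j ∧ i ≠ i₀ := by
            by_contra h3
            exact h ⟨ha, fun h4 => by_contra fun h5 => h3 ⟨h4, h5⟩⟩
          obtain ⟨rfl, h3⟩ := h2
          change z i (c i j) j = 0
          simp only [z, if_pos ha]
          exact hxy i j h3
        · change z i v j = 0
          simp [z, if_neg ha]
  intro i v h
  ext j
  have := congrFun hz (i, v, j)
  change z i v j = 0 at this
  simp only [z, if_pos h] at this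
  exact this

open Classical in
/-- The hyperedges in the closure of `A` in the tensor rigidity matroid at `p`: those whose equation
follows from the equations of `A`. -/
noncomputable def spannedEdges (p : Config 𝔽 k n d) (A : Subgraph k n) : Subgraph k n :=
  Finset.univ.filter fun e =>
    ∀ x : Config 𝔽 k n d, (∀ f ∈ A, segreDiff p f x = 0) → segreDiff p e x = 0

lemma mem_spannedEdges {p : Config 𝔽 k n d} {A : Subgraph k n} {e : Edge k n} :
    e ∈ spannedEdges p A ↔
      ∀ x : Config 𝔽 k n d, (∀ f ∈ A, segreDiff p f x = 0) → segreDiff p e x = 0 := by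
  simp [spannedEdges]

lemma spannedEdges_mono (p : Config 𝔽 k n d) {A B : Subgraph k n} (h : A ⊆ B) :
    spannedEdges p A ⊆ spannedEdges p B := fun _ he =>
  mem_spannedEdges.2 fun x hx => mem_spannedEdges.1 he x fun f hf => hx f (h hf)

/-- The deterministic part of the argument: if every vertex of `G` is either joined by `d` edges to
the vertices attached in the closure of a subgraph `A`, or exceptional, and no edge has two
exceptional vertices, then minimum degree `d` forces rigidity. -/
theorem infinitesimallyRigid_of_attached (hk : 3 ≤ k) {p : Config 𝔽 k n d} (hp : Generic p)
    {A G : Subgraph k n} (hAG : A ⊆ G) {c : Fin k → Fin d → Fin n}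
    (hc : ∀ i, Function.Injective (c i))
    (hatt : ∀ i j, Attached (spannedEdges p A) c i (c i j)) {high : Fin k → Fin n → Prop}
    (hhigh : ∀ i v, high i v → ∃ S ⊆ G, d ≤ #S ∧ ∀ e ∈ S, e i = v ∧
      ∀ i', i' ≠ i → Attached (spannedEdges p A) c i' (e i'))
    (hlow : ∀ e ∈ G, ∀ i i', i ≠ i' → ¬ high i (e i) → high i' (e i'))
    (hdeg : MinDegreeGE d G) : InfinitesimallyRigid G p := by
  intro x hx
  obtain ⟨y, hy, hxy⟩ := exists_torus_eq_on_attached hk hp hc hatt (x := x)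
    fun e he => mem_spannedEdges.1 he x fun f hf => hx f (hAG hf)
  have hxy' : ∀ e ∈ G, segreDiff p e (x - y) = 0 := fun e he => by
    rw [map_sub, hx e he, segreDiff_torus hy, sub_zero]
  have h1 : ∀ i v, high i v → (x - y) i v = 0 := by
    intro i v h
    obtain ⟨S, hSG, hS, hSv⟩ := hhigh i v h
    exact eq_zero_of_card_le hp i v S hS (fun e he => (hSv e he).1) (fun e he => hxy' e (hSG he))
      fun e he i' hi' => hxy i' (e i') ((hSv e he).2 i' hi')
  have h2 : ∀ i v, (x - y) i v = 0 := by
    intro i v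
    by_cases h : high i v
    · exact h1 i v h
    · refine eq_zero_of_card_le hp i v {e ∈ G | e i = v} (hdeg i v) (by simp) (fun e he => ?_) ?_
      · exact hxy' e (Finset.mem_filter.1 he).1
      · intro e he i' hi'
        obtain ⟨heG, hev⟩ := Finset.mem_filter.1 he
        exact h1 i' (e i') (hlow e heG i i' hi'.symm (hev ▸ h))
  have h3 : x = y := by
    ext i v j
    exact sub_eq_zero.1 (congrFun (h2 i v) j)
  rwa [h3]

/-- Rigidity forces minimum degree `d`: fewer than `d` equations at a vertex let it move while all
other vertices stay. -/
lemma InfinitesimallyRigid.minDegreeGE (hn : 2 ≤ n) {p : Config 𝔽 k n d}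
    (hp : ∀ i v j, p i v j ≠ 0) {G : Subgraph k n} (h : InfinitesimallyRigid G p) :
    MinDegreeGE d G := by
  intro i v
  by_contra hlt
  push Not at hlt
  rw [degree] at hlt
  let S := {e ∈ G | e i = v}
  let L : (Fin d → 𝔽) →ₗ[𝔽] (S → 𝔽) := LinearMap.pi fun e =>
    (segreDiff p e.1).toLinearMap ∘ₗ (LinearMap.single 𝔽 (fun _ : Fin k => Fin n → Fin d → 𝔽) i) ∘ₗ
      (LinearMap.single 𝔽 (fun _ : Fin n => Fin d → 𝔽) v)
  obtain ⟨w, hw, hw0⟩ := Submodule.exists_mem_ne_zero_of_ne_bot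
    (LinearMap.ker_ne_bot_of_finrank_lt (f := L) (by simpa using hlt))
  let x : Config 𝔽 k n d := Pi.single i (Pi.single v w)
  have hx : ∀ e ∈ G, segreDiff p e x = 0 := by
    intro e he
    by_cases hev : e i = v
    · exact congrFun (LinearMap.mem_ker.1 hw) ⟨e, by simp [S, he, hev]⟩
    · rw [← map_zero (segreDiff p e)]
      refine segreDiff_congr p e fun i' => ?_
      by_cases hi : i' = i
      · subst hi
        simp [x, Pi.single_eq_of_ne hev]
      · simp [x, Pi.single_eq_of_ne hi]
  obtain ⟨lam, -, hlam⟩ := h x hx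
  have : Nontrivial (Fin n) := Fin.nontrivial_iff_two_le.2 hn
  obtain ⟨u, hu⟩ := exists_ne v
  apply hw0
  ext j
  have h1 := hlam i u j
  have h2 := hlam i v j
  simp only [x, Pi.single_eq_same, Pi.single_eq_of_ne hu, Pi.zero_apply] at h1 h2
  have h3 : lam i j = 0 := (mul_eq_zero.1 h1.symm).resolve_right (hp _ _ _)
  rw [h2, h3, zero_mul, Pi.zero_apply]

end Attachment

/-! ### Disjoint transversals with attached vertices -/

section Base

variable {k n d : ℕ}

/-- Summing a function of the `j`-th transversal of a uniformly distributed `k × d` array of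
vertices amounts to summing over all hyperedges. -/
lemma card_mul_sum_transversal (f : Edge k n → ℝ) (j : Fin d) :
    (Fintype.card (Edge k n) : ℝ) * ∑ c : Fin k → Fin d → Fin n, f (fun i => c i j) =
      Fintype.card (Fin k → Fin d → Fin n) * ∑ e, f e := by
  let g : (Fin k → Fin d → Fin n) × Edge k n → (Fin k → Fin d → Fin n) × Edge k n :=
    fun y => (fun i => Function.update (y.1 i) j (y.2 i), fun i => y.1 i j)
  have hg : Function.Involutive g := by
    rintro ⟨c, x⟩
    simp [g]
  have h := Equiv.sum_comp hg.toPerm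
    (fun y : (Fin k → Fin d → Fin n) × Edge k n => f y.2)
  simp only [Function.Involutive.coe_toPerm, Fintype.sum_prod_type] at h
  simp only [g, Finset.sum_const, card_univ, nsmul_eq_mul] at h
  rw [← h, Finset.mul_sum]

/-- Resampling the entry `c i j` of a uniformly distributed array. -/
lemma sum_resample (i : Fin k) (j : Fin d) (f : (Fin k → Fin d → Fin n) → Fin n → ℝ) :
    ∑ c : Fin k → Fin d → Fin n, ∑ v, f c v =
      ∑ c : Fin k → Fin d → Fin n, ∑ v,
        f (Function.update c i (Function.update (c i) j v)) (c i j) := by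
  let g : (Fin k → Fin d → Fin n) × Fin n → (Fin k → Fin d → Fin n) × Fin n :=
    fun y => (Function.update y.1 i (Function.update (y.1 i) j y.2), y.1 i j)
  have hg : Function.Involutive g := by
    rintro ⟨c, x⟩
    simp [g]
  have h := Equiv.sum_comp hg.toPerm
    (fun y : (Fin k → Fin d → Fin n) × Fin n => f y.1 y.2)
  simp only [Function.Involutive.coe_toPerm, Fintype.sum_prod_type] at h
  exact h.symm

lemma transversal_update (c : Fin k → Fin d → Fin n) (i : Fin k) (j : Fin d) (v : Fin n) :
    (fun i' => Function.update c i (Function.update (c i) j v) i' j) =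
      Function.update (fun i' => c i' j) i v := by
  ext i'
  by_cases h : i' = i
  · subst h; simp
  · simp [Function.update_of_ne h]

open Classical in
/-- In a `k`-partite hypergraph `F` that misses a small fraction of the edges there are `d` disjoint
transversals, all of whose vertices are attached, such that nearly all vertices are attached: a
uniformly random choice of the transversals has these properties with positive probability. -/
lemma exists_transversals_attached (hk : 1 ≤ k) (hd : 1 ≤ d) {ε δ : ℝ} (hε : 0 < ε)
    (hδ0 : 0 ≤ δ) (hδ : δ * (4 * k * d ^ 2) ≤ min ε 1) (hn : 2 * k * d ^ 2 < n) (F : Subgraph k n)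
    (hF : (#Fᶜ : ℝ) ≤ δ * Fintype.card (Edge k n)) :
    ∃ c : Fin k → Fin d → Fin n, (∀ i, Function.Injective (c i)) ∧
      (∀ i j, Attached F c i (c i j)) ∧
      ∀ i, (#{v | ¬ Attached F c i v} : ℝ) ≤ ε * n := by
  have hn0 : 0 < n := by omega
  have hnR : (0 : ℝ) < n := by exact_mod_cast hn0
  have : Nonempty (Fin n) := ⟨⟨0, hn0⟩⟩
  set X : ℝ := (Fintype.card (Fin k → Fin d → Fin n) : ℝ) with hX
  have hX0 : 0 < X := by rw [hX]; exact_mod_cast Fintype.card_pos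
  have hN0 : (0 : ℝ) < Fintype.card (Edge k n) := by exact_mod_cast Fintype.card_pos
  let m : Edge k n → ℝ := fun e => if e ∈ F then 0 else 1
  have hm0 : ∀ e, 0 ≤ m e := fun e => by simp only [m]; split_ifs <;> norm_num
  have hm : ∑ e, m e ≤ δ * Fintype.card (Edge k n) := by
    refine le_trans (le_of_eq ?_) hF
    simp only [m]
    rw [Finset.sum_ite, Finset.sum_const_zero, zero_add, Finset.sum_const, nsmul_eq_mul, mul_one]
    congr 2
    ext e; simp
  have s0 : ∀ j, ∑ c : Fin k → Fin d → Fin n, m (fun i => c i j) ≤ δ * X := by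
    intro j
    have h1 := card_mul_sum_transversal m j
    have h2 : (Fintype.card (Edge k n) : ℝ) * ∑ c : Fin k → Fin d → Fin n, m (fun i => c i j) ≤
        Fintype.card (Edge k n) * (δ * X) := by
      rw [h1]
      calc _ ≤ X * (δ * Fintype.card (Edge k n)) := by gcongr
        _ = _ := by ring
    exact le_of_mul_le_mul_left h2 hN0
  have s1 : ∀ i (j j' : Fin d), ∑ c : Fin k → Fin d → Fin n,
      (if j ≠ j' ∧ c i j = c i j' then (1 : ℝ) else 0) ≤ X / n := by
    intro i j j'
    by_cases hj : j = j'
    · simp only [hj, ne_eq, not_true, false_and, if_false, Finset.sum_const_zero]; positivity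
    · rw [le_div_iff₀ hnR, Finset.sum_mul]
      refine le_of_eq ?_
      calc ∑ c : Fin k → Fin d → Fin n, (if j ≠ j' ∧ c i j = c i j' then (1 : ℝ) else 0) * n
          = ∑ c : Fin k → Fin d → Fin n, ∑ v : Fin n, if c i j = c i j' then (1 : ℝ) else 0 := by
            refine Finset.sum_congr rfl fun c _ => ?_
            simp [hj, mul_comm]
        _ = ∑ c : Fin k → Fin d → Fin n, ∑ v : Fin n, if v = c i j' then (1 : ℝ) else 0 := by
            rw [sum_resample i j]
            simp [Function.update_of_ne (Ne.symm hj)]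
        _ = X := by simp [hX]
  have s2 : ∀ i (j j' : Fin d), ∑ c : Fin k → Fin d → Fin n,
      m (Function.update (fun i' => c i' j') i (c i j)) ≤ δ * X := by
    intro i j j'
    refine le_trans (le_of_eq ?_) (s0 j')
    let g : (Fin k → Fin d → Fin n) → (Fin k → Fin d → Fin n) :=
      fun c => Function.update c i (c i ∘ Equiv.swap j j')
    have hg : Function.Involutive g := by
      intro c
      simp [g, Function.comp_assoc, ← Equiv.coe_trans]
    have h := Equiv.sum_comp hg.toPerm (fun c => m (fun i => c i j'))
    rw [← h]
    refine Finset.sum_congr rfl fun c _ => ?_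
    congr 1
    ext i'
    by_cases hi : i' = i
    · subst hi; simp [g]
    · simp [g, Function.update_of_ne hi]
  have s3 : ∀ i (j : Fin d), ∑ c : Fin k → Fin d → Fin n, ∑ v,
      m (Function.update (fun i' => c i' j) i v) ≤ n * (δ * X) := by
    intro i j
    have h := sum_resample i j (fun (c : Fin k → Fin d → Fin n) (_ : Fin n) => m (fun i' => c i' j))
    simp only [transversal_update] at h
    rw [← h]
    simp only [Finset.sum_const, card_univ, Fintype.card_fin, nsmul_eq_mul]
    rw [← Finset.mul_sum]
    have := s0 j
    gcongr
  -- `Φ c` counts the coincidences in `c` and the edges outside of `F` that prevent a vertex of `c`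
  -- from being attached, plus the fraction of unattached vertices in units of `ε n`; its mean is
  -- less than one
  let Φ : (Fin k → Fin d → Fin n) → ℝ := fun c => ∑ i, ∑ j, ∑ j',
      ((if j ≠ j' ∧ c i j = c i j' then (1 : ℝ) else 0) +
        m (Function.update (fun i' => c i' j') i (c i j))) +
      ∑ i, ∑ j, (∑ v, m (Function.update (fun i' => c i' j) i v)) / (ε * n)
  have hΦ : ∑ c, Φ c < ∑ c : Fin k → Fin d → Fin n, (1 : ℝ) := by
    have e1 : ∑ c, Φ c = ∑ i, ∑ j, ∑ j',
        (∑ c : Fin k → Fin d → Fin n, (if j ≠ j' ∧ c i j = c i j' then (1 : ℝ) else 0) +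
        ∑ c : Fin k → Fin d → Fin n, m (Function.update (fun i' => c i' j') i (c i j))) +
        ∑ i, ∑ j, (∑ c : Fin k → Fin d → Fin n, ∑ v,
          m (Function.update (fun i' => c i' j) i v)) / (ε * n) := by
      rw [Finset.sum_add_distrib]
      congr 1
      · rw [Finset.sum_comm]
        refine Finset.sum_congr rfl fun i _ => ?_
        rw [Finset.sum_comm]
        refine Finset.sum_congr rfl fun j _ => ?_
        rw [Finset.sum_comm]
        refine Finset.sum_congr rfl fun j' _ => ?_
        rw [Finset.sum_add_distrib]
      · rw [Finset.sum_comm]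
        refine Finset.sum_congr rfl fun i _ => ?_
        rw [Finset.sum_comm]
        refine Finset.sum_congr rfl fun j _ => ?_
        rw [Finset.sum_div]
    have e2 : ∑ c, Φ c ≤ ∑ i : Fin k, ∑ j : Fin d, ∑ j' : Fin d, (X / n + δ * X) +
        ∑ i : Fin k, ∑ j : Fin d, (n * (δ * X)) / (ε * n) := by
      rw [e1]
      gcongr with i _ j _ j' _ i _ j _
      · exact s1 i j j'
      · exact s2 i j j'
      · exact s3 i j
    refine e2.trans_lt ?_
    simp only [Finset.sum_const, card_univ, Fintype.card_fin, nsmul_eq_mul, mul_one]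
    rw [← hX]
    have h1 : (k : ℝ) * (d * (d * (X / n))) < X / 2 := by
      have : (2 : ℝ) * k * d ^ 2 < n := by exact_mod_cast hn
      rw [show (k : ℝ) * (d * (d * (X / n))) = (k * d ^ 2) * X / n by ring,
        div_lt_div_iff₀ hnR two_pos]
      nlinarith
    have hkd : (1 : ℝ) ≤ d := by exact_mod_cast hd
    have hkk : (1 : ℝ) ≤ k := by exact_mod_cast hk
    have h2 : (k : ℝ) * (d * (d * (δ * X))) ≤ X / 4 := by
      have := hδ.trans (min_le_right _ _)
      nlinarith
    have h3 : (k : ℝ) * (d * ((n * (δ * X)) / (ε * n))) ≤ X / 4 := by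
      rw [show (k : ℝ) * (d * ((n * (δ * X)) / (ε * n))) = (k * d * δ * X) / ε by field_simp,
        div_le_div_iff₀ hε (by norm_num)]
      have h4 := hδ.trans (min_le_left _ _)
      have h5 : (d : ℝ) ≤ d ^ 2 := by nlinarith
      have h6 : k * d * δ * 4 ≤ ε := by
        refine le_trans ?_ h4
        have : (k : ℝ) * δ * d ≤ k * δ * d ^ 2 := by gcongr
        nlinarith
      nlinarith
    have h7 : (k : ℝ) * (d * (d * (X / n + δ * X))) =
        k * (d * (d * (X / n))) + k * (d * (d * (δ * X))) := by
      ring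
    rw [h7]
    linarith
  obtain ⟨c, -, hc⟩ := Finset.exists_lt_of_sum_lt hΦ
  have hnn1 : ∀ i j j', 0 ≤ (if j ≠ j' ∧ c i j = c i j' then (1 : ℝ) else 0) +
        m (Function.update (fun i' => c i' j') i (c i j)) := fun i j j' =>
    add_nonneg (by split_ifs <;> norm_num) (hm0 _)
  have hnn2 : ∀ i j, 0 ≤ (∑ v, m (Function.update (fun i' => c i' j) i v)) / (ε * n) := fun i j =>
    div_nonneg (Finset.sum_nonneg fun _ _ => hm0 _) (by positivity)
  have hA : ∀ i j j', (if j ≠ j' ∧ c i j = c i j' then (1 : ℝ) else 0) +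
        m (Function.update (fun i' => c i' j') i (c i j)) < 1 := by
    intro i j j'
    let D : Fin k → Fin d → Fin d → ℝ := fun i j j' =>
      (if j ≠ j' ∧ c i j = c i j' then (1 : ℝ) else 0) +
        m (Function.update (fun i' => c i' j') i (c i j))
    have a1 := Finset.single_le_sum (f := fun j' => D i j j')
      (fun j' _ => hnn1 i j j') (mem_univ j')
    have a2 := Finset.single_le_sum (f := fun j => ∑ j', D i j j')
      (fun j _ => Finset.sum_nonneg fun j' _ => hnn1 i j j') (mem_univ j)
    have a3 := Finset.single_le_sum (f := fun i => ∑ j, ∑ j', D i j j')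
      (fun i _ => Finset.sum_nonneg fun j _ => Finset.sum_nonneg fun j' _ => hnn1 i j j')
      (mem_univ i)
    have a4 : 0 ≤ ∑ i, ∑ j, (∑ v, m (Function.update (fun i' => c i' j) i v)) / (ε * n) :=
      Finset.sum_nonneg fun i _ => Finset.sum_nonneg fun j _ => hnn2 i j
    simp only [Φ] at hc
    simp only [D] at a1 a2 a3
    linarith
  have hB : ∀ i, ∑ j, (∑ v, m (Function.update (fun i' => c i' j) i v)) / (ε * n) < 1 := by
    intro i
    have a3 := Finset.single_le_sum
        (f := fun i => ∑ j, (∑ v, m (Function.update (fun i' => c i' j) i v)) / (ε * n))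
        (fun i _ => Finset.sum_nonneg fun j _ => hnn2 i j) (mem_univ i)
    have a4 : 0 ≤ ∑ i, ∑ j, ∑ j', ((if j ≠ j' ∧ c i j = c i j' then (1 : ℝ) else 0) +
        m (Function.update (fun i' => c i' j') i (c i j))) :=
      Finset.sum_nonneg fun i _ => Finset.sum_nonneg fun j _ =>
        Finset.sum_nonneg fun j' _ => hnn1 i j j'
    simp only [Φ] at hc
    linarith
  refine ⟨c, fun i j j' hjj => ?_, fun i j j' => ?_, fun i => ?_⟩
  · by_contra hne
    have := hA i j j'
    rw [if_pos ⟨hne, hjj⟩] at this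
    linarith [hm0 (Function.update (fun i' => c i' j') i (c i j))]
  · by_contra hne
    have := hA i j j'
    have h1 : m (Function.update (fun i' => c i' j') i (c i j)) = 1 := if_neg hne
    rw [h1] at this
    have h2 : (0 : ℝ) ≤ if j ≠ j' ∧ c i j = c i j' then (1 : ℝ) else 0 := by
      split_ifs <;> norm_num
    linarith
  · have h1 := hB i
    rw [← Finset.sum_div, div_lt_one (by positivity), Finset.sum_comm] at h1
    refine le_trans ?_ h1.le
    rw [Finset.card_filter]
    push_cast
    refine Finset.sum_le_sum fun v _ => ?_
    split_ifs with h
    · exact Finset.sum_nonneg fun _ _ => hm0 _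
    · obtain ⟨j, hj⟩ := not_forall.1 h
      have h2 : m (Function.update (fun i' => c i' j) i v) = 1 := if_neg hj
      refine h2.symm.le.trans ?_
      exact Finset.single_le_sum (f := fun j => m (Function.update (fun i' => c i' j) i v))
        (fun _ _ => hm0 _) (mem_univ j)

end Base

/-! ### Expectations over binomial random subsets -/

section Expectation

variable {ι : Type*} {p q : ℝ} {s t : Finset ι}

/-- Expectation of `f A` when `A` is the random subset of `s` that contains each element
independently with probability `p`. -/
noncomputable def expect (p : ℝ) (s : Finset ι) (f : Finset ι → ℝ) : ℝ :=
  ∑ A ∈ s.powerset, p ^ #A * (1 - p) ^ (#s - #A) * f A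

lemma expect_empty (f : Finset ι → ℝ) : expect p ∅ f = f ∅ := by
  simp [expect]

lemma expect_insert [DecidableEq ι] {a : ι} (ha : a ∉ s) (f : Finset ι → ℝ) :
    expect p (insert a s) f =
      (1 - p) * expect p s f + p * expect p s (fun A => f (insert a A)) := by
  rw [expect, Finset.sum_powerset_insert ha, expect, expect, Finset.mul_sum, Finset.mul_sum]
  congr 1
  · refine Finset.sum_congr rfl fun A hA => ?_
    have h1 := Finset.card_le_card (Finset.mem_powerset.1 hA)
    rw [Finset.card_insert_of_notMem ha, Nat.sub_add_comm h1, pow_succ]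
    ring
  · refine Finset.sum_congr rfl fun A hA => ?_
    rw [Finset.card_insert_of_notMem ha,
      Finset.card_insert_of_notMem fun h => ha (Finset.mem_powerset.1 hA h),
      Nat.add_sub_add_right, pow_succ]
    ring

lemma expect_congr {f g : Finset ι → ℝ} (h : ∀ A ⊆ s, f A = g A) :
    expect p s f = expect p s g :=
  Finset.sum_congr rfl fun A hA => by rw [h A (Finset.mem_powerset.1 hA)]

lemma expect_add (f g : Finset ι → ℝ) :
    expect p s (fun A => f A + g A) = expect p s f + expect p s g := by
  simp only [expect, mul_add, Finset.sum_add_distrib]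

lemma expect_const_mul (c : ℝ) (f : Finset ι → ℝ) :
    expect p s (fun A => c * f A) = c * expect p s f := by
  rw [expect, expect, Finset.mul_sum]
  exact Finset.sum_congr rfl fun A _ => by ring

lemma expect_sum {κ : Type*} (T : Finset κ) (f : κ → Finset ι → ℝ) :
    expect p s (fun A => ∑ i ∈ T, f i A) = ∑ i ∈ T, expect p s (f i) := by
  simp only [expect, Finset.mul_sum]
  rw [Finset.sum_comm]

lemma expect_const (c : ℝ) : expect p s (fun _ => c) = c := by
  rw [expect, ← Finset.sum_mul, Finset.sum_pow_mul_eq_add_pow]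
  simp

lemma expect_mono (h0 : 0 ≤ p) (h1 : p ≤ 1) {f g : Finset ι → ℝ} (h : ∀ A ⊆ s, f A ≤ g A) :
    expect p s f ≤ expect p s g :=
  Finset.sum_le_sum fun A hA => mul_le_mul_of_nonneg_left (h A (Finset.mem_powerset.1 hA))
    (mul_nonneg (pow_nonneg h0 _) (pow_nonneg (sub_nonneg.2 h1) _))

lemma expect_nonneg (h0 : 0 ≤ p) (h1 : p ≤ 1) {f : Finset ι → ℝ} (h : ∀ A, 0 ≤ f A) :
    0 ≤ expect p s f := by
  rw [← expect_const (p := p) (s := s) 0]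
  exact expect_mono h0 h1 fun A _ => h A

lemma expect_prod [DecidableEq ι] (g : ι → ℝ) :
    expect p s (fun A => ∏ e ∈ A, g e) = ∏ e ∈ s, (1 - p + p * g e) := by
  induction s using Finset.induction_on with
  | empty => simp [expect_empty]
  | insert a s ha ih =>
    rw [expect_insert ha, Finset.prod_insert ha, ← ih]
    have : expect p s (fun A => ∏ e ∈ insert a A, g e) =
        expect p s (fun A => g a * ∏ e ∈ A, g e) :=
      expect_congr fun A hA => Finset.prod_insert fun h => ha (hA h)
    rw [this, expect_const_mul]
    ring

/-- The union of two independent random subsets is a random subset. -/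
lemma expect_union [DecidableEq ι] (f : Finset ι → ℝ) :
    expect p s (fun A => expect q s (fun B => f (A ∪ B))) = expect (p + q - p * q) s f := by
  induction s using Finset.induction_on generalizing f with
  | empty => simp [expect_empty]
  | insert a s ha ih =>
    simp only [expect_insert ha, expect_add, expect_const_mul, Finset.insert_union,
      Finset.union_insert, Finset.insert_idem, ih]
    rw [ih (fun A => f (insert a A))]
    ring

/-- The restrictions of the random subset to disjoint sets are independent. -/
lemma expect_disjoint_union [DecidableEq ι] (hst : Disjoint s t) (f : Finset ι → ℝ) :
    expect p (s ∪ t) f = expect p s (fun A => expect p t (fun B => f (A ∪ B))) := by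
  induction s using Finset.induction_on generalizing f with
  | empty => simp [expect_empty]
  | insert a s ha ih =>
    rw [Finset.disjoint_insert_left] at hst
    rw [Finset.insert_union, expect_insert (by simp [ha, hst.1]), expect_insert ha, ih hst.2,
      ih hst.2]
    simp only [Finset.insert_union]

lemma expect_biUnion_prod [DecidableEq ι] {κ : Type*} [DecidableEq κ] (U : Finset κ)
    (S : κ → Finset ι)
    (hS : ∀ a b, a ≠ b → Disjoint (S a) (S b)) (f : κ → Finset ι → ℝ) :
    expect p (U.biUnion S) (fun A => ∏ a ∈ U, f a (A ∩ S a)) = ∏ a ∈ U, expect p (S a) (f a) := by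
  induction U using Finset.induction_on with
  | empty => simp [expect_empty]
  | insert a U ha ih =>
    have hd : Disjoint (S a) (U.biUnion S) := by
      rw [Finset.disjoint_biUnion_right]
      exact fun b hb => hS a b fun h => ha (h ▸ hb)
    rw [Finset.biUnion_insert, expect_disjoint_union hd, Finset.prod_insert ha, ← ih, mul_comm,
      ← expect_const_mul]
    refine expect_congr fun A hA => ?_
    rw [mul_comm, ← expect_const_mul]
    refine expect_congr fun B hB => ?_
    rw [Finset.prod_insert ha]
    congr 1
    · congr 1
      rw [Finset.union_inter_distrib_right, Finset.inter_eq_left.2 hA,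
        Finset.disjoint_iff_inter_eq_empty.1 (hd.symm.mono_left hB), Finset.union_empty]
    · refine Finset.prod_congr rfl fun b hb => ?_
      congr 1
      rw [Finset.union_inter_distrib_right,
        Finset.disjoint_iff_inter_eq_empty.1 ((hS a b fun h => ha (h ▸ hb)).mono_left hA),
        Finset.empty_union]

/-- The event that `e` is chosen is independent of the other elements of the random subset. -/
lemma expect_ite_mem_erase [DecidableEq ι] {e : ι} (he : e ∈ s) (f : Finset ι → ℝ) :
    expect p s (fun A => if e ∈ A then f (A.erase e) else 0) =
      p * expect p s (fun A => f (A.erase e)) := by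
  rw [← Finset.insert_erase he]
  have hn : e ∉ s.erase e := Finset.notMem_erase e s
  rw [expect_insert hn, expect_insert hn]
  have h1 : expect p (s.erase e) (fun A => if e ∈ A then f (A.erase e) else 0) =
      expect p (s.erase e) (fun _ => 0) :=
    expect_congr fun A hA => if_neg fun h => hn (hA h)
  have h2 : expect p (s.erase e) (fun A => if e ∈ insert e A then f ((insert e A).erase e) else 0) =
      expect p (s.erase e) f :=
    expect_congr fun A hA => by
      rw [if_pos (Finset.mem_insert_self _ _), Finset.erase_insert fun h => hn (hA h)]
  have h3 : expect p (s.erase e) (fun A => f (A.erase e)) = expect p (s.erase e) f :=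
    expect_congr fun A hA => by rw [Finset.erase_eq_of_notMem fun h => hn (hA h)]
  have h4 : expect p (s.erase e) (fun A => f ((insert e A).erase e)) = expect p (s.erase e) f :=
    expect_congr fun A hA => by rw [Finset.erase_insert fun h => hn (hA h)]
  rw [h1, h2, h3, h4, expect_const]
  ring

open Classical in
/-- Probability of an event of the random subset. -/
noncomputable def prob (p : ℝ) (s : Finset ι) (P : Finset ι → Prop) : ℝ :=
  expect p s fun A => if P A then 1 else 0

lemma prob_nonneg (h0 : 0 ≤ p) (h1 : p ≤ 1) (P : Finset ι → Prop) : 0 ≤ prob p s P :=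
  expect_nonneg h0 h1 fun A => by split_ifs <;> norm_num

lemma prob_not (P : Finset ι → Prop) : prob p s (fun A => ¬ P A) = 1 - prob p s P := by
  rw [eq_sub_iff_add_eq]
  unfold prob
  rw [← expect_add]
  refine (expect_congr fun A _ => ?_).trans (expect_const 1)
  by_cases h : P A <;> simp [h]

lemma prob_mono (h0 : 0 ≤ p) (h1 : p ≤ 1) {P Q : Finset ι → Prop} (h : ∀ A, P A → Q A) :
    prob p s P ≤ prob p s Q :=
  expect_mono h0 h1 fun A _ => by
    by_cases hP : P A
    · simp [hP, h A hP]
    · rw [if_neg hP]; split_ifs <;> norm_num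

lemma prob_le_expect (h0 : 0 ≤ p) (h1 : p ≤ 1) {P : Finset ι → Prop} {f : Finset ι → ℝ}
    (hf : ∀ A, 0 ≤ f A) (h : ∀ A, P A → 1 ≤ f A) : prob p s P ≤ expect p s f :=
  expect_mono h0 h1 fun A _ => by
    split_ifs with hP
    · exact h A hP
    · exact hf A

lemma prob_or_le (h0 : 0 ≤ p) (h1 : p ≤ 1) (P Q : Finset ι → Prop) :
    prob p s (fun A => P A ∨ Q A) ≤ prob p s P + prob p s Q := by
  unfold prob
  rw [← expect_add]
  refine expect_mono h0 h1 fun A _ => ?_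
  by_cases hP : P A <;> by_cases hQ : Q A <;> simp [hP, hQ]

/-- The probability of an increasing event increases with `p`. -/
lemma prob_le_prob_of_le [DecidableEq ι] (h0 : 0 ≤ p) (hpq : p ≤ q) (h1 : q ≤ 1)
    {P : Finset ι → Prop}
    (hP : ∀ A B, A ⊆ B → P A → P B) : prob p s P ≤ prob q s P := by
  rcases eq_or_lt_of_le (hpq.trans h1) with rfl | hp1
  · rw [le_antisymm hpq h1]
  · have h1p : 0 < 1 - p := sub_pos.2 hp1
    set r : ℝ := (q - p) / (1 - p) with hr
    have hr0 : 0 ≤ r := div_nonneg (sub_nonneg.2 hpq) h1p.le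
    have hr1 : r ≤ 1 := (div_le_one h1p).2 (by linarith)
    have hq : p + r - p * r = q := by
      have : r * (1 - p) = q - p := div_mul_cancel₀ _ h1p.ne'
      linarith
    unfold prob
    rw [← hq, ← expect_union]
    refine expect_mono h0 (hpq.trans h1) fun A _ => ?_
    refine (expect_const (p := r) (s := s) _).symm.le.trans ?_
    refine expect_mono hr0 hr1 fun B _ => ?_
    by_cases hA : P A
    · rw [if_pos hA, if_pos (hP A _ Finset.subset_union_left hA)]
    · rw [if_neg hA]; split_ifs <;> norm_num

/-- The moment generating function of the size of a random subset, with the usual estimate. -/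
lemma expect_pow_card_inter_le [DecidableEq ι] [Fintype ι] (h0 : 0 ≤ p) (h1 : p ≤ 1) {z : ℝ}
    (hz : 0 ≤ z)
    (F : Finset ι) :
    expect p univ (fun A => z ^ #(A ∩ F)) ≤ Real.exp ((z - 1) * p * #F) := by
  have h2 : ∀ A : Finset ι, z ^ #(A ∩ F) = ∏ e ∈ A, if e ∈ F then z else 1 := by
    intro A
    rw [Finset.prod_ite, Finset.prod_const, Finset.prod_const_one, mul_one,
      Finset.filter_mem_eq_inter]
  simp only [h2]
  rw [expect_prod]
  have h3 : ∀ e, 1 - p + p * (if e ∈ F then z else 1) = if e ∈ F then 1 - p + p * z else 1 := by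
    intro e; split_ifs <;> ring
  rw [Finset.prod_congr rfl fun e _ => h3 e, Finset.prod_ite, Finset.prod_const,
    Finset.prod_const_one, mul_one, Finset.filter_mem_eq_inter, Finset.univ_inter]
  have h4 : 1 - p + p * z ≤ Real.exp ((z - 1) * p) := by
    have := Real.add_one_le_exp ((z - 1) * p)
    linarith
  calc (1 - p + p * z) ^ #F ≤ Real.exp ((z - 1) * p) ^ #F :=
        pow_le_pow_left₀ (by nlinarith) h4 _
    _ = _ := by rw [← Real.exp_nat_mul]; congr 1; ring

/-- Probability that a random subset of `s` has at least `m + 1` elements. -/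
lemma prob_lt_card_le (h0 : 0 ≤ p) (h1 : p ≤ 1) (m : ℕ) :
    prob p s (fun A => m < #A) ≤ 1 - (#s).choose m * p ^ m * (1 - p) ^ (#s - m) := by
  have h2 : prob p s (fun A => #A = m) = (#s).choose m * p ^ m * (1 - p) ^ (#s - m) := by
    rw [prob, expect]
    simp only [mul_ite, mul_one, mul_zero]
    rw [← Finset.sum_filter, ← Finset.powersetCard_eq_filter, ← Finset.card_powersetCard, mul_assoc,
      ← nsmul_eq_mul, ← Finset.sum_const]
    refine Finset.sum_congr rfl fun A hA => ?_
    rw [(Finset.mem_powersetCard.1 hA).2]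
  have h3 : prob p s (fun A => m < #A) + prob p s (fun A => #A = m) ≤ 1 := by
    unfold prob
    rw [← expect_add]
    refine (expect_mono h0 h1 fun A _ => ?_).trans (expect_const 1).le
    by_cases h : #A = m
    · simp [h]
    · rw [if_neg h, add_zero]; split_ifs <;> norm_num
  linarith

end Expectation

/-! ### Invariance of random subsets under permutations -/

section Permutations

variable {ι : Type*} [Fintype ι]

lemma expect_map (p : ℝ) (σ : Equiv.Perm ι) (f : Finset ι → ℝ) :
    expect p univ (fun A => f (A.map σ.toEmbedding)) = expect p univ f := by
  unfold expect
  rw [Finset.powerset_univ]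
  refine Eq.trans ?_ (Equiv.sum_comp (Equiv.finsetCongr σ)
    fun A => p ^ #A * (1 - p) ^ (#(univ : Finset ι) - #A) * f A)
  simp

/-- The joint law of three independent random subsets is invariant under permutations, so
expectations may be averaged over all permutations. -/
lemma expect_eq_average [DecidableEq ι] (p q r : ℝ) (f : Finset ι → Finset ι → Finset ι → ℝ) :
    expect p univ (fun A => expect q univ fun B => expect r univ fun C => f A B C) =
      expect p univ (fun A => expect q univ fun B => expect r univ fun C =>
        (∑ σ : Equiv.Perm ι, f (A.map σ.toEmbedding) (B.map σ.toEmbedding) (C.map σ.toEmbedding)) /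
          Fintype.card (Equiv.Perm ι)) := by
  have h : ∀ σ : Equiv.Perm ι, expect p univ (fun A => expect q univ fun B => expect r univ fun C =>
      f (A.map σ.toEmbedding) (B.map σ.toEmbedding) (C.map σ.toEmbedding)) =
      expect p univ (fun A => expect q univ fun B => expect r univ fun C => f A B C) := by
    intro σ
    refine Eq.trans ?_
      (expect_map p σ fun A => expect q univ fun B => expect r univ fun C => f A B C)
    refine expect_congr fun A _ => ?_
    refine Eq.trans ?_
      (expect_map q σ fun B => expect r univ fun C => f (A.map σ.toEmbedding) B C)
    refine expect_congr fun B _ => ?_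
    exact expect_map r σ fun C => f (A.map σ.toEmbedding) (B.map σ.toEmbedding) C
  have hc : (Fintype.card (Equiv.Perm ι) : ℝ) ≠ 0 := by
    exact_mod_cast Fintype.card_ne_zero
  simp only [div_eq_inv_mul, expect_const_mul, expect_sum, h]
  rw [Finset.sum_const, card_univ, nsmul_eq_mul, inv_mul_cancel_left₀ hc]

end Permutations

/-! ### The random process and its coupling with random subgraphs -/

section Coupling

variable {k n : ℕ}

lemma mem_graphAt {w : Ordering k n} {m : ℕ} {e : Edge k n} :
    e ∈ graphAt w m ↔ (w.symm e : ℕ) < m := by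
  simp [graphAt]

lemma graphAt_mono (w : Ordering k n) {m m' : ℕ} (h : m ≤ m') : graphAt w m ⊆ graphAt w m' :=
  fun _ he => mem_graphAt.2 ((mem_graphAt.1 he).trans_le h)

lemma graphAt_trans (w : Ordering k n) (σ : Equiv.Perm (Edge k n)) (m : ℕ) :
    graphAt (w.trans σ) m = (graphAt w m).map σ.toEmbedding := by
  ext e
  simp [mem_graphAt, Finset.mem_map_equiv]

lemma card_graphAt (w : Ordering k n) {m : ℕ} (hm : m ≤ Fintype.card (Edge k n)) :
    #(graphAt w m) = m := by
  have : graphAt w m = (univ.filter fun i : Fin (Fintype.card (Edge k n)) => (i : ℕ) < m).map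
      w.toEmbedding := by
    ext e
    simp [mem_graphAt, Finset.mem_map_equiv]
  rw [this, Finset.card_map, Fin.card_filter_val_lt, min_eq_right hm]

/-- Any two nested subgraphs occur in some ordering of the edges. -/
lemma exists_ordering {F G : Subgraph k n} (hFG : F ⊆ G) :
    ∃ w : Ordering k n, graphAt w #F = F ∧ graphAt w #G = G := by
  let e₀ : Ordering k n := (Fintype.equivFin (Edge k n)).symm
  let stage : Edge k n → ℕ := fun e => if e ∈ F then 0 else if e ∈ G then 1 else 2
  let σ := Tuple.sort (stage ∘ e₀)
  let w : Ordering k n := σ.trans e₀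
  have hmono : Monotone (stage ∘ w) := Tuple.monotone_sort (stage ∘ e₀)
  have key : ∀ (H : Subgraph k n) (a : ℕ), (∀ e, e ∈ H ↔ stage e ≤ a) → graphAt w #H = H := by
    intro H a hH
    have hc : #(graphAt w #H) = #H := card_graphAt w (Finset.card_le_univ H)
    by_cases hsub : graphAt w #H ⊆ H
    · exact Finset.eq_of_subset_of_card_le hsub hc.ge
    · obtain ⟨e, he, heH⟩ := Finset.not_subset.1 hsub
      refine (Finset.eq_of_subset_of_card_le (fun f hf => ?_) hc.le).symm
      rw [mem_graphAt] at he ⊢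
      refine lt_of_le_of_lt ?_ he
      by_contra hlt
      have := hmono (show w.symm e ≤ w.symm f from (not_le.1 hlt).le)
      simp only [Function.comp_apply, Equiv.apply_symm_apply] at this
      exact heH ((hH e).2 (this.trans ((hH f).1 hf)))
  refine ⟨w, key F 0 fun e => ?_, key G 1 fun e => ?_⟩
  · simp only [stage]; split_ifs <;> simp_all
  · simp only [stage]
    by_cases h : e ∈ F
    · simp [h, hFG h]
    · split_ifs <;> simp_all

open Classical in
/-- A uniformly random ordering is a fixed ordering followed by a uniformly random permutation. -/
lemma uniformProb_ordering (Q : Ordering k n → Prop) (w : Ordering k n) :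
    uniformProb (Ordering k n) Q =
      (∑ σ : Equiv.Perm (Edge k n), if Q (w.trans σ) then (1 : ℝ) else 0) /
        Fintype.card (Equiv.Perm (Edge k n)) := by
  let Ψ : Equiv.Perm (Edge k n) ≃ Ordering k n :=
    { toFun := fun σ => w.trans σ
      invFun := fun u => w.symm.trans u
      left_inv := fun σ => by ext; simp
      right_inv := fun u => by ext; simp }
  rw [uniformProb, Nat.card_eq_fintype_card, Nat.card_eq_fintype_card, ← Fintype.card_congr Ψ]
  congr 1
  rw [Fintype.card_subtype, Finset.card_filter, ← Equiv.sum_comp Ψ]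
  push_cast
  rfl

lemma uniformProb_nonneg {Ω : Type*} (Q : Ω → Prop) : 0 ≤ uniformProb Ω Q := by
  unfold uniformProb; positivity

lemma uniformProb_not (Q : Ordering k n → Prop) :
    uniformProb (Ordering k n) (fun w => ¬ Q w) = 1 - uniformProb (Ordering k n) Q := by
  classical
  obtain ⟨w, -⟩ := exists_ordering (Finset.empty_subset (univ : Subgraph k n))
  have hc : (Fintype.card (Equiv.Perm (Edge k n)) : ℝ) ≠ 0 := by
    exact_mod_cast Fintype.card_ne_zero
  rw [uniformProb_ordering _ w, uniformProb_ordering _ w, eq_sub_iff_add_eq, ← add_div,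
    ← Finset.sum_add_distrib, div_eq_one_iff_eq hc]
  rw [Finset.sum_congr rfl (g := fun _ => (1 : ℝ)) fun σ _ => by
    by_cases h : Q (w.trans σ) <;> simp [h]]
  simp

open Classical in
/-- Coupling of the random process with three independent random subgraphs `A`, `B`, `C`: the
ordering may be assumed to pass through `A ∪ B` and `A ∪ B ∪ C`. -/
lemma uniformProb_le_expect {a b c : ℝ} (ha0 : 0 ≤ a) (ha1 : a ≤ 1) (hb0 : 0 ≤ b) (hb1 : b ≤ 1)
    (hc0 : 0 ≤ c) (hc1 : c ≤ 1) (Q : Ordering k n → Prop)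
    (Bad : Subgraph k n → Subgraph k n → Subgraph k n → Prop)
    (h : ∀ (w : Ordering k n) (A B C : Subgraph k n) (m m' : ℕ), graphAt w m = A ∪ B →
      graphAt w m' = A ∪ B ∪ C → Q w → Bad A B C) :
    uniformProb (Ordering k n) Q ≤ expect a univ fun A => expect b univ fun B =>
      prob c univ fun C => Bad A B C := by
  unfold prob
  rw [expect_eq_average]
  rw [← expect_const (p := a) (s := (univ : Finset (Edge k n))) (uniformProb (Ordering k n) Q)]
  refine expect_mono ha0 ha1 fun A _ => ?_
  rw [← expect_const (p := b) (s := (univ : Finset (Edge k n))) (uniformProb (Ordering k n) Q)]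
  refine expect_mono hb0 hb1 fun B _ => ?_
  rw [← expect_const (p := c) (s := (univ : Finset (Edge k n))) (uniformProb (Ordering k n) Q)]
  refine expect_mono hc0 hc1 fun C _ => ?_
  obtain ⟨w, hw1, hw2⟩ := exists_ordering (F := A ∪ B) (G := A ∪ B ∪ C) Finset.subset_union_left
  rw [uniformProb_ordering Q w]
  gcongr with σ _
  by_cases hQ : Q (w.trans σ)
  · rw [if_pos hQ, if_pos]
    refine h (w.trans σ) _ _ _ #(A ∪ B) #(A ∪ B ∪ C) ?_ ?_ hQ
    · rw [graphAt_trans, hw1, Finset.map_union]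
    · rw [graphAt_trans, hw2, Finset.map_union, Finset.map_union]
  · rw [if_neg hQ]; split_ifs <;> norm_num

/-- The same coupling in the other direction, with a single random subgraph. -/
lemma prob_le_uniformProb {a : ℝ} (ha0 : 0 ≤ a) (ha1 : a ≤ 1) (Q : Ordering k n → Prop)
    (Bad : Subgraph k n → Prop)
    (h : ∀ (w : Ordering k n) (m : ℕ), Bad (graphAt w m) → Q w) :
    prob a univ Bad ≤ uniformProb (Ordering k n) Q := by
  classical
  have h1 := expect_eq_average (ι := Edge k n) a 0 0 fun A _ _ => if Bad A then 1 else 0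
  simp only [expect_const] at h1
  unfold prob
  rw [h1]
  rw [← expect_const (p := a) (s := (univ : Finset (Edge k n))) (uniformProb (Ordering k n) Q)]
  refine expect_mono ha0 ha1 fun A _ => ?_
  obtain ⟨w, hw1, -⟩ := exists_ordering (Finset.Subset.refl A)
  rw [uniformProb_ordering Q w]
  gcongr with σ _
  by_cases hB : Bad (A.map σ.toEmbedding)
  · rw [if_pos hB, if_pos]
    refine h (w.trans σ) #A ?_
    rwa [graphAt_trans, hw1]
  · rw [if_neg hB]; split_ifs <;> norm_num

lemma binomialProb_eq_prob (p : ℝ) (P : Subgraph k n → Prop) :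
    binomialProb k n p P = prob p univ P := by
  classical
  rw [binomialProb, prob, expect, Finset.powerset_univ, Finset.sum_filter]
  refine Finset.sum_congr rfl fun G _ => ?_
  rw [card_univ]
  split_ifs <;> simp

end Coupling

/-! ### Degrees in a random subgraph -/

section Stars

variable {k n d : ℕ}

/-- The hyperedges of `K_n^k` at the vertex `(i, v)`. -/
def star (i : Fin k) (v : Fin n) : Subgraph k n :=
  Finset.univ.filter fun e => e i = v

@[simp] lemma mem_star {i : Fin k} {v : Fin n} {e : Edge k n} : e ∈ star i v ↔ e i = v := by
  simp [star]

lemma degree_eq_card_inter (G : Subgraph k n) (i : Fin k) (v : Fin n) :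
    degree G i v = #(G ∩ star i v) := by
  rw [degree]
  congr 1
  ext e
  simp

lemma card_star (i : Fin k) (v : Fin n) : #(star i v) = n ^ (k - 1) := by
  have h : star i v = Fintype.piFinset fun i' => if i' = i then {v} else univ := by
    ext e
    simp only [mem_star, Fintype.mem_piFinset]
    constructor
    · rintro rfl i'
      split_ifs with h
      · simp [h]
      · simp
    · intro h
      simpa using h i
  rw [h, Fintype.card_piFinset, ← Finset.mul_prod_erase univ _ (mem_univ i),
    Finset.prod_congr rfl (g := fun _ => n) fun i' hi' => by simp [Finset.ne_of_mem_erase hi']]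
  simp

lemma card_star_inter {i i' : Fin k} (hi : i ≠ i') (v w : Fin n) :
    #(star i v ∩ star i' w) = n ^ (k - 2) := by
  have h : star i v ∩ star i' w =
      Fintype.piFinset fun l => if l = i then {v} else if l = i' then {w} else univ := by
    ext e
    simp only [Finset.mem_inter, mem_star, Fintype.mem_piFinset]
    constructor
    · rintro ⟨rfl, rfl⟩ l
      split_ifs with h h
      · simp [h]
      · simp [h]
      · simp
    · intro h
      exact ⟨by simpa using h i, by simpa [hi.symm] using h i'⟩
  rw [h, Fintype.card_piFinset, ← Finset.mul_prod_erase univ _ (mem_univ i),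
    ← Finset.mul_prod_erase (univ.erase i) _ (Finset.mem_erase.2 ⟨hi.symm, mem_univ i'⟩),
    Finset.prod_congr rfl (g := fun _ => n) fun l hl => by
      obtain ⟨h1, h2⟩ := Finset.mem_erase.1 hl
      simp [h1, Finset.ne_of_mem_erase h2]]
  simp [hi.symm, Finset.card_erase_of_mem, Nat.sub_sub]

lemma MinDegreeGE.mono {G H : Subgraph k n} (hGH : G ⊆ H) (h : MinDegreeGE d G) :
    MinDegreeGE d H := fun i v =>
  (h i v).trans (Finset.card_le_card (Finset.filter_subset_filter _ hGH))

/-- The degrees in one class are independent, so that all of them are at least `d` only with small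
probability. -/
lemma prob_minDegreeGE_le (hk : 1 ≤ k) (hd : 1 ≤ d) {p : ℝ} (h0 : 0 ≤ p) (h1 : p ≤ 1) :
    prob p (univ : Subgraph k n) (MinDegreeGE d) ≤
      Real.exp (-(n * ((n ^ (k - 1)).choose (d - 1) * p ^ (d - 1) *
        (1 - p) ^ (n ^ (k - 1) - (d - 1))))) := by
  classical
  let i₀ : Fin k := ⟨0, hk⟩
  set π : ℝ := (n ^ (k - 1)).choose (d - 1) * p ^ (d - 1) * (1 - p) ^ (n ^ (k - 1) - (d - 1))
  have hU : (univ : Subgraph k n) = (univ : Finset (Fin n)).biUnion (star i₀) := by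
    ext e; simp
  have hdisj : ∀ a b : Fin n, a ≠ b → Disjoint (star i₀ a) (star i₀ b) := by
    intro a b hab
    rw [Finset.disjoint_left]
    intro e h1 h2
    exact hab ((mem_star.1 h1).symm.trans (mem_star.1 h2))
  let f : Fin n → Finset (Edge k n) → ℝ := fun _ A => if d - 1 < #A then 1 else 0
  have hf : ∀ a A, 0 ≤ f a A := fun a A => by simp only [f]; split_ifs <;> norm_num
  calc prob p (univ : Subgraph k n) (MinDegreeGE d)
      ≤ expect p univ (fun A => ∏ a ∈ (univ : Finset (Fin n)), f a (A ∩ star i₀ a)) := by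
        refine prob_le_expect h0 h1 (fun A => Finset.prod_nonneg fun a _ => hf a _) fun A hA => ?_
        rw [Finset.prod_eq_one]
        intro a _
        have := hA i₀ a
        rw [degree_eq_card_inter] at this
        exact if_pos (by omega)
    _ = ∏ a ∈ (univ : Finset (Fin n)), expect p (star i₀ a) (f a) := by
        rw [hU, expect_biUnion_prod _ _ hdisj]
    _ ≤ ∏ a ∈ (univ : Finset (Fin n)), Real.exp (-π) := by
        refine Finset.prod_le_prod (fun a _ => expect_nonneg h0 h1 (hf a)) fun a _ => ?_
        have h2 := prob_lt_card_le (s := star i₀ a) h0 h1 (d - 1)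
        rw [card_star] at h2
        have h3 : expect p (star i₀ a) (f a) = prob p (star i₀ a) (fun A => d - 1 < #A) := by
          unfold prob
          exact expect_congr fun A _ => by simp only [f]; congr
        rw [h3]
        have := Real.add_one_le_exp (-π)
        linarith
    _ = _ := by
        rw [Finset.prod_const, card_univ, Fintype.card_fin, ← Real.exp_nat_mul]
        congr 1
        ring

/-- Chernoff bound for the existence of a vertex of degree less than `d`. -/
lemma prob_not_minDegreeGE_le (hd : 1 ≤ d) {p y : ℝ} (h0 : 0 ≤ p) (h1 : p ≤ 1) (hy : 1 ≤ y)
    (hyp : y ≤ p * (n : ℝ) ^ (k - 1)) :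
    prob p (univ : Subgraph k n) (fun G => ¬ MinDegreeGE d G) ≤
      k * n * (y ^ (d - 1) * Real.exp (1 - y)) := by
  have hy0 : 0 < y := by linarith
  let f : Finset (Edge k n) → ℝ := fun A =>
    ∑ x : Fin k × Fin n, y ^ (d - 1) * (y⁻¹) ^ #(A ∩ star x.1 x.2)
  have hnn : ∀ A (x : Fin k × Fin n), 0 ≤ y ^ (d - 1) * (y⁻¹) ^ #(A ∩ star x.1 x.2) :=
    fun A x => by positivity
  calc _ ≤ expect p univ f := by
        refine prob_le_expect h0 h1 (fun A => Finset.sum_nonneg fun x _ => hnn A x) fun A hA => ?_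
        rw [MinDegreeGE] at hA
        push Not at hA
        obtain ⟨i, v, h⟩ := hA
        rw [degree_eq_card_inter] at h
        refine le_trans ?_ (Finset.single_le_sum (fun x _ => hnn A x) (mem_univ (i, v)))
        rw [inv_pow, ← div_eq_mul_inv, one_le_div (by positivity)]
        exact pow_le_pow_right₀ hy (by simp only; omega)
    _ = ∑ x : Fin k × Fin n, y ^ (d - 1) * expect p univ fun A => (y⁻¹) ^ #(A ∩ star x.1 x.2) := by
        simp only [f, expect_sum, expect_const_mul]
    _ ≤ ∑ x : Fin k × Fin n, y ^ (d - 1) * Real.exp (1 - y) := by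
        gcongr with x _
        refine (expect_pow_card_inter_le h0 h1 (inv_nonneg.2 hy0.le) _).trans ?_
        rw [Real.exp_le_exp, card_star]
        push_cast
        have h2 : y⁻¹ ≤ 1 := inv_le_one_of_one_le₀ hy
        have h3 : (1 - y⁻¹) * y ≤ (1 - y⁻¹) * (p * (n : ℝ) ^ (k - 1)) :=
          mul_le_mul_of_nonneg_left hyp (by linarith)
        have h4 : (1 - y⁻¹) * y = y - 1 := by field_simp
        nlinarith
    _ = _ := by
        rw [Finset.sum_const, card_univ, Fintype.card_prod, Fintype.card_fin, Fintype.card_fin,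
          nsmul_eq_mul]
        push_cast
        ring

end Stars

/-! ### The closure of a random subgraph -/

section Closure

variable {𝔽 : Type*} [RCLike 𝔽] {k n d : ℕ}

open Classical in
/-- The edges of `A` that are not spanned by the others have independent equations. -/
lemma card_coloops_le (p : Config 𝔽 k n d) (A : Subgraph k n) :
    #{e ∈ A | e ∉ spannedEdges p (A.erase e)} ≤ d * k * n := by
  set I := {e ∈ A | e ∉ spannedEdges p (A.erase e)} with hI
  have h : ∀ e : I, ∃ x : Config 𝔽 k n d, (∀ f ∈ A, f ≠ e.1 → segreDiff p f x = 0) ∧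
      segreDiff p e.1 x ≠ 0 := by
    rintro ⟨e, he⟩
    have h1 := (Finset.mem_filter.1 he).2
    rw [mem_spannedEdges] at h1
    push Not at h1
    obtain ⟨x, hx, hx'⟩ := h1
    exact ⟨x, fun f hf hfe => hx f (Finset.mem_erase.2 ⟨hfe, hf⟩), hx'⟩
  choose x hx hx' using h
  have hli : LinearIndependent 𝔽 x := by
    rw [Fintype.linearIndependent_iff]
    intro g hg e
    have h1 := congrArg (segreDiff p e.1) hg
    rw [map_sum, map_zero, Finset.sum_eq_single e] at h1
    · rw [map_smul, smul_eq_mul] at h1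
      exact (mul_eq_zero.1 h1).resolve_right (hx' e)
    · intro f _ hfe
      rw [map_smul, hx f e.1 (Finset.mem_filter.1 e.2).1 fun h => hfe (Subtype.ext h.symm),
        smul_zero]
    · simp
  have h2 := hli.fintype_card_le_finrank
  simp only [Fintype.card_coe, Module.finrank_pi_fintype, Module.finrank_self, Finset.sum_const,
    card_univ, Fintype.card_fin, smul_eq_mul, mul_one] at h2
  calc #I ≤ k * (n * d) := h2
    _ = d * k * n := by ring

/-- The closure of a random subgraph misses few edges: a random edge outside of the closure would
be a coloop after its insertion, and there are never more coloops than the rank. -/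
lemma expect_card_compl_spannedEdges_le (p : Config 𝔽 k n d) {a : ℝ} (h0 : 0 < a) (h1 : a ≤ 1) :
    expect a univ (fun A : Subgraph k n => (#(spannedEdges p A)ᶜ : ℝ)) ≤ d * k * n / a := by
  classical
  rw [le_div_iff₀ h0, mul_comm]
  have h2 : ∀ A : Subgraph k n, (#(spannedEdges p A)ᶜ : ℝ) =
      ∑ e : Edge k n, if e ∉ spannedEdges p A then (1 : ℝ) else 0 := by
    intro A
    rw [Finset.sum_boole]
    congr 2
    ext e
    simp
  simp only [h2, expect_sum]
  rw [Finset.mul_sum]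
  calc ∑ e : Edge k n, a * expect a univ (fun A => if e ∉ spannedEdges p A then (1 : ℝ) else 0)
      ≤ ∑ e : Edge k n, a * expect a univ
          (fun A => if e ∉ spannedEdges p (A.erase e) then (1 : ℝ) else 0) := by
        gcongr with e _
        refine expect_mono h0.le h1 fun A _ => ?_
        by_cases h : e ∈ spannedEdges p A
        · rw [if_neg (not_not.2 h)]; split_ifs <;> norm_num
        · rw [if_pos h, if_pos fun h' => h (spannedEdges_mono p (Finset.erase_subset e A) h')]
    _ = ∑ e : Edge k n, expect a univ
          (fun A =>
            if e ∈ A then (if e ∉ spannedEdges p (A.erase e) then (1 : ℝ) else 0) else 0) := by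
        refine Finset.sum_congr rfl fun e _ => ?_
        exact (expect_ite_mem_erase (mem_univ e)
          fun A => if e ∉ spannedEdges p A then (1 : ℝ) else 0).symm
    _ = expect a univ (fun A => (#{e ∈ A | e ∉ spannedEdges p (A.erase e)} : ℝ)) := by
        rw [← expect_sum]
        refine expect_congr fun A _ => ?_
        rw [Finset.card_filter]
        push_cast
        rw [← Finset.sum_filter, Finset.filter_mem_eq_inter, Finset.univ_inter]
    _ ≤ expect a univ (fun _ => (d * k * n : ℝ)) :=
        expect_mono h0.le h1 fun A _ => by exact_mod_cast card_coloops_le p A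
    _ = d * k * n := expect_const _

/-- Markov's inequality for the number of edges outside of the closure. -/
lemma prob_card_compl_spannedEdges_gt (p : Config 𝔽 k n d) {a r : ℝ} (h0 : 0 < a) (h1 : a ≤ 1)
    (hr : 0 < r) :
    prob a univ (fun A : Subgraph k n => r < #(spannedEdges p A)ᶜ) ≤ d * k * n / a / r := by
  refine (prob_le_expect (f := fun A => r⁻¹ * (#(spannedEdges p A)ᶜ : ℝ)) h0.le h1
    (fun A => by positivity) fun A hA => ?_).trans ?_
  · rw [← div_eq_inv_mul, one_le_div hr]
    exact hA.le
  · rw [expect_const_mul, ← div_eq_inv_mul]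
    have := expect_card_compl_spannedEdges_le p h0 h1
    gcongr

end Closure

/-! ### Exceptional vertices -/

section Exceptional

variable {k n : ℕ}

open Classical in
/-- If few vertices violate `W`, then it is unlikely that some vertex has `t` random edges through
another vertex that violates `W`. -/
lemma prob_exists_card_bad_gt_le {b s t η : ℝ} (h0 : 0 ≤ b) (h1 : b ≤ 1) (hs : 0 ≤ s)
    (W : Fin k → Fin n → Prop) (hW : ∀ i, (#{v | ¬ W i v} : ℝ) ≤ η) :
    prob b univ (fun B : Subgraph k n => ∃ i v,
        t < #{e ∈ B | e i = v ∧ ∃ i', i' ≠ i ∧ ¬ W i' (e i')}) ≤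
      k * n * (Real.exp (-(s * t)) *
        Real.exp (Real.exp s * b * (k * η * (n : ℝ) ^ (k - 2)))) := by
  have hη : ∀ i : Fin k, 0 ≤ η := fun i => le_trans (Nat.cast_nonneg _) (hW i)
  let D : Fin k × Fin n → Subgraph k n := fun x =>
    Finset.univ.filter fun e => e x.1 = x.2 ∧ ∃ i', i' ≠ x.1 ∧ ¬ W i' (e i')
  have hD : ∀ x, (#(D x) : ℝ) ≤ k * η * (n : ℝ) ^ (k - 2) := by
    intro x
    have hsub : D x ⊆ (univ.erase x.1).biUnion fun i' =>
        ({v | ¬ W i' v} : Finset (Fin n)).biUnion fun w => star x.1 x.2 ∩ star i' w := by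
      intro e he
      obtain ⟨-, h2, i', h3, h4⟩ := Finset.mem_filter.1 he
      simp only [Finset.mem_biUnion, Finset.mem_inter, mem_star]
      exact ⟨i', by simp [h3], e i', by simp [h4], h2, rfl⟩
    have h3 : (#(D x) : ℝ) ≤ ∑ i' ∈ univ.erase x.1, ∑ w ∈ ({v | ¬ W i' v} : Finset (Fin n)),
        (#(star x.1 x.2 ∩ star i' w) : ℝ) := by
      refine (Nat.cast_le.2 ((Finset.card_le_card hsub).trans (Finset.card_biUnion_le.trans
        (Finset.sum_le_sum fun i' _ => Finset.card_biUnion_le)))).trans ?_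
      push_cast
      exact le_rfl
    have h4 : ∀ i' ∈ univ.erase x.1, ∑ w ∈ ({v | ¬ W i' v} : Finset (Fin n)),
        (#(star x.1 x.2 ∩ star i' w) : ℝ) ≤ η * (n : ℝ) ^ (k - 2) := by
      intro i' hi'
      rw [Finset.sum_congr rfl (g := fun _ => (n : ℝ) ^ (k - 2)) fun w _ => by
        rw [card_star_inter (Finset.ne_of_mem_erase hi').symm]; push_cast; rfl]
      rw [Finset.sum_const, nsmul_eq_mul]
      have := hW i'
      gcongr
    refine (h3.trans (Finset.sum_le_sum h4)).trans ?_
    rw [Finset.sum_const, nsmul_eq_mul, mul_assoc]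
    have h5 : (#(univ.erase x.1) : ℝ) ≤ k := by
      exact_mod_cast (Finset.card_le_univ _).trans_eq (Fintype.card_fin k)
    have := hη x.1
    gcongr
  let f : Finset (Edge k n) → ℝ := fun A =>
    ∑ x : Fin k × Fin n, Real.exp (-(s * t)) * (Real.exp s) ^ #(A ∩ D x)
  have hnn : ∀ A (x : Fin k × Fin n), 0 ≤ Real.exp (-(s * t)) * (Real.exp s) ^ #(A ∩ D x) :=
    fun A x => by positivity
  calc _ ≤ expect b univ f := by
        refine prob_le_expect h0 h1 (fun A => Finset.sum_nonneg fun x _ => hnn A x) fun A hA => ?_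
        obtain ⟨i, v, h⟩ := hA
        refine le_trans ?_ (Finset.single_le_sum (fun x _ => hnn A x) (mem_univ (i, v)))
        have h2 : {e ∈ A | e i = v ∧ ∃ i', i' ≠ i ∧ ¬ W i' (e i')} = A ∩ D (i, v) := by
          ext e; simp [D]
        rw [h2] at h
        rw [← Real.exp_nat_mul, ← Real.exp_add]
        refine Real.one_le_exp ?_
        nlinarith
    _ = ∑ x : Fin k × Fin n, Real.exp (-(s * t)) *
          expect b univ fun A => (Real.exp s) ^ #(A ∩ D x) := by
        simp only [f, expect_sum, expect_const_mul]
    _ ≤ ∑ x : Fin k × Fin n, Real.exp (-(s * t)) *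
          Real.exp (Real.exp s * b * (k * η * (n : ℝ) ^ (k - 2))) := by
        gcongr with x _
        refine (expect_pow_card_inter_le h0 h1 (Real.exp_pos s).le _).trans ?_
        rw [Real.exp_le_exp]
        have h2 := hD x
        have h3 := hη x.1
        have h4 := Real.add_one_le_exp s
        have h5 : (0 : ℝ) ≤ #(D x) := Nat.cast_nonneg _
        calc (Real.exp s - 1) * b * #(D x) ≤ Real.exp s * b * #(D x) := by
              gcongr; linarith
          _ ≤ _ := by gcongr
    _ = _ := by
        rw [Finset.sum_const, card_univ, Fintype.card_prod, Fintype.card_fin, Fintype.card_fin,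
          nsmul_eq_mul]
        push_cast
        ring

/-- Two vertices of small degree in `B` are unlikely to share an edge of `A ∪ B ∪ C`. -/
lemma prob_exists_low_pair_le {a b c s t : ℝ} (ha0 : 0 ≤ a) (ha1 : a ≤ 1) (hb0 : 0 ≤ b)
    (hb1 : b ≤ 1) (hc0 : 0 ≤ c) (hc1 : c ≤ 1) (hs : 0 ≤ s) :
    (expect a univ fun A : Subgraph k n => expect b univ fun B => prob c univ fun C =>
      ∃ e ∈ A ∪ B ∪ C, ∃ i i', i ≠ i' ∧ (degree B i (e i) : ℝ) < t ∧ (degree B i' (e i') : ℝ) < t) ≤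
      Fintype.card (Edge k n) * k ^ 2 * ((a + b + c) * (Real.exp (2 * s * t) *
        Real.exp ((Real.exp (-s) - 1) * b * (2 * ((n : ℝ) ^ (k - 1) - (n : ℝ) ^ (k - 2)))))) := by
  classical
  -- the edges at exactly one of the two vertices
  let D : Edge k n → Fin k → Fin k → Subgraph k n := fun e i i' =>
    (star i (e i) \ star i' (e i')) ∪ (star i' (e i') \ star i (e i))
  let Y : Edge k n → Fin k → Fin k → Finset (Edge k n) → ℝ := fun e i i' B =>
    Real.exp (2 * s * t) * (Real.exp (-s)) ^ #(B ∩ D e i i')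
  let R : ℝ := Real.exp (2 * s * t) *
    Real.exp ((Real.exp (-s) - 1) * b * (2 * ((n : ℝ) ^ (k - 1) - (n : ℝ) ^ (k - 2))))
  have hY0 : ∀ e i i' B, 0 ≤ Y e i i' B := fun e i i' B => by positivity
  have hcardD : ∀ e i i', i ≠ i' →
      (#(D e i i') : ℝ) = 2 * ((n : ℝ) ^ (k - 1) - (n : ℝ) ^ (k - 2)) := by
    intro e i i' hi
    have h1 := Finset.card_sdiff_add_card_inter (star i (e i)) (star i' (e i'))
    have h2 := Finset.card_sdiff_add_card_inter (star i' (e i')) (star i (e i))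
    rw [card_star, card_star_inter hi] at h1
    rw [card_star, card_star_inter hi.symm] at h2
    rw [Finset.card_union_of_disjoint (disjoint_sdiff_sdiff)]
    have h1' : (#(star i (e i) \ star i' (e i')) : ℝ) + (n : ℝ) ^ (k - 2) = (n : ℝ) ^ (k - 1) := by
      exact_mod_cast h1
    have h2' : (#(star i' (e i') \ star i (e i)) : ℝ) + (n : ℝ) ^ (k - 2) = (n : ℝ) ^ (k - 1) := by
      exact_mod_cast h2
    push_cast
    linarith
  have hYE : ∀ e i i', i ≠ i' → expect b univ (Y e i i') ≤ R := by
    intro e i i' hi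
    simp only [Y]
    rw [expect_const_mul]
    have := expect_pow_card_inter_le hb0 hb1 (Real.exp_pos (-s)).le (D e i i')
    rw [hcardD e i i' hi] at this
    exact mul_le_mul_of_nonneg_left this (Real.exp_pos _).le
  have hmem : ∀ (r : ℝ) (e : Edge k n),
      expect r univ (fun A => if e ∈ A then (1 : ℝ) else 0) = r := by
    intro r e
    have := expect_ite_mem_erase (p := r) (mem_univ e) fun _ => (1 : ℝ)
    rwa [expect_const, mul_one] at this
  have hYmem : ∀ e i i', expect b univ (fun B => if e ∈ B then Y e i i' B else 0) =
      b * expect b univ (Y e i i') := by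
    intro e i i'
    have hYer : ∀ B, Y e i i' (B.erase e) = Y e i i' B := by
      intro B
      have : (B.erase e) ∩ D e i i' = B ∩ D e i i' := by
        rw [Finset.erase_inter, Finset.erase_eq_of_notMem]
        simp [D]
      simp only [Y, this]
    have := expect_ite_mem_erase (p := b) (mem_univ e) (Y e i i')
    simpa only [hYer] using this
  -- the contribution of one edge and two of its vertices
  have hone : ∀ e i i', i ≠ i' →
      (expect a univ fun A : Subgraph k n => expect b univ fun B => expect c univ fun C =>
        ((if e ∈ A then (1 : ℝ) else 0) * Y e i i' B + (if e ∈ B then Y e i i' B else 0) +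
          (if e ∈ C then (1 : ℝ) else 0) * Y e i i' B)) ≤ (a + b + c) * R := by
    intro e i i' hi
    have h1 : ∀ A B : Subgraph k n, (expect c univ fun C : Subgraph k n =>
        ((if e ∈ A then (1 : ℝ) else 0) * Y e i i' B + (if e ∈ B then Y e i i' B else 0) +
          (if e ∈ C then (1 : ℝ) else 0) * Y e i i' B)) =
        ((if e ∈ A then (1 : ℝ) else 0) * Y e i i' B + (if e ∈ B then Y e i i' B else 0)) +
          c * Y e i i' B := by
      intro A B
      rw [expect_add, expect_const]
      congr 1
      simp only [mul_comm _ (Y e i i' B)]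
      rw [expect_const_mul, hmem]
    simp only [h1]
    simp only [expect_add, expect_const_mul, hYmem]
    rw [expect_const]
    simp only [mul_comm _ (expect b univ (Y e i i'))]
    rw [expect_const_mul, hmem]
    have h2 := hYE e i i' hi
    have h3 : b * expect b univ (Y e i i') ≤ b * R := mul_le_mul_of_nonneg_left h2 hb0
    have h4 := mul_le_mul_of_nonneg_left h2 ha0
    have h5 := mul_le_mul_of_nonneg_left h2 hc0
    linarith
  let T : Finset (Edge k n × Fin k × Fin k) := univ.filter fun x => x.2.1 ≠ x.2.2
  let g : Edge k n × Fin k × Fin k → Subgraph k n → Subgraph k n → Subgraph k n → ℝ :=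
    fun x A B C => (if x.1 ∈ A then (1 : ℝ) else 0) * Y x.1 x.2.1 x.2.2 B +
      (if x.1 ∈ B then Y x.1 x.2.1 x.2.2 B else 0) +
          (if x.1 ∈ C then (1 : ℝ) else 0) * Y x.1 x.2.1 x.2.2 B
  have hg0 : ∀ x A B C, 0 ≤ g x A B C := by
    intro x A B C
    have := hY0 x.1 x.2.1 x.2.2 B
    simp only [g]
    split_ifs <;> linarith
  calc _ ≤ expect a univ fun A : Subgraph k n => expect b univ fun B => expect c univ fun C =>
        ∑ x ∈ T, g x A B C := by
        refine expect_mono ha0 ha1 fun A _ => expect_mono hb0 hb1 fun B _ => ?_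
        refine prob_le_expect hc0 hc1 (fun C => Finset.sum_nonneg fun x _ => hg0 x A B C) ?_
        rintro C ⟨e, he, i, i', hi, h1, h2⟩
        refine le_trans ?_ (Finset.single_le_sum (fun x _ => hg0 x A B C)
          (show (e, i, i') ∈ T by simp [T, hi]))
        have hY1 : 1 ≤ Y e i i' B := by
          simp only [Y]
          rw [← Real.exp_nat_mul, ← Real.exp_add]
          refine Real.one_le_exp ?_
          have h3 : #(B ∩ D e i i') ≤ degree B i (e i) + degree B i' (e i') := by
            rw [degree_eq_card_inter, degree_eq_card_inter]
            refine le_trans (Finset.card_le_card ?_) (Finset.card_union_le _ _)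
            rw [← Finset.inter_union_distrib_left]
            exact Finset.inter_subset_inter_left
              (Finset.union_subset_union Finset.sdiff_subset Finset.sdiff_subset)
          have h4 : (#(B ∩ D e i i') : ℝ) ≤ degree B i (e i) + degree B i' (e i') := by
            exact_mod_cast h3
          nlinarith
        simp only [g]
        simp only [Finset.mem_union] at he
        split_ifs <;> first | linarith | (exfalso; tauto)
    _ = ∑ x ∈ T, expect a univ fun A : Subgraph k n => expect b univ fun B => expect c univ fun C =>
        g x A B C := by
        simp only [expect_sum]
    _ ≤ ∑ x ∈ T, (a + b + c) * R := by
        refine Finset.sum_le_sum fun x hx => hone x.1 x.2.1 x.2.2 (Finset.mem_filter.1 hx).2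
    _ ≤ _ := by
        rw [Finset.sum_const, nsmul_eq_mul]
        have hT : (#T : ℝ) ≤ Fintype.card (Edge k n) * k ^ 2 := by
          have : #T ≤ Fintype.card (Edge k n × Fin k × Fin k) := Finset.card_le_univ T
          rw [Fintype.card_prod, Fintype.card_prod, Fintype.card_fin, ← sq] at this
          exact_mod_cast this
        gcongr

end Exceptional

/-! ### Three independent random subgraphs -/

section ThreeSubgraphs

variable {k n : ℕ}

/-- Probability of an event of three independent random subgraphs. -/
noncomputable def prob₃ (a b c : ℝ) (P : Subgraph k n → Subgraph k n → Subgraph k n → Prop) : ℝ :=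
  expect a univ fun A => expect b univ fun B => prob c univ fun C => P A B C

variable {a b c : ℝ}

lemma prob₃_or_le (ha0 : 0 ≤ a) (ha1 : a ≤ 1) (hb0 : 0 ≤ b) (hb1 : b ≤ 1) (hc0 : 0 ≤ c)
    (hc1 : c ≤ 1) (P Q : Subgraph k n → Subgraph k n → Subgraph k n → Prop) :
    prob₃ a b c (fun A B C => P A B C ∨ Q A B C) ≤ prob₃ a b c P + prob₃ a b c Q := by
  unfold prob₃
  rw [← expect_add]
  refine expect_mono ha0 ha1 fun A _ => ?_
  rw [← expect_add]
  exact expect_mono hb0 hb1 fun B _ => prob_or_le hc0 hc1 _ _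

lemma prob_const_event {p : ℝ} {s : Finset (Edge k n)} (P : Prop) [Decidable P] :
    prob p s (fun _ => P) = if P then 1 else 0 := by
  unfold prob
  rw [expect_const]
  congr

lemma prob₃_union (P : Subgraph k n → Prop) :
    prob₃ a b c (fun A B _ => P (A ∪ B)) = prob (a + b - a * b) univ P := by
  classical
  unfold prob₃
  simp only [prob_const_event]
  rw [expect_union fun G : Finset (Edge k n) => if P G then (1 : ℝ) else 0]
  unfold prob
  exact expect_congr fun A _ => by congr

lemma prob₃_fst (P : Subgraph k n → Prop) :
    prob₃ a b c (fun A _ _ => P A) = prob a univ P := by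
  classical
  unfold prob₃
  simp only [prob_const_event, expect_const]
  unfold prob
  exact expect_congr fun A _ => by congr

lemma prob₃_snd (P : Subgraph k n → Subgraph k n → Prop) :
    prob₃ a b c (fun A B _ => P A B) = expect a univ fun A => prob b univ (P A) := by
  classical
  unfold prob₃
  simp only [prob_const_event]
  refine expect_congr fun A _ => ?_
  unfold prob
  exact expect_congr fun A _ => by congr

lemma prob₃_thd (P : Subgraph k n → Prop) :
    prob₃ a b c (fun _ _ C => P C) = prob c univ P := by
  unfold prob₃
  rw [expect_const, expect_const]

end ThreeSubgraphs

/-! ### The hitting time -/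

section HittingTime

variable {𝔽 : Type*} [RCLike 𝔽] {k n d : ℕ}

lemma minDegreeGE_graphAt_hittingTime {w : Ordering k n} {m : ℕ}
    (h : MinDegreeGE d (graphAt w m)) : MinDegreeGE d (graphAt w (hittingTime d w)) :=
  Nat.sInf_mem (s := {m | MinDegreeGE d (graphAt w m)}) ⟨m, h⟩

lemma hittingTime_le {w : Ordering k n} {m : ℕ} (h : MinDegreeGE d (graphAt w m)) :
    hittingTime d w ≤ m :=
  Nat.sInf_le h

open Classical in
/-- The failure probability at the hitting time, in terms of three independent random subgraphs:
`A` spans nearly everything, `B` attaches all but a few exceptional vertices, `A ∪ B` comes before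
and `A ∪ B ∪ C` after the hitting time. -/
lemma uniformProb_not_infinitesimallyRigid_le (hk : 3 ≤ k) (hd : 1 ≤ d) {p : Config 𝔽 k n d}
    (hp : Generic p) {a b c ε δ s t : ℝ} (ha0 : 0 < a) (ha1 : a ≤ 1) (hb0 : 0 ≤ b) (hb1 : b ≤ 1)
    (hc0 : 0 ≤ c) (hc1 : c ≤ 1) (hε : 0 < ε) (hδ0 : 0 < δ) (hδ : δ * (4 * k * d ^ 2) ≤ min ε 1)
    (hn : 2 * k * d ^ 2 < n) (hs : 0 ≤ s) :
    uniformProb (Ordering k n)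
        (fun w => ¬ InfinitesimallyRigid (graphAt w (hittingTime d w)) p) ≤
      prob (a + b - a * b) (univ : Subgraph k n) (MinDegreeGE d) +
      prob c (univ : Subgraph k n) (fun G => ¬ MinDegreeGE d G) +
      d * k * n / a / (δ * Fintype.card (Edge k n)) +
      k * n * (Real.exp (-(s * (t - d))) *
        Real.exp (Real.exp s * b * (k * (ε * n) * (n : ℝ) ^ (k - 2)))) +
      Fintype.card (Edge k n) * k ^ 2 * ((a + b + c) * (Real.exp (2 * 2 * t) *
        Real.exp ((Real.exp (-2) - 1) * b * (2 * ((n : ℝ) ^ (k - 1) - (n : ℝ) ^ (k - 2)))))) := by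
  have hn0 : 0 < n := by omega
  have : Nonempty (Fin n) := ⟨⟨0, hn0⟩⟩
  have hN0 : (0 : ℝ) < Fintype.card (Edge k n) := by exact_mod_cast Fintype.card_pos
  let Base : Subgraph k n → (Fin k → Fin d → Fin n) → Prop := fun A v =>
    (∀ i, Function.Injective (v i)) ∧ (∀ i j, Attached (spannedEdges p A) v i (v i j)) ∧
      ∀ i, (#{u | ¬ Attached (spannedEdges p A) v i u} : ℝ) ≤ ε * n
  let Far : Subgraph k n → Subgraph k n → Prop := fun A B =>
    ∃ h : (∃ v, Base A v), ∃ i u, t - d < #{e ∈ B | e i = u ∧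
      ∃ i', i' ≠ i ∧ ¬ Attached (spannedEdges p A) h.choose i' (e i')}
  let Low : Subgraph k n → Subgraph k n → Subgraph k n → Prop := fun A B C =>
    ∃ e ∈ A ∪ B ∪ C, ∃ i i', i ≠ i' ∧ (degree B i (e i) : ℝ) < t ∧ (degree B i' (e i') : ℝ) < t
  have h1 : uniformProb (Ordering k n)
      (fun w => ¬ InfinitesimallyRigid (graphAt w (hittingTime d w)) p) ≤
      prob₃ a b c (fun A B C => (((MinDegreeGE d (A ∪ B) ∨ ¬ MinDegreeGE d C) ∨
        ¬ ∃ v, Base A v) ∨ Far A B) ∨ Low A B C) := by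
    refine uniformProb_le_expect ha0.le ha1 hb0 hb1 hc0 hc1 _ _ ?_
    intro w A B C m m' hm hm' hQ
    by_contra hgood
    apply hQ
    push Not at hgood
    obtain ⟨⟨⟨⟨g1, g2⟩, g3⟩, g4⟩, g5⟩ := hgood
    have hABC : MinDegreeGE d (graphAt w m') := by
      rw [hm']
      exact g2.mono Finset.subset_union_right
    have hdeg := minDegreeGE_graphAt_hittingTime hABC
    have hupper : graphAt w (hittingTime d w) ⊆ A ∪ B ∪ C := by
      rw [← hm']
      exact graphAt_mono w (hittingTime_le hABC)
    have hlower : A ∪ B ⊆ graphAt w (hittingTime d w) := by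
      rw [← hm]
      refine graphAt_mono w (not_lt.1 fun hlt => g1 ?_)
      rw [← hm]
      exact hdeg.mono (graphAt_mono w hlt.le)
    have hbase := g3.choose_spec
    refine infinitesimallyRigid_of_attached hk hp (Finset.union_subset_left hlower) (c := g3.choose)
      hbase.1 hbase.2.1 (high := fun i u => t ≤ degree B i u) ?_ ?_ hdeg
    · intro i u hu
      refine ⟨{e ∈ B | e i = u ∧ ∀ i', i' ≠ i → Attached (spannedEdges p A) g3.choose i' (e i')},
        ?_, ?_, fun e he => (Finset.mem_filter.1 he).2⟩
      · exact (Finset.filter_subset _ _).trans (Finset.union_subset_right hlower)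
      · have hfar : (#{e ∈ B | e i = u ∧
            ∃ i', i' ≠ i ∧ ¬ Attached (spannedEdges p A) g3.choose i' (e i')} : ℝ) ≤ t - d := by
          by_contra hlt
          exact g4 ⟨g3, i, u, not_le.1 hlt⟩
        have hsplit : degree B i u ≤
            #{e ∈ B | e i = u ∧ ∀ i', i' ≠ i → Attached (spannedEdges p A) g3.choose i' (e i')} +
            #{e ∈ B | e i = u ∧
              ∃ i', i' ≠ i ∧ ¬ Attached (spannedEdges p A) g3.choose i' (e i')} := by
          rw [degree]
          refine le_trans (Finset.card_le_card fun e he => ?_) (Finset.card_union_le _ _)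
          rw [Finset.mem_filter] at he
          rw [Finset.mem_union, Finset.mem_filter, Finset.mem_filter]
          by_cases hall : ∀ i', i' ≠ i → Attached (spannedEdges p A) g3.choose i' (e i')
          · exact Or.inl ⟨he.1, he.2, hall⟩
          · push Not at hall
            exact Or.inr ⟨he.1, he.2, hall⟩
        have hsplit' : (degree B i u : ℝ) ≤
            #{e ∈ B | e i = u ∧ ∀ i', i' ≠ i → Attached (spannedEdges p A) g3.choose i' (e i')} +
            #{e ∈ B | e i = u ∧
              ∃ i', i' ≠ i ∧ ¬ Attached (spannedEdges p A) g3.choose i' (e i')} := by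
          exact_mod_cast hsplit
        have : (d : ℝ) ≤ #{e ∈ B | e i = u ∧
            ∀ i', i' ≠ i → Attached (spannedEdges p A) g3.choose i' (e i')} := by
          linarith
        exact_mod_cast this
    · intro e he i i' hi hlow
      by_contra hlow'
      exact g5 ⟨e, hupper he, i, i', hi, not_le.1 hlow, not_le.1 hlow'⟩
  refine h1.trans ?_
  have h2 : prob₃ a b c (fun A _ _ => ¬ ∃ v, Base A v) ≤
      d * k * n / a / (δ * Fintype.card (Edge k n)) := by
    rw [prob₃_fst]
    refine le_trans (prob_mono ha0.le ha1 fun A hA => ?_)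
      (prob_card_compl_spannedEdges_gt p ha0 ha1 (mul_pos hδ0 hN0))
    by_contra hle
    exact hA (exists_transversals_attached (by omega) hd hε hδ0.le hδ hn _ (not_lt.1 hle))
  have h3 : prob₃ a b c (fun A B _ => Far A B) ≤
      k * n * (Real.exp (-(s * (t - d))) *
        Real.exp (Real.exp s * b * (k * (ε * n) * (n : ℝ) ^ (k - 2)))) := by
    rw [prob₃_snd]
    refine le_trans (expect_mono ha0.le ha1 fun A _ => ?_) (expect_const _).le
    by_cases h : ∃ v, Base A v
    · refine le_trans (prob_mono hb0 hb1 fun B hB => ?_) (prob_exists_card_bad_gt_le hb0 hb1 hs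
        (Attached (spannedEdges p A) h.choose) h.choose_spec.2.2)
      -- `Far` does not depend on the proof of `∃ v, Base A v`
      obtain ⟨_, i, u, hiu⟩ := hB
      exact ⟨i, u, hiu⟩
    · have : prob b univ (Far A) ≤ prob b univ fun _ : Subgraph k n => False :=
        prob_mono hb0 hb1 fun B hB => h hB.1
      rw [prob_const_event, if_neg not_false] at this
      exact this.trans (by positivity)
  have h4 : prob₃ a b c Low ≤ _ :=
    prob_exists_low_pair_le (t := t) ha0.le ha1 hb0 hb1 hc0 hc1 (s := 2) (by norm_num)
  have h5 := prob₃_union (a := a) (b := b) (c := c) (fun G : Subgraph k n => MinDegreeGE d G)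
  have h6 := prob₃_thd (a := a) (b := b) (c := c) (fun G : Subgraph k n => ¬ MinDegreeGE d G)
  have or_le := @prob₃_or_le k n a b c ha0.le ha1 hb0 hb1 hc0 hc1
  refine (or_le _ _).trans (add_le_add ((or_le _ _).trans (add_le_add ((or_le _ _).trans
    (add_le_add ((or_le _ _).trans (add_le_add h5.le h6.le)) h2)) h3)) h4)

end HittingTime

/-! ### The minimum degree threshold -/

section Asymptotics

lemma tendsto_log_natCast : Tendsto (fun n : ℕ => Real.log (n : ℝ)) atTop atTop :=
  Real.tendsto_log_atTop.comp tendsto_natCast_atTop_atTop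

lemma eventually_log_le_mul {η : ℝ} (hη : 0 < η) : ∀ᶠ x : ℝ in atTop, Real.log x ≤ η * x := by
  have h := Real.isLittleO_log_id_atTop.bound hη
  filter_upwards [h, eventually_ge_atTop 1] with x hx hx1
  rw [id, Real.norm_of_nonneg (Real.log_nonneg hx1), Real.norm_of_nonneg (by linarith)] at hx
  exact hx

lemma eventually_mul_sq_log_le (K : ℝ) : ∀ᶠ n : ℕ in atTop, K * Real.log n ^ 2 ≤ n := by
  have h := (Real.isLittleO_pow_log_id_atTop (n := 2)).bound
    (show (0 : ℝ) < 1 / (|K| + 1) by positivity)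
  filter_upwards [tendsto_natCast_atTop_atTop.eventually h] with n hn
  have hK : 0 < |K| + 1 := by positivity
  rw [id, Real.norm_of_nonneg (sq_nonneg _), Real.norm_of_nonneg (Nat.cast_nonneg n), one_div,
    inv_mul_eq_div, le_div_iff₀ hK] at hn
  nlinarith [le_abs_self K, sq_nonneg (Real.log (n : ℝ)), abs_nonneg K]

lemma one_sub_ge_exp {x : ℝ} (h1 : x ≤ 1 / 2) :
    Real.exp (-(x + 2 * x ^ 2)) ≤ 1 - x := by
  have h2 : 0 < 1 - x := by linarith
  have h3 : 1 / (1 - x) ≤ Real.exp (x + 2 * x ^ 2) := by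
    have h4 : 1 / (1 - x) ≤ (x + 2 * x ^ 2) + 1 := by
      rw [div_le_iff₀ h2]
      nlinarith [mul_nonneg (sq_nonneg x) (sub_nonneg.2 h1)]
    exact h4.trans (Real.add_one_le_exp _)
  rw [Real.exp_neg]
  rw [one_div] at h3
  exact inv_le_of_inv_le₀ h2 h3

/-- The expected number of vertices of degree `d - 1` in one class at the lower threshold. -/
lemma le_mul_choose_mul_pow {k n d : ℕ} (hk : 2 ≤ k) (hd : 1 ≤ d) (hn : 1 ≤ n) (hdn : 2 * d ≤ n)
    (hL1 : 4 * Real.log n ≤ n) (hL2 : 8 * Real.log n ^ 2 ≤ n) (hL0 : 0 < Real.log n)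
    (hLL0 : 0 < Real.log (Real.log n))
    (hy1 : Real.log n / 2 ≤ Real.log n + ((d : ℝ) - 1) * Real.log (Real.log n) -
      Real.log (Real.log (Real.log n)))
    (hy2 : Real.log n + ((d : ℝ) - 1) * Real.log (Real.log n) -
      Real.log (Real.log (Real.log n)) ≤ 2 * Real.log n) :
    Real.log (Real.log n) / (4 ^ (d - 1) * (d - 1).factorial * Real.exp 1) ≤
      n * ((n ^ (k - 1)).choose (d - 1) * pMinus k d n ^ (d - 1) *
        (1 - pMinus k d n) ^ (n ^ (k - 1) - (d - 1))) := by
  set L := Real.log (n : ℝ) with hL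
  set LL := Real.log L with hLL
  set y := L + ((d : ℝ) - 1) * LL - Real.log LL with hy
  set M := n ^ (k - 1) with hM
  obtain ⟨r, rfl⟩ : ∃ r, d = r + 1 := ⟨d - 1, by omega⟩
  simp only [Nat.add_sub_cancel]
  push_cast at hy
  rw [add_sub_cancel_right] at hy
  have hn0 : (0 : ℝ) < n := by exact_mod_cast hn
  have hnM : n ≤ M := by
    rw [hM]
    exact Nat.le_self_pow (by omega) n
  have hnM' : (n : ℝ) ≤ M := by exact_mod_cast hnM
  have hM0 : (0 : ℝ) < M := hn0.trans_le hnM'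
  have hp : pMinus k (r + 1) n = y / M := by
    rw [pMinus, hM]
    push_cast
    rw [← hL, ← hLL, hy, add_sub_cancel_right]
  rw [hp]
  set p := y / M with hpdef
  have hy0 : 0 ≤ y := by linarith
  have hp0 : 0 ≤ p := div_nonneg hy0 hM0.le
  have hp2 : p ≤ 1 / 2 := by
    rw [hpdef, div_le_iff₀ hM0]
    linarith
  have hpM : p * M = y := div_mul_cancel₀ _ hM0.ne'
  have h1 : (L / 4) ^ r / r.factorial ≤ M.choose r * p ^ r := by
    have h2 : (M : ℝ) / 2 ≤ ((M + 1 - r : ℕ) : ℝ) := by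
      rw [Nat.cast_sub (by omega)]
      push_cast
      have : 2 * ((r : ℝ) + 1) ≤ n := by exact_mod_cast hdn
      linarith
    have h3 := Nat.pow_le_choose (α := ℝ) r M
    calc (L / 4) ^ r / r.factorial ≤ (M / 2 * p) ^ r / r.factorial := by
          gcongr
          rw [div_mul_eq_mul_div, mul_comm (M : ℝ), hpM]
          linarith
      _ = (M / 2) ^ r / r.factorial * p ^ r := by rw [mul_pow]; ring
      _ ≤ ((M + 1 - r : ℕ) : ℝ) ^ r / r.factorial * p ^ r := by gcongr
      _ ≤ _ := by gcongr
  have h4 : Real.exp (-(y + 1)) ≤ (1 - p) ^ (M - r) := by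
    calc Real.exp (-(y + 1)) ≤ Real.exp (-(p + 2 * p ^ 2)) ^ M := by
          rw [← Real.exp_nat_mul, Real.exp_le_exp]
          have h5 : 2 * p ^ 2 * M ≤ 1 := by
            have : 2 * p ^ 2 * M = 2 * y ^ 2 / M := by rw [hpdef]; field_simp
            rw [this, div_le_one hM0]
            nlinarith
          nlinarith
      _ ≤ (1 - p) ^ M := pow_le_pow_left₀ (Real.exp_pos _).le (one_sub_ge_exp hp2) _
      _ ≤ (1 - p) ^ (M - r) :=
          pow_le_pow_of_le_one (by linarith) (by linarith) (Nat.sub_le _ _)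
  have h6 : n * Real.exp (-(y + 1)) = LL / (L ^ r * Real.exp 1) := by
    have e1 : Real.exp y = n * L ^ r / LL := by
      rw [hy, Real.exp_sub, Real.exp_add, Real.exp_nat_mul, hLL, Real.exp_log hL0, ← hLL,
        Real.exp_log hLL0, hL, Real.exp_log hn0]
    rw [Real.exp_neg, Real.exp_add, e1]
    have := hL0.ne'
    have := hLL0.ne'
    field_simp
  calc LL / (4 ^ r * r.factorial * Real.exp 1)
      = (L / 4) ^ r / r.factorial * (LL / (L ^ r * Real.exp 1)) := by
        rw [div_pow]
        have := hL0.ne'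
        field_simp
    _ = n * ((L / 4) ^ r / r.factorial * Real.exp (-(y + 1))) := by rw [← h6]; ring
    _ ≤ n * (M.choose r * p ^ r * (1 - p) ^ (M - r)) := by gcongr

/-- Below the threshold the minimum degree is less than `d`. -/
lemma tendsto_prob_minDegreeGE {k d : ℕ} (hk : 2 ≤ k) (hd : 1 ≤ d) {P : ℕ → ℝ}
    (hP : ∀ᶠ n in atTop, 0 ≤ P n) (hP' : ∀ᶠ n in atTop, P n ≤ pMinus k d n) :
    Tendsto (fun n : ℕ => prob (P n) (univ : Subgraph k n) (MinDegreeGE d)) atTop (𝓝 0) := by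
  have hLt := tendsto_log_natCast
  have hLLt : Tendsto (fun n : ℕ => Real.log (Real.log n)) atTop atTop :=
    Real.tendsto_log_atTop.comp hLt
  have hLLLt : Tendsto (fun n : ℕ => Real.log (Real.log (Real.log n))) atTop atTop :=
    Real.tendsto_log_atTop.comp hLLt
  have hd0 : (0 : ℝ) < d := by exact_mod_cast hd
  set K : ℝ := 4 ^ (d - 1) * (d - 1).factorial * Real.exp 1 with hK
  have hK0 : 0 < K := by positivity
  have hlim : Tendsto (fun n : ℕ => Real.exp (-(Real.log (Real.log n) / K))) atTop (𝓝 0) :=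
    Real.tendsto_exp_neg_atTop_nhds_zero.comp (hLLt.atTop_div_const hK0)
  have hev : ∀ᶠ n : ℕ in atTop, 0 ≤ prob (P n) (univ : Subgraph k n) (MinDegreeGE d) ∧
      prob (P n) (univ : Subgraph k n) (MinDegreeGE d) ≤
        Real.exp (-(Real.log (Real.log n) / K)) := by
    filter_upwards [hP, hP', hLt.eventually_ge_atTop 1, hLLt.eventually_ge_atTop 1,
      hLLLt.eventually_ge_atTop 1, eventually_mul_sq_log_le 8,
      hLt.eventually (eventually_log_le_mul (show (0 : ℝ) < 1 / (2 * d) by positivity)),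
      hLLt.eventually (eventually_log_le_mul (show (0 : ℝ) < 1 by positivity)),
      eventually_ge_atTop (2 * d)]
      with n h0 h1 hL1 hLL1 hLLL1 hsq hLL hLLL hdn
    have hn1 : 1 ≤ n := by omega
    have hd1 : (1 : ℝ) ≤ d := by exact_mod_cast hd
    have hLLd : d * Real.log (Real.log n) ≤ Real.log n / 2 := by
      rw [div_mul_eq_mul_div, one_mul, le_div_iff₀ (by positivity)] at hLL
      linarith
    have hy1 : Real.log n / 2 ≤ Real.log n + ((d : ℝ) - 1) * Real.log (Real.log n) -
      Real.log (Real.log (Real.log n)) := by nlinarith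
    have hy2 : Real.log n + ((d : ℝ) - 1) * Real.log (Real.log n) -
      Real.log (Real.log (Real.log n)) ≤ 2 * Real.log n := by nlinarith
    have hL4 : 4 * Real.log n ≤ n := by nlinarith
    have hm0 : 0 ≤ pMinus k d n := h0.trans h1
    have hm1 : pMinus k d n ≤ 1 := by
      rw [pMinus, div_le_one (by positivity)]
      have : (n : ℝ) ≤ (n : ℝ) ^ (k - 1) := by
        exact_mod_cast Nat.le_self_pow (show k - 1 ≠ 0 by omega) n
      linarith
    refine ⟨prob_nonneg h0 (h1.trans hm1) _, ?_⟩
    refine (prob_le_prob_of_le h0 h1 hm1 fun A B hAB hA => hA.mono hAB).trans ?_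
    refine (prob_minDegreeGE_le (by omega) hd hm0 hm1).trans ?_
    rw [Real.exp_le_exp, neg_le_neg_iff]
    exact le_mul_choose_mul_pow hk hd hn1 hdn hL4 hsq (by linarith) (by linarith) hy1 hy2
  exact tendsto_of_tendsto_of_tendsto_of_le_of_le' tendsto_const_nhds hlim
    (hev.mono fun n h => h.1) (hev.mono fun n h => h.2)

/-- Above the threshold the minimum degree is at least `d`. -/
lemma tendsto_prob_not_minDegreeGE {k d : ℕ} (hd : 1 ≤ d) {P : ℕ → ℝ}
    (hP1 : ∀ᶠ n in atTop, P n ≤ 1) (hP : ∀ᶠ n in atTop, pPlus k d n ≤ P n) :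
    Tendsto (fun n : ℕ => prob (P n) (univ : Subgraph k n) (fun G => ¬ MinDegreeGE d G)) atTop
      (𝓝 0) := by
  have hLt := tendsto_log_natCast
  have hLLt : Tendsto (fun n : ℕ => Real.log (Real.log n)) atTop atTop :=
    Real.tendsto_log_atTop.comp hLt
  have hLLLt : Tendsto (fun n : ℕ => Real.log (Real.log (Real.log n))) atTop atTop :=
    Real.tendsto_log_atTop.comp hLLt
  have hd0 : (0 : ℝ) < d := by exact_mod_cast hd
  have hlim : Tendsto (fun n : ℕ => k * 2 ^ (d - 1) * Real.exp 1 / Real.log (Real.log n)) atTop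
      (𝓝 0) := hLLt.const_div_atTop _
  have hev : ∀ᶠ n : ℕ in atTop,
      0 ≤ prob (P n) (univ : Subgraph k n) (fun G => ¬ MinDegreeGE d G) ∧
      prob (P n) (univ : Subgraph k n) (fun G => ¬ MinDegreeGE d G) ≤
        k * 2 ^ (d - 1) * Real.exp 1 / Real.log (Real.log n) := by
    filter_upwards [hP1, hP, hLt.eventually_ge_atTop 1, hLLt.eventually_ge_atTop 1,
      hLLLt.eventually_ge_atTop 1,
      hLt.eventually (eventually_log_le_mul (show (0 : ℝ) < 1 / (2 * d) by positivity)),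
      hLLt.eventually (eventually_log_le_mul (show (0 : ℝ) < 1 by positivity)),
      eventually_ge_atTop 1]
      with n h1 h2 hL1 hLL1 hLLL1 hLL hLLL hn1
    have hd1 : (1 : ℝ) ≤ d := by exact_mod_cast hd
    have hn0 : (0 : ℝ) < n := by exact_mod_cast hn1
    set L := Real.log (n : ℝ) with hL
    set LL := Real.log L with hLLdef
    have hLLd : d * LL ≤ L / 2 := by
      rw [div_mul_eq_mul_div, one_mul, le_div_iff₀ (by positivity)] at hLL
      linarith
    set y := L + ((d : ℝ) - 1) * LL + Real.log LL with hy
    have hM0 : (0 : ℝ) < (n : ℝ) ^ (k - 1) := by positivity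
    have hyL : y ≤ 2 * L := by nlinarith
    have hy1 : 1 ≤ y := by nlinarith
    have hyp : y ≤ P n * (n : ℝ) ^ (k - 1) := by
      rw [← div_le_iff₀ hM0]
      exact h2
    have hP0 : 0 ≤ P n := le_trans (div_nonneg (by linarith) hM0.le) h2
    refine ⟨prob_nonneg hP0 h1 _, (prob_not_minDegreeGE_le hd hP0 h1 hy1 hyp).trans ?_⟩
    have e1 : Real.exp y = n * L ^ (d - 1) * LL := by
      have : ((d : ℝ) - 1) = ((d - 1 : ℕ) : ℝ) := by rw [Nat.cast_sub hd]; simp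
      have a1 : Real.exp L = n := Real.exp_log hn0
      have a2 : Real.exp LL = L := Real.exp_log (by linarith)
      have a3 : Real.exp (Real.log LL) = LL := Real.exp_log (by linarith)
      rw [hy, this, Real.exp_add, Real.exp_add, Real.exp_nat_mul, a1, a2, a3]
    calc k * n * (y ^ (d - 1) * Real.exp (1 - y))
        ≤ k * n * ((2 * L) ^ (d - 1) * Real.exp (1 - y)) := by gcongr
      _ = _ := by
        rw [Real.exp_sub, e1, mul_pow]
        have : L ≠ 0 := by linarith
        have : LL ≠ 0 := by linarith
        field_simp
  exact tendsto_of_tendsto_of_tendsto_of_le_of_le' tendsto_const_nhds hlim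
    (hev.mono fun n h => h.1) (hev.mono fun n h => h.2)

end Asymptotics

/-! ### Rigidity at the hitting time and at the threshold -/

section MainLimit

variable {𝔽 : Type*} [RCLike 𝔽] {k d : ℕ}

lemma card_edge (k n : ℕ) : (Fintype.card (Edge k n) : ℝ) = (n : ℝ) ^ k := by
  simp [Edge]

/-- Asymptotically almost surely the graph at the hitting time is infinitesimally rigid. -/
lemma tendsto_uniformProb_not_infinitesimallyRigid (hd : 1 ≤ d) (hk : 3 ≤ k)
    (p : ∀ n, Config 𝔽 k n d) (hp : ∀ n, Generic (p n)) :
    Tendsto (fun n : ℕ => uniformProb (Ordering k n)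
      (fun w => ¬ InfinitesimallyRigid (graphAt w (hittingTime d w)) (p n))) atTop (𝓝 0) := by
  have hLt := tendsto_log_natCast
  have hLLt : Tendsto (fun n : ℕ => Real.log (Real.log n)) atTop atTop :=
    Real.tendsto_log_atTop.comp hLt
  have hk0 : (0 : ℝ) < k := by exact_mod_cast (by omega : 0 < k)
  have hd0 : (0 : ℝ) < d := by exact_mod_cast hd
  -- `A`, `B`, `C` have average degrees `(log n) / 10`, `4 (log n) / 5` and `2 log n`; a vertex is
  -- exceptional if its degree in `B` is less than `(log n) / 40`. The constants leave room in three
  -- places: `1/10 + 4/5 < 1` puts `A ∪ B` below the threshold and `2 > 1` puts `C` above it; the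
  -- exponent `120` beats the union bound, as `120 / 40 > 1 + 4/5`; and two exceptional vertices of
  -- an edge cost `n ^ (-11/10)`, which beats the `O(n log n)` edges.
  let M : ℕ → ℝ := fun n => (n : ℝ) ^ (k - 1)
  let a : ℕ → ℝ := fun n => Real.log n / (10 * M n)
  let b : ℕ → ℝ := fun n => 4 * Real.log n / (5 * M n)
  let c : ℕ → ℝ := fun n => 2 * Real.log n / M n
  set ε : ℝ := 1 / (k * Real.exp 120) with hε
  have hε0 : 0 < ε := by positivity
  set δ : ℝ := min ε 1 / (4 * k * d ^ 2) with hδ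
  have hδ0 : 0 < δ := div_pos (lt_min hε0 one_pos) (by positivity)
  have hδε : δ * (4 * k * d ^ 2) ≤ min ε 1 := (div_mul_cancel₀ _ (by positivity)).le
  have hev : ∀ᶠ n : ℕ in atTop, 10 ≤ n ∧ 1 ≤ Real.log n ∧ 0 < M n ∧ 0 < a n ∧ 0 < b n ∧ 0 < c n ∧
      a n ≤ 1 ∧ b n ≤ 1 ∧ c n ≤ 1 := by
    filter_upwards [hLt.eventually_ge_atTop 1, eventually_mul_sq_log_le 2, eventually_ge_atTop 10]
      with n h1 h2 h3
    have hn0 : (0 : ℝ) < n := by exact_mod_cast (by omega : 0 < n)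
    have hM0 : 0 < M n := by positivity
    have hnM : (n : ℝ) ≤ M n := by
      change (n : ℝ) ≤ (n : ℝ) ^ (k - 1)
      exact_mod_cast Nat.le_self_pow (show k - 1 ≠ 0 by omega) n
    have hLM : 2 * Real.log n ≤ M n := by nlinarith
    have hL0 : 0 < Real.log (n : ℝ) := by linarith
    refine ⟨h3, h1, hM0, by positivity, by positivity, by positivity, ?_, ?_, ?_⟩
    · rw [div_le_one (by positivity)]; linarith
    · rw [div_le_one (by positivity)]; linarith
    · rw [div_le_one (by positivity)]; linarith
  have hX1 : Tendsto (fun n : ℕ => prob (a n + b n - a n * b n) (univ : Subgraph k n)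
      (MinDegreeGE d)) atTop (𝓝 0) := by
    refine tendsto_prob_minDegreeGE (by omega) hd ?_ ?_
    · filter_upwards [hev] with n ⟨_, _, _, h1, h2, _, h3, h4, _⟩
      nlinarith
    · filter_upwards [hev, hLLt.eventually_ge_atTop 1, hLt.eventually (eventually_log_le_mul
        (show (0 : ℝ) < 1 / 10 by norm_num)),
        hLLt.eventually (eventually_log_le_mul (show (0 : ℝ) < 1 by norm_num))] with n
        ⟨_, _, hM0, h1, h2, _, h3, h4, _⟩ h5 h6 h7
      have e : a n + b n = (9 / 10 * Real.log n) / M n := by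
        simp only [a, b]
        field_simp
        ring
      refine le_trans (by nlinarith) (e.le.trans ?_)
      rw [pMinus]
      refine div_le_div_of_nonneg_right ?_ hM0.le
      have hd1 : (1 : ℝ) ≤ d := by exact_mod_cast hd
      nlinarith
  have hX2 : Tendsto (fun n : ℕ => prob (c n) (univ : Subgraph k n)
      (fun G => ¬ MinDegreeGE d G)) atTop (𝓝 0) := by
    refine tendsto_prob_not_minDegreeGE hd (hev.mono fun n h => h.2.2.2.2.2.2.2.2) ?_
    filter_upwards [hev, hLLt.eventually_ge_atTop 1,
        hLt.eventually (eventually_log_le_mul (show (0 : ℝ) < 1 / d by positivity)),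
        hLLt.eventually (eventually_log_le_mul (show (0 : ℝ) < 1 by norm_num))] with n
        ⟨_, _, hM0, _⟩ h5 h6 h7
    rw [pPlus]
    refine div_le_div_of_nonneg_right ?_ hM0.le
    rw [div_mul_eq_mul_div, one_mul, le_div_iff₀ hd0] at h6
    nlinarith
  have hX3 : Tendsto (fun n : ℕ => (10 * d * k / δ) / Real.log n) atTop (𝓝 0) :=
    hLt.const_div_atTop _
  have hX4 : Tendsto (fun n : ℕ => k * Real.exp (120 * d) * Real.exp (-Real.log n)) atTop
      (𝓝 0) := by
    simpa using (Real.tendsto_exp_neg_atTop_nhds_zero.comp hLt).const_mul (k * Real.exp (120 * d))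
  have hX5 : Tendsto (fun n : ℕ => 3 * (k : ℝ) ^ 2 * 20 * Real.exp (-(Real.log n / 20))) atTop
      (𝓝 0) := by
    simpa using (Real.tendsto_exp_neg_atTop_nhds_zero.comp
      (hLt.atTop_div_const (show (0 : ℝ) < 20 by norm_num))).const_mul (3 * (k : ℝ) ^ 2 * 20)
  have hsum := (((hX1.add hX2).add hX3).add hX4).add hX5
  simp only [add_zero] at hsum
  refine tendsto_of_tendsto_of_tendsto_of_le_of_le' tendsto_const_nhds hsum
    (Eventually.of_forall fun n => uniformProb_nonneg _) ?_
  filter_upwards [hev, eventually_gt_atTop (2 * k * d ^ 2)] with n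
    ⟨hn10, hL1, hM0, ha0, hb0, hc0, ha1, hb1, hc1⟩ hn
  refine (uniformProb_not_infinitesimallyRigid_le hk hd (hp n) (t := Real.log n / 40) (s := 120)
    ha0 ha1 hb0.le hb1 hc0.le hc1 hε0 hδ0 hδε hn (by norm_num)).trans ?_
  have hn0 : (0 : ℝ) < n := by exact_mod_cast (by omega : 0 < n)
  have hMn : M n = n * (n : ℝ) ^ (k - 2) := by
    simp only [M]
    rw [show k - 1 = (k - 2) + 1 by omega, pow_succ, mul_comm]
  have hN : (n : ℝ) ^ k = n * M n := by
    simp only [M]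
    rw [← pow_succ']
    congr 1
    omega
  have hexpL : Real.exp (Real.log (n : ℝ)) = n := Real.exp_log hn0
  rw [card_edge, hN]
  set L := Real.log (n : ℝ) with hL
  have hL0 : 0 < L := by linarith
  refine add_le_add (add_le_add (add_le_add le_rfl (le_of_eq ?_)) ?_) ?_
  · simp only [a]
    rw [← hL]
    field_simp
  · have e1 : Real.exp 120 * b n * (k * (ε * n) * (n : ℝ) ^ (k - 2)) = 4 / 5 * L := by
      rw [show (k : ℝ) * (ε * n) * (n : ℝ) ^ (k - 2) = k * ε * M n by rw [hMn]; ring]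
      simp only [b, hε]
      rw [← hL]
      field_simp
    rw [e1, ← Real.exp_add, mul_assoc, mul_assoc]
    refine mul_le_mul_of_nonneg_left ?_ hk0.le
    rw [← hexpL, ← Real.exp_add, ← Real.exp_add, Real.exp_le_exp]
    linarith
  · have e2 : Real.exp (-2) ≤ 14 / 100 := by
      have h1 := Real.exp_one_gt_d9
      have h2 : Real.exp 2 = Real.exp 1 * Real.exp 1 := by rw [← Real.exp_add]; norm_num
      rw [Real.exp_neg, inv_le_comm₀ (Real.exp_pos _) (by norm_num), h2]
      nlinarith
    have e3 : b n * (2 * ((n : ℝ) ^ (k - 1) - (n : ℝ) ^ (k - 2))) = 8 / 5 * L * (1 - 1 / n) := by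
      change b n * (2 * (M n - (n : ℝ) ^ (k - 2))) = _
      have h1 : (n : ℝ) ^ (k - 2) = M n / n := by rw [hMn]; field_simp
      rw [h1]
      simp only [b]
      rw [← hL]
      field_simp
      ring
    have e4 : 1 / (n : ℝ) ≤ 1 / 10 := by
      have : (10 : ℝ) ≤ n := by exact_mod_cast hn10
      exact one_div_le_one_div_of_le (by norm_num) this
    have e5 : (Real.exp (-2) - 1) * b n * (2 * ((n : ℝ) ^ (k - 1) - (n : ℝ) ^ (k - 2))) ≤
        -(12 / 10 * L) := by
      rw [mul_assoc, e3]
      have h1 : 8 / 5 * L * (9 / 10) ≤ 8 / 5 * L * (1 - 1 / n) := by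
        gcongr; linarith
      nlinarith
    have e6 : (n * M n) * (a n + b n + c n) = 29 / 10 * L * n := by
      simp only [a, b, c]
      rw [← hL]
      field_simp
      ring
    have e7 : L ≤ 20 * Real.exp (L / 20) := by
      have := Real.add_one_le_exp (L / 20)
      linarith
    calc n * M n * (k : ℝ) ^ 2 * ((a n + b n + c n) * (Real.exp (2 * 2 * (L / 40)) *
          Real.exp ((Real.exp (-2) - 1) * b n * (2 * ((n : ℝ) ^ (k - 1) - (n : ℝ) ^ (k - 2))))))
        ≤ n * M n * (k : ℝ) ^ 2 * ((a n + b n + c n) * (Real.exp (2 * 2 * (L / 40)) *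
          Real.exp (-(12 / 10 * L)))) := by gcongr
      _ = (k : ℝ) ^ 2 * ((n * M n) * (a n + b n + c n)) * (Real.exp (2 * 2 * (L / 40)) *
          Real.exp (-(12 / 10 * L))) := by ring
      _ = 29 / 10 * (k : ℝ) ^ 2 * L * Real.exp (-(L / 10)) := by
        rw [e6, ← Real.exp_add, ← hexpL,
          show (k : ℝ) ^ 2 * (29 / 10 * L * Real.exp L) *
            Real.exp (2 * 2 * (L / 40) + -(12 / 10 * L)) = 29 / 10 * (k : ℝ) ^ 2 * L *
            (Real.exp L * Real.exp (2 * 2 * (L / 40) + -(12 / 10 * L))) by ring, ← Real.exp_add]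
        congr 2
        ring
      _ ≤ 3 * (k : ℝ) ^ 2 * (20 * Real.exp (L / 20)) * Real.exp (-(L / 10)) := by
        gcongr
        norm_num
      _ = 3 * (k : ℝ) ^ 2 * 20 * Real.exp (-(L / 20)) := by
        rw [show -(L / 20) = L / 20 + -(L / 10) by ring, Real.exp_add]
        ring

lemma LocallyRigid.mono (hk : 1 ≤ k) {n : ℕ} (hn : 1 ≤ n) {G H : Subgraph k n} (hGH : G ⊆ H)
    (h : LocallyRigid 𝔽 d G) : LocallyRigid 𝔽 d H := by
  obtain ⟨p, hp⟩ := exists_generic 𝔽 k n d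
  rw [locallyRigid_iff_infinitesimallyRigid hk hn _ hp] at h ⊢
  exact h.mono hGH

lemma fullRigidityRank_iff_locallyRigid (hk : 1 ≤ k) {n : ℕ} (hn : 1 ≤ n) (G : Subgraph k n) :
    FullRigidityRank 𝔽 d G ↔ LocallyRigid 𝔽 d G := by
  obtain ⟨p, hp⟩ := exists_generic 𝔽 k n d
  rw [locallyRigid_iff_infinitesimallyRigid hk hn G hp]
  constructor
  · intro h
    exact (eRk_eq_iff_infinitesimallyRigid hk hn hp G).1 (h p hp)
  · intro h q hq
    exact (eRk_eq_iff_infinitesimallyRigid hk hn hq G).2 (h.of_generic hk hn hp hq)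

variable (𝔽) in
lemma tendsto_uniformProb_not_locallyRigid (hd : 1 ≤ d) (hk : 3 ≤ k) :
    Tendsto (fun n : ℕ => uniformProb (Ordering k n)
      (fun w => ¬ LocallyRigid 𝔽 d (graphAt w (hittingTime d w)))) atTop (𝓝 0) := by
  choose p hp using fun n => exists_generic 𝔽 k n d
  refine (tendsto_uniformProb_not_infinitesimallyRigid hd hk p hp).congr' ?_
  filter_upwards [eventually_ge_atTop 1] with n hn
  simp only [locallyRigid_iff_infinitesimallyRigid (by omega : 1 ≤ k) hn _ (hp n)]

variable (𝔽) in
lemma tendsto_uniformProb_locallyRigid (hd : 1 ≤ d) (hk : 3 ≤ k) :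
    Tendsto (fun n : ℕ => uniformProb (Ordering k n)
      (fun w => LocallyRigid 𝔽 d (graphAt w (hittingTime d w)))) atTop (𝓝 1) := by
  have h := (tendsto_uniformProb_not_locallyRigid 𝔽 hd hk).const_sub 1
  simpa [uniformProb_not] using h

/-- Conditioned on minimum degree at least `d`, the random subgraph contains the random process at
its hitting time. -/
lemma prob_not_locallyRigid_le (hk : 1 ≤ k) {n : ℕ} (hn : 1 ≤ n) {a : ℝ} (h0 : 0 ≤ a)
    (h1 : a ≤ 1) :
    prob a (univ : Subgraph k n) (fun G => ¬ LocallyRigid 𝔽 d G) ≤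
      prob a (univ : Subgraph k n) (fun G => ¬ MinDegreeGE d G) + uniformProb (Ordering k n)
      (fun w => ¬ LocallyRigid 𝔽 d (graphAt w (hittingTime d w))) := by
  have h2 : prob a (univ : Subgraph k n) (fun G => MinDegreeGE d G ∧ ¬ LocallyRigid 𝔽 d G) ≤
      uniformProb (Ordering k n)
      (fun w => ¬ LocallyRigid 𝔽 d (graphAt w (hittingTime d w))) := by
    refine prob_le_uniformProb h0 h1 _ _ fun w m ⟨hm, hnr⟩ hr => hnr ?_
    exact hr.mono hk hn (graphAt_mono w (hittingTime_le hm))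
  refine le_trans (prob_mono h0 h1 fun G hG => ?_) ((prob_or_le h0 h1 _ _).trans
    (add_le_add le_rfl h2))
  by_cases h : MinDegreeGE d G
  · exact Or.inr ⟨h, hG⟩
  · exact Or.inl h

end MainLimit

end TensorRigidity

theorem mainTheorem5 (𝔽 : Type*) [RCLike 𝔽] (d k : ℕ) (hd : 1 ≤ d) (hk : 3 ≤ k) :
    -- asymptotically almost surely, `G(n, M_d)` is locally rigid in `𝔽^d`
    Tendsto (fun n : ℕ => TensorRigidity.uniformProb (TensorRigidity.Ordering k n) fun w =>
        TensorRigidity.LocallyRigid 𝔽 d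
          (TensorRigidity.graphAt w (TensorRigidity.hittingTime d w))) atTop (𝓝 1) ∧
    -- asymptotically almost surely, `E(G(n, M_d))` has full rank in the generic rigidity matroid
    Tendsto (fun n : ℕ => TensorRigidity.uniformProb (TensorRigidity.Ordering k n) fun w =>
        TensorRigidity.FullRigidityRank 𝔽 d
          (TensorRigidity.graphAt w (TensorRigidity.hittingTime d w))) atTop (𝓝 1) ∧
    -- the two properties are equivalent, for every subgraph `G` of `K_n^k`
    (∀ n : ℕ, 1 ≤ n → ∀ G : TensorRigidity.Subgraph k n,
      ∀ p : TensorRigidity.Config 𝔽 k n d, TensorRigidity.Generic p →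
        (TensorRigidity.LocallyRigid 𝔽 d G ↔
          (TensorRigidity.tensorRigidityMatroid p).eRk (G : Set (TensorRigidity.Edge k n)) =
            ((d * k * n - d * (k - 1) : ℕ) : ℕ∞))) ∧
    -- above the threshold, `G(n, p)` is asymptotically almost surely locally rigid
    (∀ P : ℕ → ℝ, (∀ n, 0 ≤ P n ∧ P n ≤ 1) →
      (∀ᶠ n in atTop, TensorRigidity.pPlus k d n ≤ P n) →
      Tendsto (fun n : ℕ => TensorRigidity.binomialProb k n (P n)
        (TensorRigidity.LocallyRigid 𝔽 d)) atTop (𝓝 1)) ∧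
    -- below the threshold, `G(n, p)` is asymptotically almost surely not locally rigid
    (∀ P : ℕ → ℝ, (∀ n, 0 ≤ P n ∧ P n ≤ 1) →
      (∀ᶠ n in atTop, P n ≤ TensorRigidity.pMinus k d n) →
      Tendsto (fun n : ℕ => TensorRigidity.binomialProb k n (P n)
        (TensorRigidity.LocallyRigid 𝔽 d)) atTop (𝓝 0)) := by
  have hk1 : 1 ≤ k := by omega
  refine ⟨TensorRigidity.tendsto_uniformProb_locallyRigid 𝔽 hd hk, ?_, ?_, ?_, ?_⟩
  · refine (TensorRigidity.tendsto_uniformProb_locallyRigid 𝔽 hd hk).congr' ?_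
    filter_upwards [eventually_ge_atTop 1] with n hn
    simp only [TensorRigidity.fullRigidityRank_iff_locallyRigid hk1 hn]
  · intro n hn G p hp
    rw [TensorRigidity.locallyRigid_iff_infinitesimallyRigid hk1 hn G hp,
      TensorRigidity.eRk_eq_iff_infinitesimallyRigid hk1 hn hp]
  · intro P hP hPlus
    have h1 := TensorRigidity.tendsto_prob_not_minDegreeGE hd
      (Eventually.of_forall fun n => (hP n).2) hPlus
    have h2 := h1.add (TensorRigidity.tendsto_uniformProb_not_locallyRigid 𝔽 hd hk)
    rw [add_zero] at h2
    have h3 : Tendsto (fun n : ℕ => TensorRigidity.prob (P n)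
        (univ : TensorRigidity.Subgraph k n) (fun G => ¬ TensorRigidity.LocallyRigid 𝔽 d G))
        atTop (𝓝 0) := by
      refine tendsto_of_tendsto_of_tendsto_of_le_of_le' tendsto_const_nhds h2
        (Eventually.of_forall fun n => TensorRigidity.prob_nonneg (hP n).1 (hP n).2 _) ?_
      filter_upwards [eventually_ge_atTop 1] with n hn
      exact TensorRigidity.prob_not_locallyRigid_le hk1 hn (hP n).1 (hP n).2
    have h4 := h3.const_sub 1
    simpa [TensorRigidity.prob_not, TensorRigidity.binomialProb_eq_prob] using h4
  · intro P hP hMinus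
    refine tendsto_of_tendsto_of_tendsto_of_le_of_le' tendsto_const_nhds
      (TensorRigidity.tendsto_prob_minDegreeGE (by omega) hd
        (Eventually.of_forall fun n => (hP n).1) hMinus) ?_ ?_
    · refine Eventually.of_forall fun n => ?_
      rw [TensorRigidity.binomialProb_eq_prob]
      exact TensorRigidity.prob_nonneg (hP n).1 (hP n).2 _
    · filter_upwards [eventually_ge_atTop 2] with n hn
      rw [TensorRigidity.binomialProb_eq_prob]
      refine TensorRigidity.prob_mono (hP n).1 (hP n).2 fun G hG => ?_
      obtain ⟨p, hp⟩ := TensorRigidity.exists_generic 𝔽 k n d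
      exact ((TensorRigidity.locallyRigid_iff_infinitesimallyRigid hk1 (by omega) G hp).1
        hG).minDegreeGE hn hp.ne_zero
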